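/- **Notation.** Let $n,d,l\in\mathbb N=\{1,2,\dots\}$ and $p,r\in(0,\infty)$. A weight is a measurable function with values in $(0,\infty)$; cubes are open with sides parallel to the coordinate axes, and $r(Q)$ is the side length of $Q$. For $k\in\mathbb N_0$, $m\in\mathbb Z^n$ put $Q_{k,m}=\prod_{i=1}^n\bigl(\tfrac{m_i}{2^k},\tfrac{m_i+1}{2^k}\bigr)$. * A weight $w$ on $\mathbb R^N$ belongs to $A^{loc}_\infty(\mathbb R^N)$ if, for some $a>0$ and some $\alpha\in(0,1)$, the ratio $\int_Q w/\int_F w$ is bounded uniformly over all cubes $Q$ with $r(Q)\le a$ and all measurable $F\subset Q$ with $|F|\ge\alpha|Q|$. * A sequence of weights $\{s_k\}_{k\ge0}$ on $\mathbb R^n$ belongs to ${}^{loc}Y^{\alpha_3}_{\alpha_1,\alpha_2}$ with constant $C_1>0$ if $\frac1{C_1}2^{\alpha_1(k-j)}\le \frac{s_k(x)}{s_j(x)}\le C_12^{\alpha_2(k-j)}$ for all $0\le j\le k$, $x\in\mathbb R^n$, and $s_k(x)\le2^{\alpha_3}s_k(y)$ for all $k\ge 0$ and $|x-y|\le2^{-k}$.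 Put $s_{k,m}=\|s_k|L_p(Q_{k,m})\|$. * For a weight $\gamma$ on $\mathbb R^{n+d}$ put $\widehat\gamma_{k,m}=\|\gamma|L_p(\Xi_{k,m})\|$, $\Xi_{k,m}=Q_{k,m}\times(2^{-k}B^d\setminus2^{-k-1}B^d)$, where $B^d$ is the Euclidean unit ball of $\mathbb R^d$. * $\delta_1=\delta_1(\gamma,n,d)$ is the supremum of all $\delta>0$ for which there is $C$ with $\sum_{Q_{j,m'}\subset Q_{k,m}}\widehat\gamma_{j,m'}^{\,p}\le C2^{(k-j)d\delta}\,\widehat\gamma_{k,m}^{\,p}$ for all $0\le k\le j$ and $m\in\mathbb Z^n$. * $\delta_2=\delta_2(\gamma,n,d)$ is the supremum of all $\delta>0$ for which there is $C$ with $\sum_{Q_{j,m'}\in G}\widehat\gamma_{j,m'}^{\,p}\le C\bigl(|\bigcup_{Q\in G}Q|/|Q_{k,m}|\bigr)^{\delta}\sum_{Q_{j,m'}\subset Q_{k,m}}\widehat\gamma_{j,m'}^{\,p}$ for all $0\le k\le j$, $m\in\mathbb Z^n$ and all sets $G$ of cubes $Q_{j,m'}\subset Q_{k,m}$. * $\Delta^l(h)\varphi(x)=\sum_{i=0}^l(-1)^{l+i}\binom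 li\varphi(x+ih)$ and $\delta^l_r(Q)\varphi=\Bigl(r(Q)^{-2n}\int_{(-r(Q),r(Q))^n}\int_Q|\Delta^l(h)\varphi(x)|^r\,dx\,dh\Bigr)^{1/r}$. * $N^{l-1}$ is the $B$-spline of degree $l-1$ with knots $0,1,\dots,l$, $N^{l-1}_{k,m}(x)=\prod_{i=1}^nN^{l-1}(2^kx_i-m_i)$, and $\Sigma^{l-1}_k$ is the set of all $S=\sum_{m\in\mathbb Z^n}\beta_mN^{l-1}_{k,m}$ with real $\beta_m$. * For $\{t_{k,m}\}$ and $\varphi\in L_r^{loc}(\mathbb R^n)$ put, for $k\ge0$, $$s^l_k(\varphi)=\inf_{S\in\Sigma^{l-1}_k}\Bigl(\sum_{m\in\mathbb Z^n}t_{k,m}^p\,2^{knp/r}\|\varphi-S|L_r(Q_{k,m})\|^p\Bigr)^{1/p},\qquad s^l_{-1}(\varphi)=\Bigl(\sum_{m\in\mathbb Z^n}t_{0,m}^p\|\varphi|L_r(Q_{0,m})\|^p\Bigr)^{1/p}.$$ **Theorem.** Let $0<\alpha_1\le\alpha_2$, $\alpha_3\ge0$, $C_1>0$, $\varepsilon>0$,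 and let $\gamma$ be a weight on $\mathbb R^{n+d}$ with $\gamma^p\in A^{loc}_\infty(\mathbb R^{n+d})$. Put $\widetilde\lambda=\min\{l,\;l-1+\frac{\delta_2-\varepsilon}{p}\}$ and $\beta=\widetilde\lambda+\frac{d(\delta_1-\varepsilon)}{p}-\alpha_2$. Then there is a constant $C>0$, depending only on $n,d,l,p,r,\alpha_1,\alpha_2,\alpha_3,C_1,\varepsilon$ and $\gamma$, such that for every $\{s_k\}\in{}^{loc}Y^{\alpha_3}_{\alpha_1,\alpha_2}$ with constant $C_1$, every $0<\mu\le\min\{1,r,p\}$, every $\varphi\in L_r^{loc}(\mathbb R^n)$ and every $k\in\mathbb N_0$, with $t_{k,m}=2^{kn/p}s_{k,m}\widehat\gamma_{k,m}$, $$\Bigl(\sum_{m\in\mathbb Z^n}t_{k,m}^p\,[\delta^l_r(Q_{k,m})\varphi]^p\Bigr)^{1/p}\le C\,2^{-k\beta}\Bigl(\sum_{j=-1}^k2^{j\mu\beta}\bigl(s^l_j(\varphi)\bigr)^\mu\Bigr)^{1/\mu},$$ where both sides may be $+\infty$. -/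

import Mathlib

open MeasureTheory
open scoped ENNReal NNReal

noncomputable section

namespace VarSmooth

/-- The open cube with sides parallel to the axes, lower corner `c` and side length `s`. -/
def openCube {ι : Type*} (c : ι → ℝ) (s : ℝ) : Set (ι → ℝ) :=
  {x | ∀ i, c i < x i ∧ x i < c i + s}

/-- The dyadic cube `∏ (mᵢ / 2ᵏ, (mᵢ + 1) / 2ᵏ)`. -/
def dyadicCube {n : ℕ} (k : ℕ) (m : Fin n → ℤ) : Set (Fin n → ℝ) :=
  openCube (fun i => (m i : ℝ) / 2 ^ k) (1 / 2 ^ k)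

/-- A weight: a measurable function with values in `(0, ∞)`. -/
def IsWeight {ι : Type*} (w : (ι → ℝ) → ℝ) : Prop :=
  Measurable w ∧ ∀ x, 0 < w x

/-- `w(E) = ∫_E w`. -/
def weightMass {ι : Type*} [Fintype ι] (w : (ι → ℝ) → ℝ) (E : Set (ι → ℝ)) : ℝ≥0∞ :=
  ∫⁻ x in E, ENNReal.ofReal (w x)

/-- The local Muckenhoupt class `A_∞^loc`: for some bound `a > 0` on the side length and some
`α ∈ (0, 1)`, the ratio `w(Q) / w(F)` is bounded over all cubes `Q` of side length at most `a` and
all measurable `F ⊆ Q` with `|F| ≥ α |Q|`. Local integrability of `w` is a consequence: take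
`F = Q ∩ {w ≤ M}` with `M` large. -/
def ALocInfty {ι : Type*} [Fintype ι] (w : (ι → ℝ) → ℝ) : Prop :=
  IsWeight w ∧ ∃ a : ℝ, 0 < a ∧ ∃ α : ℝ, 0 < α ∧ α < 1 ∧ ∃ C : ℝ≥0,
    ∀ (c : ι → ℝ) (s : ℝ), 0 < s → s ≤ a → ∀ F : Set (ι → ℝ), MeasurableSet F →
      F ⊆ openCube c s → ENNReal.ofReal α * volume (openCube c s) ≤ volume F →
      weightMass w (openCube c s) ≤ C * weightMass w F

/-- The class `^loc Y^{α₃}_{α₁, α₂}` of weight sequences, with the constant `C₁` of the two-sided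
growth condition made explicit. The distance in the last condition is the Euclidean one. -/
structure LocY {n : ℕ} (α₁ α₂ α₃ C₁ : ℝ) (s : ℕ → (Fin n → ℝ) → ℝ) : Prop where
  isWeight : ∀ k, IsWeight (s k)
  lower : ∀ (j k : ℕ), j ≤ k → ∀ x,
    1 / C₁ * (2 : ℝ) ^ (α₁ * ((k : ℝ) - j)) ≤ s k x / s j x
  upper : ∀ (j k : ℕ), j ≤ k → ∀ x,
    s k x / s j x ≤ C₁ * (2 : ℝ) ^ (α₂ * ((k : ℝ) - j))
  compare : ∀ (k : ℕ) (x y : Fin n → ℝ),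
    dist (WithLp.toLp 2 x) (WithLp.toLp 2 y) ≤ 1 / 2 ^ k →
      s k x ≤ (2 : ℝ) ^ α₃ * s k y

/-- The quasi-norm `‖f | L_p(E)‖`, for `p ∈ (0, ∞)`. -/
def lpNormOn {ι : Type*} [Fintype ι] (f : (ι → ℝ) → ℝ) (p : ℝ) (E : Set (ι → ℝ)) : ℝ≥0∞ :=
  eLpNorm f (ENNReal.ofReal p) (volume.restrict E)

/-- `φ ∈ L_r^loc(ℝⁿ)`. -/
def MemLpLoc {n : ℕ} (φ : (Fin n → ℝ) → ℝ) (r : ℝ) : Prop :=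
  ∀ K : Set (Fin n → ℝ), IsCompact K → MemLp φ (ENNReal.ofReal r) (volume.restrict K)

/-- The set `Ξ_{k,m} = Q_{k,m} × (2^{-k} B^d \ 2^{-k-1} B^d)`, where `B^d` is the Euclidean unit
ball. Points of `ℝ^{n+d}` have coordinates indexed by `Fin n ⊕ Fin d`. -/
def shellBox {n : ℕ} (d k : ℕ) (m : Fin n → ℤ) : Set (Fin n ⊕ Fin d → ℝ) :=
  {z | (fun i => z (Sum.inl i)) ∈ dyadicCube k m ∧
    1 / 2 ^ (k + 1) ≤ ‖WithLp.toLp 2 (fun i : Fin d => z (Sum.inr i))‖ ∧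
    ‖WithLp.toLp 2 (fun i : Fin d => z (Sum.inr i))‖ < 1 / 2 ^ k}

/-- The multiple sequence generated by the weight `γ`: `‖γ | L_p(Ξ_{k,m})‖`. -/
def gammaHat {n d : ℕ} (γ : (Fin n ⊕ Fin d → ℝ) → ℝ) (p : ℝ) (k : ℕ) (m : Fin n → ℤ) : ℝ≥0∞ :=
  lpNormOn γ p (shellBox d k m)

/-- Indices of the dyadic cubes of generation `j` that lie in `Q_{k,m}`. -/
def subcubes {n : ℕ} (k : ℕ) (m : Fin n → ℤ) (j : ℕ) : Set (Fin n → ℤ) :=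
  {m' | dyadicCube j m' ⊆ dyadicCube k m}

/-- `δ₁(γ, n, d)`: the supremum of the `δ > 0` for which, with a constant `C`,
`∑_{Q_{j,m'} ⊆ Q_{k,m}} γ̂_{j,m'}^p ≤ C 2^{(k-j) d δ} γ̂_{k,m}^p` for all `k ≤ j` and `m`. -/
def delta1 {n d : ℕ} (γ : (Fin n ⊕ Fin d → ℝ) → ℝ) (p : ℝ) : ℝ :=
  sSup {δ : ℝ | 0 < δ ∧ ∃ C : ℝ≥0, ∀ (k j : ℕ), k ≤ j → ∀ m : Fin n → ℤ,
    ∑' m' : subcubes k m j, gammaHat γ p j m' ^ p ≤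
      C * (2 : ℝ≥0∞) ^ (((k : ℝ) - j) * d * δ) * gammaHat γ p k m ^ p}

/-- `δ₂(γ, n, d)`: the supremum of the `δ > 0` for which, with a constant `C`,
`∑_{Q ∈ G} γ̂_Q^p ≤ C (|⋃ G| / |Q_{k,m}|)^δ ∑_{Q_{j,m'} ⊆ Q_{k,m}} γ̂_{j,m'}^p` for all `k ≤ j`, all
`m` and all sets `G` of dyadic cubes of generation `j` contained in `Q_{k,m}`. -/
def delta2 {n d : ℕ} (γ : (Fin n ⊕ Fin d → ℝ) → ℝ) (p : ℝ) : ℝ :=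
  sSup {δ : ℝ | 0 < δ ∧ ∃ C : ℝ≥0, ∀ (k j : ℕ), k ≤ j → ∀ m : Fin n → ℤ,
    ∀ G : Set (Fin n → ℤ), G ⊆ subcubes k m j →
      ∑' m' : G, gammaHat γ p j m' ^ p ≤
        C * (volume (⋃ m' ∈ G, dyadicCube j m') / volume (dyadicCube k m)) ^ δ *
          ∑' m' : subcubes k m j, gammaHat γ p j m' ^ p}

/-- `t_{k,m} = 2^{kn/p} s_{k,m} γ̂_{k,m}` with `s_{k,m} = ‖s_k | L_p(Q_{k,m})‖`. -/
def tSeq {n d : ℕ} (s : ℕ → (Fin n → ℝ) → ℝ) (γ : (Fin n ⊕ Fin d → ℝ) → ℝ) (p : ℝ)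
    (k : ℕ) (m : Fin n → ℤ) : ℝ≥0∞ :=
  (2 : ℝ≥0∞) ^ ((k : ℝ) * n / p) * lpNormOn (s k) p (dyadicCube k m) * gammaHat γ p k m

/-- The averaged difference
`δ^l_r(Q) φ = (r(Q)^{-2n} ∫_{r(Q) Iⁿ} ∫_Q |Δ^l(h) φ(x)|^r dx dh)^{1/r}`, `Iⁿ = (-1, 1)ⁿ`,
for the cube `Q` with lower corner `c` and side length `r(Q) = s`. -/
def localDiff {n : ℕ} (l : ℕ) (r : ℝ) (c : Fin n → ℝ) (s : ℝ) (φ : (Fin n → ℝ) → ℝ) : ℝ≥0∞ :=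
  ((ENNReal.ofReal (s ^ (2 * n)))⁻¹ *
    ∫⁻ h in openCube (fun _ : Fin n => -s) (2 * s), ∫⁻ x in openCube c s,
      ‖(fwdDiff h)^[l] φ x‖ₑ ^ r) ^ (1 / r)

/-- `δ^l_r(Q_{k,m}) φ`. -/
def dyadicDiff {n : ℕ} (l : ℕ) (r : ℝ) (k : ℕ) (m : Fin n → ℤ) (φ : (Fin n → ℝ) → ℝ) : ℝ≥0∞ :=
  localDiff l r (fun i => (m i : ℝ) / 2 ^ k) (1 / 2 ^ k) φ

/-- The `B`-spline `N^{l-1}` of degree `l - 1` (for `l ≥ 1`) with knots `0, 1, …, l`: the divided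
difference of order `l` at the knots of the truncated power `(t - ·)_+^{l-1}`, normalized so that
the integer translates form a partition of unity. For `l = 1` it is the indicator of `[0, 1)`. -/
def bSpline (l : ℕ) (t : ℝ) : ℝ :=
  ((l - 1).factorial : ℝ)⁻¹ * ∑ i ∈ Finset.range (l + 1),
    (-1 : ℝ) ^ i * (l.choose i : ℝ) * (if (i : ℝ) ≤ t then (t - i) ^ (l - 1) else 0)

/-- `N^{l-1}_{k,m}(x) = ∏ᵢ N^{l-1}(2ᵏ (xᵢ - mᵢ / 2ᵏ))`. -/
def bSplineN {n : ℕ} (l k : ℕ) (m : Fin n → ℤ) (x : Fin n → ℝ) : ℝ :=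
  ∏ i, bSpline l (2 ^ k * (x i - (m i : ℝ) / 2 ^ k))

/-- `Σ^{l-1}_k`: all splines `∑_m β_m N^{l-1}_{k,m}`. At each point only finitely many terms are
nonzero. -/
def splineSpace (n l k : ℕ) : Set ((Fin n → ℝ) → ℝ) :=
  {S | ∃ β : (Fin n → ℤ) → ℝ, ∀ x, S x = ∑ᶠ m, β m * bSplineN l k m x}

/-- The weighted best spline approximation error
`s^l_k = inf_{S ∈ Σ^{l-1}_k} (∑_m t_{k,m}^p (2^{kn/r} ‖φ - S | L_r(Q_{k,m})‖)^p)^{1/p}`. -/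
def splineError {n : ℕ} (l : ℕ) (r p : ℝ) (t : ℕ → (Fin n → ℤ) → ℝ≥0∞)
    (φ : (Fin n → ℝ) → ℝ) (k : ℕ) : ℝ≥0∞ :=
  ⨅ S ∈ splineSpace n l k,
    (∑' m, t k m ^ p *
      ((2 : ℝ≥0∞) ^ ((k : ℝ) * n / r) * lpNormOn (φ - S) r (dyadicCube k m)) ^ p) ^ (1 / p)

/-- `s^l_{-1} = (∑_m t_{0,m}^p ‖φ | L_r(Q_{0,m})‖^p)^{1/p}`. -/
def splineErrorInit {n : ℕ} (r p : ℝ) (t : ℕ → (Fin n → ℤ) → ℝ≥0∞)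
    (φ : (Fin n → ℝ) → ℝ) : ℝ≥0∞ :=
  (∑' m, t 0 m ^ p * lpNormOn φ r (dyadicCube 0 m) ^ p) ^ (1 / p)

/-- The exponent `λ̃ + d (δ₁ - ε) / p - α₂`, with `λ̃ = min {l, l - 1 + (δ₂ - ε) / p}`. -/
def rate {n d : ℕ} (l : ℕ) (p α₂ ε : ℝ) (γ : (Fin n ⊕ Fin d → ℝ) → ℝ) : ℝ :=
  min (l : ℝ) ((l : ℝ) - 1 + (delta2 γ p - ε) / p) + d * (delta1 γ p - ε) / p - α₂

end VarSmooth

end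

/-!
Take near-best splines `S j` of generation `j` and write
`φ = (φ - S k) + S 0 + ∑ j ∈ {1, …, k}, (S j - S (j - 1))`. The differences of `φ - S k` on a cell
are controlled by its norms on the neighbouring cells, because `γ ^ p` is locally doubling.

Let `σ` be a spline of generation `j` and `θ = 2 ^ (j - k)`. An `l`-th difference of `σ` with step
`2 ^ (-k)` is of order `θ ^ l` where all its nodes lie in one cell of generation `j`, since `σ` is a
polynomial there, and only of order `θ ^ (l - 1)` across the cell boundaries, where `σ` loses one
order of smoothness. The boundary layer fills a proportion `θ` of the cell, so `δ₂` gives its weight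
an extra factor `θ ^ (δ₂ - ε)`; this is where `λ̃` comes from. The total weight over the cell decays
like `θ ^ (d (δ₁ - ε))`, while `s k / s j` is at most of order `θ ^ (-α₂)`. Finally the spline
coefficients are bounded by the `L_r` norms on the cells, by compactness on one reference cell, and
the `μ`-triangle inequality sums the scales.
-/

namespace VarSmooth

section Differences

variable {M R : Type*} [AddCommMonoid M] {h x : M} {a : ℕ}

theorem fwdDiff_iter_congr {G : Type*} [AddCommGroup G] {f g : M → G}
    (hfg : ∀ i ≤ a, f (x + i • h) = g (x + i • h)) :
    (fwdDiff h)^[a] f x = (fwdDiff h)^[a] g x := by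
  simp only [fwdDiff_iter_eq_sum_shift]
  exact Finset.sum_congr rfl fun i hi => by rw [hfg i (Finset.mem_range_succ_iff.1 hi)]

theorem fwdDiff_iter_comp_nsmul {G : Type*} [AddCommGroup G] (f : M → G) :
    (fwdDiff 1)^[a] (fun i : ℕ => f (x + i • h)) 0 = (fwdDiff h)^[a] f x := by
  simp [fwdDiff_iter_eq_sum_shift]

theorem fwdDiff_iter_mul [CommRing R] (u v : M → R) :
    (fwdDiff h)^[a] (u * v) x = ∑ ij ∈ Finset.HasAntidiagonal.antidiagonal a,
      (a.choose ij.1 : R) *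
        ((fwdDiff h)^[ij.1] u x * (fwdDiff h)^[ij.2] v (x + ij.1 • h)) := by
  induction a generalizing x with
  | zero => simp
  | succ a ih =>
    rw [Finset.sum_antidiagonal_choose_succ_mul
        (fun i j => (fwdDiff h)^[i] u x * (fwdDiff h)^[j] v (x + i • h)),
      Function.iterate_succ_apply', fwdDiff, ih, ih, ← Finset.sum_sub_distrib,
      ← Finset.sum_add_distrib]
    refine Finset.sum_congr rfl fun ij hij => ?_
    rw [Nat.choose_symm_of_eq_add (Finset.HasAntidiagonal.mem_antidiagonal.1 hij).symm,
      Function.iterate_succ_apply' _ ij.1, Function.iterate_succ_apply' _ ij.2, fwdDiff, fwdDiff,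
      succ_nsmul', ← add_assoc, add_right_comm x (ij.1 • h) h]
    ring

end Differences

/-- The differences of order `a` of the sequence `u`, taken within `{0, …, l}`, are at most
`B * θ ^ min a κ`. The order `κ` caps the decay in `a`: it is `l` for polynomial data and `l - 1`
for splines of degree `l - 1` sampled across a knot. -/
def DiffBound (l κ : ℕ) (θ B : ℝ) (u : ℕ → ℝ) : Prop :=
  ∀ a i : ℕ, i + a ≤ l → |(fwdDiff 1)^[a] u i| ≤ B * θ ^ min a κ

section DiffBound

variable {l κ q : ℕ} {θ η t R B B' : ℝ} {u v : ℕ → ℝ}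

theorem DiffBound.mono (h : B ≤ B') (hθ : 0 ≤ θ) (hu : DiffBound l κ θ B u) :
    DiffBound l κ θ B' u :=
  fun a i hi => (hu a i hi).trans (by gcongr)

theorem DiffBound.congr (h : ∀ i ≤ l, u i = v i) (hv : DiffBound l κ θ B v) :
    DiffBound l κ θ B u := fun a i hi => by
  rw [fwdDiff_iter_congr fun j hj => h _ (by simp only [smul_eq_mul, mul_one]; omega)]
  exact hv a i hi

theorem DiffBound.mul (hθ0 : 0 ≤ θ) (hθ1 : θ ≤ 1) (hB : 0 ≤ B) (hB' : 0 ≤ B')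
    (hu : DiffBound l κ θ B u) (hv : DiffBound l κ θ B' v) :
    DiffBound l κ θ (2 ^ l * (B * B')) (u * v) := by
  intro a i hi
  have hterm : ∀ bc ∈ Finset.HasAntidiagonal.antidiagonal a,
      |(fwdDiff 1)^[bc.1] u i * (fwdDiff 1)^[bc.2] v (i + bc.1 • 1)| ≤
        B * B' * θ ^ min a κ := by
    intro bc hbc
    have hsum : bc.1 + bc.2 = a := Finset.HasAntidiagonal.mem_antidiagonal.1 hbc
    calc _ ≤ B * θ ^ min bc.1 κ * (B' * θ ^ min bc.2 κ) := by
          rw [abs_mul]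
          exact mul_le_mul (hu _ _ (by omega))
            (hv _ _ (by simp only [smul_eq_mul, mul_one]; omega)) (abs_nonneg _) (by positivity)
      _ = B * B' * θ ^ (min bc.1 κ + min bc.2 κ) := by ring
      _ ≤ B * B' * θ ^ min a κ := by
          gcongr B * B' * ?_
          exact pow_le_pow_of_le_one hθ0 hθ1 (by omega)
  calc |(fwdDiff 1)^[a] (u * v) i|
      ≤ ∑ bc ∈ Finset.HasAntidiagonal.antidiagonal a,
          (a.choose bc.1 : ℝ) * (B * B' * θ ^ min a κ) := by
        rw [fwdDiff_iter_mul]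
        refine (Finset.abs_sum_le_sum_abs _ _).trans (Finset.sum_le_sum fun bc hbc => ?_)
        rw [abs_mul, Nat.abs_cast]
        exact mul_le_mul_of_nonneg_left (hterm bc hbc) (Nat.cast_nonneg _)
    _ = 2 ^ a * (B * B' * θ ^ min a κ) := by
        have hchoose := congrArg (Nat.cast (R := ℝ)) (Nat.sum_range_choose a)
        push_cast at hchoose
        rw [← Finset.sum_mul, Finset.Nat.sum_antidiagonal_eq_sum_range_succ_mk, hchoose]
    _ ≤ 2 ^ l * (B * B') * θ ^ min a κ := by
        rw [← mul_assoc]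
        gcongr
        · norm_num
        · omega

theorem DiffBound.sum {ι : Type*} (s : Finset ι) (c : ι → ℝ) {u : ι → ℕ → ℝ}
    (hu : ∀ i ∈ s, DiffBound l κ θ B (u i)) :
    DiffBound l κ θ (∑ i ∈ s, |c i| * B) (∑ i ∈ s, c i • u i) := by
  intro a j hj
  rw [fwdDiff_iter_finsetSum, Finset.sum_apply, Finset.sum_mul]
  refine (Finset.abs_sum_le_sum_abs _ _).trans (Finset.sum_le_sum fun i hi => ?_)
  rw [fwdDiff_iter_const_smul, Pi.smul_apply, smul_eq_mul, abs_mul, mul_assoc]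
  exact mul_le_mul_of_nonneg_left (hu i hi a j hj) (abs_nonneg _)

theorem diffBound_const (hθ : 0 ≤ θ) (c : ℝ) : DiffBound l κ θ |c| fun _ => c := by
  rintro (_ | a) i _
  · simp
  · rw [Function.iterate_succ_apply, fwdDiff_const,
      Function.iterate_fixed (fwdDiff_const (G := ℝ) (1 : ℕ) 0), abs_zero]
    positivity

theorem DiffBound.prod {ι : Type*} (hθ0 : 0 ≤ θ) (hθ1 : θ ≤ 1) (hB : 0 ≤ B) (s : Finset ι)
    {u : ι → ℕ → ℝ} (hu : ∀ i ∈ s, DiffBound l κ θ B (u i)) :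
    DiffBound l κ θ ((2 ^ l * B) ^ s.card) (∏ i ∈ s, u i) := by
  classical
  induction s using Finset.induction_on with
  | empty => simpa [Pi.one_def] using diffBound_const hθ0 1
  | insert i s hi ih =>
    rw [Finset.prod_insert hi, Finset.card_insert_of_notMem hi, pow_succ', mul_assoc]
    exact (hu i (by simp)).mul hθ0 hθ1 hB (by positivity) (ih fun j hj => hu j (by simp [hj]))

theorem diffBound_of_abs_le (hθ0 : 0 ≤ θ) (hθ1 : θ ≤ 1) (hB : 0 ≤ B)
    (hu : ∀ i ≤ l, |u i| ≤ B * θ ^ κ) : DiffBound l κ θ (2 ^ l * B) u := by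
  have hiter : ∀ a i, i + a ≤ l → |(fwdDiff 1)^[a] u i| ≤ 2 ^ a * (B * θ ^ κ) := by
    intro a
    induction a with
    | zero => simpa using hu
    | succ a ih =>
      intro i hi
      rw [Function.iterate_succ_apply', pow_succ', mul_assoc, two_mul]
      exact (abs_sub _ _).trans (add_le_add (ih _ (by omega)) (ih _ (by omega)))
  intro a i hi
  calc |(fwdDiff 1)^[a] u i| ≤ 2 ^ a * (B * θ ^ κ) := hiter a i hi
    _ ≤ 2 ^ l * (B * θ ^ min a κ) := by
        gcongr ?_ * (B * ?_)
        · exact pow_le_pow_right₀ one_le_two (by omega)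
        · exact pow_le_pow_of_le_one hθ0 hθ1 (min_le_right _ _)
    _ = 2 ^ l * B * θ ^ min a κ := (mul_assoc _ _ _).symm

theorem diffBound_affine (hη : |η| ≤ θ) (hθ1 : θ ≤ 1) (ht : |t| ≤ R) :
    DiffBound l κ θ (R + l + 1) fun i => t + i * η := by
  have hθ0 : 0 ≤ θ := (abs_nonneg _).trans hη
  have hR : 0 ≤ R := (abs_nonneg _).trans ht
  have hdiff : fwdDiff 1 (fun i : ℕ => t + i * η) = fun _ => η := by
    funext j
    simp only [fwdDiff, Nat.cast_add, Nat.cast_one]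
    ring
  rintro (_ | a) i hi
  · have hstep : |(i : ℝ) * η| ≤ l * 1 := by
      rw [abs_mul, Nat.abs_cast]
      exact mul_le_mul (by exact_mod_cast hi) (hη.trans hθ1) (abs_nonneg _) (Nat.cast_nonneg _)
    simp only [Function.iterate_zero, id, zero_le, inf_of_le_left, pow_zero]
    linarith [abs_add_le t (i * η)]
  · rw [Function.iterate_succ_apply, hdiff]
    rcases a with _ | a
    · calc |η| ≤ 1 * θ ^ 1 := by simpa using hη
        _ ≤ (R + l + 1) * θ ^ min 1 κ := by
          gcongr ?_ * ?_
          · linarith [Nat.cast_nonneg (α := ℝ) l]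
          · exact pow_le_pow_of_le_one hθ0 hθ1 (min_le_left _ _)
    · rw [Function.iterate_succ_apply, fwdDiff_const,
        Function.iterate_fixed (fwdDiff_const (G := ℝ) (1 : ℕ) 0), abs_zero]
      positivity

/-- The truncated power `t₊^q`, with `0₊^0 = 1`. -/
noncomputable def truncPow (q : ℕ) (t : ℝ) : ℝ := if 0 ≤ t then t ^ q else 0

theorem truncPow_of_nonneg (ht : 0 ≤ t) : truncPow q t = t ^ q := if_pos ht

theorem truncPow_of_neg (ht : t < 0) : truncPow q t = 0 := if_neg ht.not_ge

theorem abs_truncPow_le (h : t ≤ R) (hR : 0 ≤ R) : |truncPow q t| ≤ R ^ q := by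
  rcases le_or_gt 0 t with ht | ht
  · rw [truncPow_of_nonneg ht, abs_of_nonneg (pow_nonneg ht q)]
    exact pow_le_pow_left₀ ht h q
  · simpa only [truncPow_of_neg ht, abs_zero] using pow_nonneg hR q

theorem diffBound_truncPow (hη : |η| ≤ θ) (hθ1 : θ ≤ 1) (ht : |t| ≤ R)
    (hside : κ ≤ q ∨ (∀ i : ℕ, i ≤ l → 0 ≤ t + i * η) ∨ ∀ i : ℕ, i ≤ l → t + i * η < 0) :
    DiffBound l κ θ ((2 ^ l * (R + l + 1)) ^ q + 2 ^ l * l ^ q)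
      fun i => truncPow q (t + i * η) := by
  have hθ0 : 0 ≤ θ := (abs_nonneg _).trans hη
  have hR : 0 ≤ R := (abs_nonneg _).trans ht
  by_cases hpos : ∀ i : ℕ, i ≤ l → 0 ≤ t + i * η
  · refine DiffBound.congr (fun i hi => truncPow_of_nonneg (hpos i hi)) ?_
    have := DiffBound.prod (l := l) (κ := κ) hθ0 hθ1 (by positivity) (Finset.range q)
      fun _ _ => diffBound_affine hη hθ1 ht
    rw [Finset.prod_const, Finset.card_range] at this
    exact this.mono (le_add_of_nonneg_right (by positivity)) hθ0
  by_cases hneg : ∀ i : ℕ, i ≤ l → t + i * η < 0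
  · refine DiffBound.congr (fun i hi => truncPow_of_neg (hneg i hi)) ?_
    exact (diffBound_const hθ0 0).mono (by rw [abs_zero]; positivity) hθ0
  -- A sign change confines all the sample points to `(-∞, l * θ]`.
  have hκ : κ ≤ q := hside.resolve_right fun h => h.elim hpos hneg
  push Not at hpos
  obtain ⟨i₀, hi₀, h₀⟩ := hpos
  have hsmall : ∀ i : ℕ, i ≤ l → t + i * η ≤ l * θ := by
    intro i hi
    have hdist : |((i : ℝ) - i₀)| ≤ l := by
      rw [abs_le]
      have : (i : ℝ) ≤ l ∧ (i₀ : ℝ) ≤ l := by exact_mod_cast And.intro hi hi₀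
      constructor <;> linarith [Nat.cast_nonneg (α := ℝ) i, Nat.cast_nonneg (α := ℝ) i₀]
    calc t + i * η ≤ (i - i₀) * η := by linarith
      _ ≤ |(i : ℝ) - i₀| * |η| := (le_abs_self _).trans (abs_mul _ _).le
      _ ≤ l * θ := mul_le_mul hdist hη (abs_nonneg _) (Nat.cast_nonneg _)
  refine (diffBound_of_abs_le (B := l ^ q) hθ0 hθ1 (by positivity) fun i hi => ?_).mono
    (le_add_of_nonneg_left (by positivity)) hθ0
  calc |truncPow q (t + i * η)| ≤ (l * θ) ^ q := abs_truncPow_le (hsmall i hi) (by positivity)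
    _ = l ^ q * θ ^ q := mul_pow _ _ _
    _ ≤ l ^ q * θ ^ κ := by gcongr ?_ * ?_; exact pow_le_pow_of_le_one hθ0 hθ1 hκ

end DiffBound

section BSpline

variable {l κ : ℕ} {θ η t R : ℝ}

theorem bSpline_eq_truncPow (l : ℕ) (t : ℝ) :
    bSpline l t = ∑ i ∈ Finset.range (l + 1),
      (((l - 1).factorial : ℝ)⁻¹ * ((-1 : ℝ) ^ i * l.choose i)) * truncPow (l - 1) (t - i) := by
  simp only [bSpline, truncPow, Finset.mul_sum, sub_nonneg, mul_assoc]

theorem bSpline_eq_fwdDiff (l : ℕ) (t : ℝ) :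
    bSpline l t = ((l - 1).factorial : ℝ)⁻¹ * (fwdDiff 1)^[l] (truncPow (l - 1)) (t - l) := by
  rw [bSpline_eq_truncPow, fwdDiff_iter_eq_sum_shift, ← Finset.sum_range_reflect,
    Finset.mul_sum]
  refine Finset.sum_congr rfl fun i hi => ?_
  have hil : i ≤ l := Finset.mem_range_succ_iff.1 hi
  rw [show l + 1 - 1 - i = l - i by omega, Nat.choose_symm hil, Nat.cast_sub hil, zsmul_eq_mul,
    nsmul_eq_mul, mul_one, sub_sub_eq_add_sub, add_sub_right_comm, mul_assoc]
  push_cast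
  ring

theorem bSpline_of_neg (l : ℕ) (ht : t < 0) : bSpline l t = 0 := by
  rw [bSpline_eq_truncPow]
  refine Finset.sum_eq_zero fun i _ => ?_
  rw [truncPow_of_neg (by linarith [Nat.cast_nonneg (α := ℝ) i]), mul_zero]

theorem bSpline_of_ge (hl : 0 < l) (ht : l ≤ t) : bSpline l t = 0 := by
  have hpoly : (fwdDiff 1)^[l] (truncPow (l - 1)) (t - l) =
      (fwdDiff 1)^[l] (fun y : ℝ => y ^ (l - 1)) (t - l) :=
    fwdDiff_iter_congr fun i _ => truncPow_of_nonneg <| by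
      rw [nsmul_eq_mul, mul_one]
      linarith [Nat.cast_nonneg (α := ℝ) i]
  rw [bSpline_eq_fwdDiff, hpoly, fwdDiff_iter_pow_eq_zero_of_lt (by omega), Pi.zero_apply,
    mul_zero]

theorem diffBound_bSpline (l : ℕ) (hR : 0 ≤ R) : ∃ B : ℝ, 0 ≤ B ∧
    ∀ (κ : ℕ) (t η θ : ℝ), |η| ≤ θ → θ ≤ 1 → |t| ≤ R →
      (κ < l ∨ ∀ i : ℕ, i ≤ l → ⌊t + i * η⌋ = ⌊t⌋) →
      DiffBound l κ θ B fun i => bSpline l (t + i * η) := by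
  refine ⟨∑ s ∈ Finset.range (l + 1), |((l - 1).factorial : ℝ)⁻¹ * ((-1 : ℝ) ^ s * l.choose s)| *
    ((2 ^ l * (R + l + l + 1)) ^ (l - 1) + 2 ^ l * l ^ (l - 1)), by positivity, ?_⟩
  intro κ t η θ hη hθ ht hcell
  have hsum : (fun i : ℕ => bSpline l (t + i * η)) = ∑ s ∈ Finset.range (l + 1),
      (((l - 1).factorial : ℝ)⁻¹ * ((-1 : ℝ) ^ s * l.choose s)) •
        fun i : ℕ => truncPow (l - 1) (t - s + i * η) := by
    funext i
    simp only [bSpline_eq_truncPow, Finset.sum_apply, Pi.smul_apply, smul_eq_mul,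
      add_sub_right_comm]
  rw [hsum]
  refine DiffBound.sum _ _ fun s hs => diffBound_truncPow hη hθ ?_ ?_
  · have : (s : ℝ) ≤ l := by exact_mod_cast Finset.mem_range_succ_iff.1 hs
    linarith [abs_sub t s, Nat.abs_cast (R := ℝ) s]
  · refine hcell.imp (fun h => by omega) fun hfloor => ?_
    have hiff : ∀ i : ℕ, i ≤ l → (0 ≤ t - s + i * η ↔ (s : ℤ) ≤ ⌊t⌋) := by
      intro i hi
      rw [← hfloor i hi, Int.le_floor, Int.cast_natCast, sub_add_eq_add_sub, sub_nonneg]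
    rcases le_or_gt (s : ℤ) ⌊t⌋ with h | h
    · exact Or.inl fun i hi => (hiff i hi).2 h
    · exact Or.inr fun i hi => not_le.1 fun h0 => h.not_ge ((hiff i hi).1 h0)

end BSpline

section Spline

variable {n l k : ℕ} {m : Fin n → ℤ} {x : Fin n → ℝ}

theorem bSplineN_eq (l k : ℕ) (m : Fin n → ℤ) (x : Fin n → ℝ) :
    bSplineN l k m x = ∏ q, bSpline l (2 ^ k * x q - m q) := by
  refine Finset.prod_congr rfl fun q _ => ?_
  rw [mul_sub, mul_div_cancel₀ _ (by positivity)]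

/-- The index of the half-open dyadic cube of side length `2⁻ᵏ` that contains `x`. -/
noncomputable def cellIndex (k : ℕ) (x : Fin n → ℝ) : Fin n → ℤ := fun q => ⌊2 ^ k * x q⌋

/-- The offsets `e ∈ ℤⁿ` with `|e|_∞ ≤ L`. -/
noncomputable def offsets (n L : ℕ) : Finset (Fin n → ℤ) :=
  Fintype.piFinset fun _ => Finset.Icc (-(L : ℤ)) L

theorem mem_offsets {L : ℕ} {e : Fin n → ℤ} : e ∈ offsets n L ↔ ∀ q, |e q| ≤ L := by
  simp only [offsets, Fintype.mem_piFinset, Finset.mem_Icc, abs_le]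

theorem mem_Ioc_of_bSplineN_ne_zero (hl : 0 < l) (h : bSplineN l k m x ≠ 0) (q : Fin n) :
    m q ∈ Set.Ioc (cellIndex k x q - l) (cellIndex k x q) := by
  have hq : bSpline l (2 ^ k * x q - m q) ≠ 0 := by
    rw [bSplineN_eq] at h
    exact Finset.prod_ne_zero_iff.1 h q (Finset.mem_univ q)
  constructor
  · rw [sub_lt_iff_lt_add', add_comm, cellIndex, Int.floor_lt]
    contrapose! hq
    exact bSpline_of_ge hl (by push_cast at hq; linarith)
  · rw [cellIndex, Int.le_floor]
    contrapose! hq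
    exact bSpline_of_neg l (by linarith)

theorem finite_support_bSplineN (hl : 0 < l) (k : ℕ) (x : Fin n → ℝ) :
    (Function.support fun m => bSplineN l k m x).Finite :=
  (Set.finite_Icc (fun q => cellIndex k x q - l) (cellIndex k x)).subset fun _ hm =>
    ⟨fun q => (mem_Ioc_of_bSplineN_ne_zero hl hm q).1.le,
      fun q => (mem_Ioc_of_bSplineN_ne_zero hl hm q).2⟩

/-- The linear map that sends the coefficients `β` to the spline `∑_m β_m N^{l-1}_{k,m}`. -/
noncomputable def splineMap (hl : 0 < l) (k : ℕ) :
    ((Fin n → ℤ) → ℝ) →ₗ[ℝ] (Fin n → ℝ) → ℝ where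
  toFun β x := ∑ᶠ m, β m * bSplineN l k m x
  map_add' β β' := by
    funext x
    have hfin := finite_support_bSplineN hl k x
    simp only [Pi.add_apply, add_mul]
    exact finsum_add_distrib (hfin.subset (Function.support_mul_subset_right _ _))
      (hfin.subset (Function.support_mul_subset_right _ _))
  map_smul' c β := by
    funext x
    simp only [Pi.smul_apply, smul_eq_mul, mul_assoc, RingHom.id_apply]
    rw [mul_finsum]

theorem splineMap_apply (hl : 0 < l) (β : (Fin n → ℤ) → ℝ) :
    splineMap hl k β x = ∑ᶠ m, β m * bSplineN l k m x := rfl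

theorem splineSpace_eq_range (hl : 0 < l) (k : ℕ) :
    splineSpace n l k = LinearMap.range (splineMap (n := n) hl k) := by
  ext S
  simp only [splineSpace, Set.mem_ofPred_eq, SetLike.mem_coe, LinearMap.mem_range, funext_iff,
    splineMap_apply, eq_comm]

theorem splineMap_apply_eq_sum (hl : 0 < l) (β : (Fin n → ℤ) → ℝ) (s : Finset (Fin n → ℤ))
    (hs : ∀ m, bSplineN l k m x ≠ 0 → m ∈ s) :
    splineMap hl k β x = ∑ m ∈ s, β m * bSplineN l k m x :=
  finsum_eq_sum_of_support_subset _ fun _ hm => hs _ (right_ne_zero_of_mul hm)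

theorem splineMap_apply_eq_sum_offsets (hl : 0 < l) (β : (Fin n → ℤ) → ℝ) {L : ℕ}
    (hm : ∀ q, |cellIndex k x q - m q| + l ≤ L) :
    splineMap hl k β x = ∑ e ∈ offsets n L, β (m + e) * bSplineN l k (m + e) x := by
  rw [splineMap_apply_eq_sum hl β ((offsets n L).map (Equiv.addLeft m).toEmbedding),
    Finset.sum_map]
  · rfl
  · intro m' hm'
    refine Finset.mem_map.2 ⟨m' - m, mem_offsets.2 fun q => ?_, add_sub_cancel _ _⟩
    have hdist := abs_le.1 (le_sub_right_of_add_le (hm q))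
    have hmem := mem_Ioc_of_bSplineN_ne_zero hl hm' q
    rw [Pi.sub_apply, abs_le]
    constructor <;> linarith [hmem.1, hmem.2, hdist.1, hdist.2]

theorem exists_abs_fwdDiff_bSplineN_le (n l : ℕ) {R : ℝ} (hR : 0 ≤ R) : ∃ B : ℝ, 0 ≤ B ∧
    ∀ κ ≤ l, ∀ (j : ℕ) (m : Fin n → ℤ) (x h : Fin n → ℝ) (θ : ℝ), 0 ≤ θ → θ ≤ 1 →
      (∀ q, |2 ^ j * h q| ≤ θ) → (∀ q, |2 ^ j * x q - m q| ≤ R) →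
      (κ < l ∨ ∀ i ≤ l, cellIndex j (x + i • h) = cellIndex j x) →
      |(fwdDiff h)^[l] (bSplineN l j m) x| ≤ B * θ ^ κ := by
  obtain ⟨B, hB, hbound⟩ := diffBound_bSpline l hR
  refine ⟨(2 ^ l * B) ^ n, by positivity, ?_⟩
  intro κ hκ j m x h θ hθ0 hθ1 hh hx hcell
  have hline : (fun i : ℕ => bSplineN l j m (x + i • h)) =
      ∏ q, fun i : ℕ => bSpline l (2 ^ j * x q - m q + i * (2 ^ j * h q)) := by
    funext i
    rw [bSplineN_eq, Finset.prod_apply]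
    refine Finset.prod_congr rfl fun q _ => congrArg _ ?_
    rw [Pi.add_apply, Pi.smul_apply, nsmul_eq_mul]
    ring
  have hprod := DiffBound.prod hθ0 hθ1 hB Finset.univ fun q _ =>
    hbound κ (2 ^ j * x q - m q) (2 ^ j * h q) θ (hh q) hθ1 (hx q) <| hcell.imp_right
      fun hcell i hi => by
        have hfloor : ⌊2 ^ j * (x q + i * h q)⌋ = ⌊2 ^ j * x q⌋ := by
          rw [← nsmul_eq_mul]
          exact congrFun (hcell i hi) q
        rw [sub_add_eq_add_sub, Int.floor_sub_intCast, Int.floor_sub_intCast, ← hfloor]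
        ring_nf
  rw [← fwdDiff_iter_comp_nsmul, hline]
  simpa only [Finset.card_univ, Fintype.card_fin, min_eq_right hκ] using hprod l 0 (zero_add l).le

theorem abs_cellIndex_add_sub_le {j : ℕ} {x v : Fin n → ℝ} {N : ℕ} {q : Fin n}
    (hv : |2 ^ j * v q| ≤ N) : |cellIndex j (x + v) q - cellIndex j x q| ≤ N := by
  have hv := abs_le.1 hv
  rw [abs_le, cellIndex, cellIndex, Pi.add_apply, mul_add]
  constructor
  · rw [neg_le_sub_iff_le_add, ← sub_le_iff_le_add, Int.le_floor]
    push_cast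
    linarith [Int.floor_le (2 ^ j * x q)]
  · rw [sub_le_iff_le_add, ← Int.lt_add_one_iff, Int.floor_lt]
    push_cast
    linarith [Int.lt_floor_add_one (2 ^ j * x q)]

theorem exists_abs_fwdDiff_splineMap_le (n : ℕ) (hl : 0 < l) : ∃ B : ℝ, 0 ≤ B ∧
    ∀ κ ≤ l, ∀ (j : ℕ) (β : (Fin n → ℤ) → ℝ) (x h : Fin n → ℝ) (θ : ℝ), 0 ≤ θ → θ ≤ 1 →
      (∀ q, |2 ^ j * h q| ≤ θ) →
      (κ < l ∨ ∀ i ≤ l, cellIndex j (x + i • h) = cellIndex j x) →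
      |(fwdDiff h)^[l] (splineMap hl j β) x| ≤
        B * θ ^ κ * ∑ e ∈ offsets n (2 * l), |β (cellIndex j x + e)| := by
  obtain ⟨B, hB, hbound⟩ := exists_abs_fwdDiff_bSplineN_le n l (R := 2 * l + 1) (by positivity)
  refine ⟨B, hB, ?_⟩
  intro κ hκ j β x h θ hθ0 hθ1 hh hcell
  set m := cellIndex j x
  have hlocal : (fwdDiff h)^[l] (splineMap hl j β) x =
      (fwdDiff h)^[l] (∑ e ∈ offsets n (2 * l), β (m + e) • bSplineN l j (m + e)) x := by
    refine fwdDiff_iter_congr fun i hi => ?_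
    have hnear : ∀ q, |cellIndex j (x + i • h) q - m q| ≤ l := fun q =>
      abs_cellIndex_add_sub_le <| by
        rw [Pi.smul_apply, nsmul_eq_mul, mul_left_comm, abs_mul, Nat.abs_cast]
        exact (mul_le_mul (Nat.cast_le.2 hi) ((hh q).trans hθ1) (abs_nonneg _)
          (Nat.cast_nonneg _)).trans_eq (mul_one _)
    rw [splineMap_apply_eq_sum_offsets hl β (m := m) (L := 2 * l)
      fun q => by push_cast; linarith [hnear q]]
    simp only [Finset.sum_apply, Pi.smul_apply, smul_eq_mul]
  have hterm : ∀ e ∈ offsets n (2 * l),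
      |(fwdDiff h)^[l] (bSplineN l j (m + e)) x| ≤ B * θ ^ κ := by
    refine fun e he => hbound κ hκ j (m + e) x h θ hθ0 hθ1 hh (fun q => ?_) hcell
    have he' : |(e q : ℝ)| ≤ 2 * l := by exact_mod_cast mem_offsets.1 he q
    have hm : |2 ^ j * x q - m q| ≤ 1 := by
      rw [show 2 ^ j * x q - m q = Int.fract (2 ^ j * x q) from rfl, Int.abs_fract]
      exact (Int.fract_lt_one _).le
    rw [Pi.add_apply, Int.cast_add, ← sub_sub]
    linarith [abs_sub (2 ^ j * x q - m q) (e q)]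
  rw [hlocal, fwdDiff_iter_finsetSum, Finset.sum_apply, Finset.mul_sum]
  refine (Finset.abs_sum_le_sum_abs _ _).trans (Finset.sum_le_sum fun e he => ?_)
  rw [fwdDiff_iter_const_smul, Pi.smul_apply, smul_eq_mul, abs_mul, mul_comm]
  exact mul_le_mul_of_nonneg_right (hterm e he) (abs_nonneg _)

end Spline

section Refinement

variable {n l k : ℕ}

/-- The identity behind this is `(1 + X)^l (1 - X)^l = (1 - X²)^l`. -/
theorem sum_choose_mul_sum_neg_one_pow_choose {R : Type*} [CommRing R] (l : ℕ) (f : ℕ → R) :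
    ∑ i ∈ Finset.range (l + 1), (l.choose i : R) *
        ∑ s ∈ Finset.range (l + 1), (-1) ^ s * (l.choose s : R) * f (i + s) =
      ∑ i ∈ Finset.range (l + 1), (-1) ^ i * (l.choose i : R) * f (2 * i) := by
  let ev : Polynomial R →ₗ[R] R := (Polynomial.basisMonomials R).constr R f
  have hev : ∀ i, ev (Polynomial.X ^ i) = f i := fun i => by
    simpa [Polynomial.monomial_one_right_eq_X_pow] using
      (Polynomial.basisMonomials R).constr_basis R f i
  have hsub : ∀ P : Polynomial R, (1 - P) ^ l =
      ∑ i ∈ Finset.range (l + 1), ((-1) ^ i * (l.choose i : R)) • P ^ i := fun P => by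
    rw [sub_eq_neg_add, add_pow]
    refine Finset.sum_congr rfl fun i _ => ?_
    rw [Polynomial.smul_eq_C_mul, neg_pow]
    simp only [one_pow, mul_one, map_mul, map_pow, map_neg, map_one, map_natCast]
    ring
  have hadd : (1 + Polynomial.X : Polynomial R) ^ l =
      ∑ i ∈ Finset.range (l + 1), (l.choose i : R) • Polynomial.X ^ i := by
    rw [add_comm, add_pow]
    refine Finset.sum_congr rfl fun i _ => ?_
    rw [Polynomial.smul_eq_C_mul, one_pow, mul_one, map_natCast, mul_comm]
  have hpoly : (1 + Polynomial.X : Polynomial R) ^ l * (1 - Polynomial.X) ^ l =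
      (1 - Polynomial.X ^ 2) ^ l := by
    rw [← mul_pow]
    ring
  rw [hadd, hsub, hsub, Finset.sum_mul_sum] at hpoly
  simpa only [smul_mul_smul_comm, ← pow_add, ← pow_mul, map_sum, map_smul, hev, smul_eq_mul,
    Finset.mul_sum, mul_assoc] using congrArg ev hpoly

theorem truncPow_mul {c : ℝ} (hc : 0 < c) (q : ℕ) (t : ℝ) :
    truncPow q (c * t) = c ^ q * truncPow q t := by
  simp only [truncPow, mul_nonneg_iff_of_pos_left hc, mul_pow, mul_ite, mul_zero]

theorem bSpline_refine (l : ℕ) (t : ℝ) :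
    bSpline l t = ∑ i ∈ Finset.range (l + 1),
      ((2 : ℝ) ^ (l - 1))⁻¹ * l.choose i * bSpline l (2 * t - i) := by
  have hsum := sum_choose_mul_sum_neg_one_pow_choose l fun i => truncPow (l - 1) (2 * t - i)
  have hdouble : ∀ i : ℕ, truncPow (l - 1) (2 * t - (2 * i : ℕ)) =
      2 ^ (l - 1) * truncPow (l - 1) (t - i) := fun i => by
    rw [← truncPow_mul two_pos, Nat.cast_mul, Nat.cast_ofNat, mul_sub]
  simp only [hdouble, Nat.cast_add, ← sub_sub] at hsum
  have hfine : ∀ i : ℕ, bSpline l (2 * t - i) = ((l - 1).factorial : ℝ)⁻¹ *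
      ∑ s ∈ Finset.range (l + 1), (-1) ^ s * l.choose s * truncPow (l - 1) (2 * t - i - s) :=
    fun i => by simp only [bSpline_eq_truncPow, Finset.mul_sum, mul_assoc]
  calc bSpline l t
      = ((2 : ℝ) ^ (l - 1))⁻¹ * (((l - 1).factorial : ℝ)⁻¹ * ∑ i ∈ Finset.range (l + 1),
          (-1) ^ i * l.choose i * (2 ^ (l - 1) * truncPow (l - 1) (t - i))) := by
        rw [bSpline_eq_truncPow, Finset.mul_sum, Finset.mul_sum]
        refine Finset.sum_congr rfl fun i _ => ?_
        field_simp
    _ = _ := by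
        rw [← hsum, Finset.mul_sum, Finset.mul_sum]
        refine Finset.sum_congr rfl fun i _ => ?_
        rw [hfine]
        ring

theorem bSplineN_refine (l k : ℕ) (m : Fin n → ℤ) (x : Fin n → ℝ) :
    bSplineN l k m x = ∑ i ∈ Fintype.piFinset fun _ : Fin n => Finset.range (l + 1),
      (∏ q, ((2 : ℝ) ^ (l - 1))⁻¹ * l.choose (i q)) *
        bSplineN l (k + 1) (fun q => 2 * m q + i q) x := by
  simp only [bSplineN_eq, bSpline_refine l (2 ^ k * x _ - m _), ← Finset.prod_mul_distrib,
    Finset.prod_univ_sum]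
  refine Finset.sum_congr rfl fun i _ => Finset.prod_congr rfl fun q _ => ?_
  push_cast
  ring_nf

theorem finsum_extend_zero_mul {α α' R : Type*} [NonUnitalNonAssocSemiring R] {e : α → α'}
    (he : Function.Injective e) (β : α → R) (g : α' → R) :
    ∑ᶠ b, Function.extend e β 0 b * g b = ∑ᶠ a, β a * g (e a) := by
  rw [← finsum_mem_univ, finsum_mem_inter_support_eq' _ Set.univ (Set.range e),
    finsum_mem_range he]
  · simp only [he.extend_apply]
  · refine fun b hb => iff_of_true trivial ?_
    by_contra hnot
    exact left_ne_zero_of_mul hb (Function.extend_apply' _ _ _ hnot)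

theorem splineMap_eq_sum_extend (hl : 0 < l) (β : (Fin n → ℤ) → ℝ) :
    splineMap hl k β = ∑ i ∈ Fintype.piFinset fun _ : Fin n => Finset.range (l + 1),
      (∏ q, ((2 : ℝ) ^ (l - 1))⁻¹ * l.choose (i q)) •
        splineMap hl (k + 1) (Function.extend (fun m q => 2 * m q + i q) β 0) := by
  have hinj : ∀ i : Fin n → ℕ, Function.Injective fun (m : Fin n → ℤ) q => 2 * m q + i q :=
    fun i m m' h => funext fun q => by simpa using congrFun h q
  funext x
  simp only [Finset.sum_apply, Pi.smul_apply, smul_eq_mul, splineMap_apply,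
    finsum_extend_zero_mul (hinj _), mul_finsum, bSplineN_refine l k, Finset.mul_sum]
  rw [finsum_sum_comm _ _ fun i _ =>
    ((finite_support_bSplineN hl (k + 1) x).preimage (hinj i).injOn).subset fun m hm =>
      right_ne_zero_of_mul (right_ne_zero_of_mul hm)]
  simp only [mul_left_comm]

theorem range_splineMap_mono (hl : 0 < l) :
    Monotone fun k => LinearMap.range (splineMap (n := n) hl k) := by
  refine monotone_nat_of_le_succ fun k => ?_
  rintro _ ⟨β, rfl⟩
  rw [splineMap_eq_sum_extend]
  exact Submodule.sum_mem _ fun i _ => Submodule.smul_mem _ _ ⟨_, rfl⟩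

end Refinement

section Cube

variable {ι : Type*}

theorem openCube_eq_pi (c : ι → ℝ) (s : ℝ) :
    openCube c s = Set.univ.pi fun i => Set.Ioo (c i) (c i + s) := by
  ext x
  simp only [openCube, Set.mem_ofPred_eq, Set.mem_univ_pi, Set.mem_Ioo]

theorem isOpen_openCube [Finite ι] (c : ι → ℝ) (s : ℝ) : IsOpen (openCube c s) := by
  rw [openCube_eq_pi]
  exact isOpen_set_pi Set.finite_univ fun i _ => isOpen_Ioo

theorem measurableSet_openCube [Finite ι] (c : ι → ℝ) (s : ℝ) : MeasurableSet (openCube c s) :=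
  (isOpen_openCube c s).measurableSet

theorem volume_openCube [Fintype ι] (c : ι → ℝ) (s : ℝ) :
    volume (openCube c s) = ENNReal.ofReal s ^ Fintype.card ι := by
  simp only [openCube_eq_pi, Real.volume_pi_Ioo, add_sub_cancel_left, Finset.prod_const,
    Finset.card_univ]

theorem measurableSet_dyadicCube {n : ℕ} (k : ℕ) (m : Fin n → ℤ) :
    MeasurableSet (dyadicCube k m) :=
  measurableSet_openCube _ _

theorem mem_dyadicCube {n k : ℕ} {m : Fin n → ℤ} {x : Fin n → ℝ} :
    x ∈ dyadicCube k m ↔ ∀ q, (m q : ℝ) < 2 ^ k * x q ∧ 2 ^ k * x q < m q + 1 := by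
  have hk : (0 : ℝ) < 2 ^ k := by positivity
  simp only [dyadicCube, openCube, Set.mem_ofPred_eq, ← add_div, div_lt_iff₀ hk, lt_div_iff₀ hk,
    mul_comm]

theorem cellIndex_of_mem_dyadicCube {n k : ℕ} {m : Fin n → ℤ} {x : Fin n → ℝ}
    (hx : x ∈ dyadicCube k m) : cellIndex k x = m :=
  funext fun q => Int.floor_eq_iff.2 ⟨(mem_dyadicCube.1 hx q).1.le, (mem_dyadicCube.1 hx q).2⟩

theorem setLIntegral_openCube [Fintype ι] (c : ι → ℝ) {s : ℝ} (hs : 0 < s) (f : (ι → ℝ) → ℝ≥0∞) :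
    ∫⁻ x in openCube c s, f x =
      ENNReal.ofReal s ^ Fintype.card ι * ∫⁻ y in openCube 0 1, f (c + s • y) := by
  let e : (ι → ℝ) ≃ₜ (ι → ℝ) := (Homeomorph.smulOfNeZero s hs.ne').trans (Homeomorph.addLeft c)
  have hpre : e ⁻¹' openCube c s = openCube 0 1 := by
    ext y
    simp only [e, openCube, Set.mem_preimage, Set.mem_ofPred_eq, Homeomorph.trans_apply,
      Homeomorph.smulOfNeZero_apply, Homeomorph.coe_addLeft, Pi.add_apply, Pi.smul_apply,
      smul_eq_mul, lt_add_iff_pos_right, add_lt_add_iff_left, mul_pos_iff_of_pos_left hs,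
      mul_lt_iff_lt_one_right hs, Pi.zero_apply, zero_add]
  have hmap : (volume : Measure (ι → ℝ)) =
      ENNReal.ofReal s ^ Fintype.card ι • volume.map e := by
    have hcomp : (volume : Measure (ι → ℝ)).map e =
        ENNReal.ofReal |(s ^ Fintype.card ι)⁻¹| • volume := by
      rw [show ⇑e = (c + ·) ∘ (s • ·) from rfl, ← Measure.map_map (by fun_prop) (by fun_prop),
        Measure.map_addHaar_smul _ hs.ne', Measure.map_smul, Module.finrank_fintype_fun_eq_card,
        map_add_left_eq_self]
    rw [hcomp, smul_smul, abs_of_pos (by positivity), ← ENNReal.ofReal_pow hs.le,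
      ← ENNReal.ofReal_mul (by positivity), mul_inv_cancel₀ (by positivity), ENNReal.ofReal_one,
      one_smul]
  conv_lhs => rw [hmap]
  rw [Measure.restrict_smul, lintegral_smul_measure, smul_eq_mul,
    e.measurableEmbedding.restrict_map, e.measurableEmbedding.lintegral_map, hpre]
  rfl

end Cube

section Stability

open Polynomial

theorem aemeasurable_enorm_sum_mul_rpow {ι Ω : Type*} [Fintype ι] [MeasurableSpace Ω]
    {μ : Measure Ω} {f : ι → Ω → ℝ} (hf : ∀ i, AEMeasurable (f i) μ) (b : ι → ℝ) (r : ℝ) :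
    AEMeasurable (fun x => ‖∑ i, b i * f i x‖ₑ ^ r) μ :=
  (Finset.aemeasurable_fun_sum _ fun i _ => (hf i).const_mul (b i)).enorm.pow_const r

theorem lowerSemicontinuous_lintegral_enorm_sum_mul_rpow {ι Ω : Type*} [Fintype ι]
    [MeasurableSpace Ω] {μ : Measure Ω} {f : ι → Ω → ℝ} (hf : ∀ i, AEMeasurable (f i) μ) (r : ℝ) :
    LowerSemicontinuous fun b : ι → ℝ => ∫⁻ x, ‖∑ i, b i * f i x‖ₑ ^ r ∂μ := by
  refine lowerSemicontinuous_iff_le_liminf.2 fun b => (lintegral_mono fun x => ?_).trans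
    (lintegral_liminf_le' fun b => aemeasurable_enorm_sum_mul_rpow hf b r)
  have hcont : Continuous fun b : ι → ℝ => ‖∑ i, b i * f i x‖ₑ ^ r :=
    ENNReal.continuous_rpow_const.comp (by fun_prop)
  exact (hcont.tendsto b).liminf_eq.ge

theorem exists_enorm_rpow_le_lintegral {ι Ω : Type*} [Fintype ι] [MeasurableSpace Ω]
    {μ : Measure Ω} {f : ι → Ω → ℝ} (hf : ∀ i, AEMeasurable (f i) μ)
    (hind : ∀ b : ι → ℝ, (fun x => ∑ i, b i * f i x) =ᵐ[μ] 0 → b = 0) {r : ℝ} (hr : 0 < r) :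
    ∃ C : ℝ≥0, ∀ (b : ι → ℝ) (i : ι),
      ‖b i‖ₑ ^ r ≤ C * ∫⁻ x, ‖∑ i, b i * f i x‖ₑ ^ r ∂μ := by
  rcases isEmpty_or_nonempty ι with hι | hι
  · exact ⟨0, fun _ i => isEmptyElim i⟩
  let G : (ι → ℝ) → ℝ≥0∞ := fun b => ∫⁻ x, ‖∑ i, b i * f i x‖ₑ ^ r ∂μ
  have hmeas : ∀ b : ι → ℝ, AEMeasurable (fun x => ‖∑ i, b i * f i x‖ₑ ^ r) μ :=
    fun b => aemeasurable_enorm_sum_mul_rpow hf b r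
  have hlsc : LowerSemicontinuous G := lowerSemicontinuous_lintegral_enorm_sum_mul_rpow hf r
  obtain ⟨b₀, hb₀, hmin⟩ := (hlsc.lowerSemicontinuousOn _).exists_isMinOn
    (NormedSpace.sphere_nonempty.2 zero_le_one) (isCompact_sphere (0 : ι → ℝ) 1)
  have hpos : G b₀ ≠ 0 := fun hzero => by
    have hae : (fun x => ∑ i, b₀ i * f i x) =ᵐ[μ] 0 := by
      filter_upwards [(lintegral_eq_zero_iff' (hmeas b₀)).1 hzero] with x hx
      simpa [hr, hr.le.not_gt] using hx
    exact ne_zero_of_mem_unit_sphere ⟨b₀, hb₀⟩ (hind b₀ hae)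
  have hsmul : ∀ (c : ℝ) (b : ι → ℝ), G (c • b) = ‖c‖ₑ ^ r * G b := fun c b => by
    simp only [G, Pi.smul_apply, smul_eq_mul, mul_assoc, ← Finset.mul_sum, enorm_mul,
      ENNReal.mul_rpow_of_nonneg _ _ hr.le]
    exact lintegral_const_mul'' _ (hmeas b)
  let g : ℝ≥0∞ := min (G b₀) 1
  have hg : g ≠ 0 := (lt_min hpos.bot_lt one_pos).ne'
  have hg' : g ≠ ∞ := ((min_le_right _ _).trans_lt ENNReal.one_lt_top).ne
  refine ⟨g⁻¹.toNNReal, fun b i => ?_⟩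
  rw [ENNReal.coe_toNNReal (ENNReal.inv_ne_top.2 hg), mul_comm, ← div_eq_mul_inv]
  rcases eq_or_ne b 0 with rfl | hb
  · simp [hr]
  have hlower : ‖b‖ₑ ^ r * g ≤ G b := by
    have hunit : ‖b‖⁻¹ • b ∈ Metric.sphere (0 : ι → ℝ) 1 := by
      simp [norm_smul, hb]
    calc ‖b‖ₑ ^ r * g ≤ ‖b‖ₑ ^ r * G (‖b‖⁻¹ • b) := by
          gcongr
          exact (min_le_left _ _).trans (hmin hunit)
      _ = G b := by
        rw [← enorm_norm, ← hsmul, smul_inv_smul₀ (norm_ne_zero_iff.2 hb)]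
  calc ‖b i‖ₑ ^ r ≤ ‖b‖ₑ ^ r := by
        gcongr
        exact enorm_le_iff_norm_le.2 (norm_le_pi_norm b i)
    _ ≤ G b / g := (ENNReal.le_div_iff_mul_le (Or.inl hg) (Or.inl hg')).2 hlower

theorem linearIndependent_X_add_C_pow {K : Type*} [Field K] [CharZero K] {l : ℕ} {x : Fin l → K}
    (hx : Function.Injective x) : LinearIndependent K fun a => (X + C (x a)) ^ (l - 1) := by
  refine Fintype.linearIndependent_iff.2 fun b hb => congrFun <|
    Matrix.eq_zero_of_forall_pow_sum_mul_pow_eq_zero hx fun i => ?_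
  have hcoeff := congrArg (fun P => P.coeff (l - 1 - i)) hb
  simp only [finsetSum_coeff, coeff_smul, coeff_X_add_C_pow, coeff_zero, smul_eq_mul,
    Nat.sub_sub_self (Nat.le_sub_one_of_lt i.2), ← mul_assoc, ← Finset.sum_mul] at hcoeff
  refine (mul_eq_zero.1 hcoeff).resolve_right ?_
  exact Nat.cast_ne_zero.2 (Nat.choose_pos (Nat.sub_le _ _)).ne'

theorem linearIndependent_sum_toeplitz {K V : Type*} [Field K] [AddCommGroup V] [Module K V]
    {l : ℕ} {v : ℕ → V} (hv : LinearIndependent K fun a : Fin l => v a) {c : ℕ → K}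
    (hc : c 0 ≠ 0) :
    LinearIndependent K fun i : Fin l => ∑ a ∈ Finset.range (i + 1), c (i - a) • v a := by
  let M : Matrix (Fin l) (Fin l) K := .of fun i a => if a ≤ i then c (i - a) else 0
  have hdet : M.det ≠ 0 := by
    rw [Matrix.det_of_isLowerTriangular M fun i a hia => if_neg (not_le.2 hia)]
    refine Finset.prod_ne_zero_iff.2 fun i _ => ?_
    simpa only [M, Matrix.of_apply, le_refl, if_true, Nat.sub_self] using hc
  have hrow : ∀ i : Fin l,
      ∑ a ∈ Finset.range (i + 1), c (i - a) • v a = ∑ a : Fin l, M i a • v a := fun i => by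
    simp only [M, Matrix.of_apply, ite_smul, zero_smul, Fin.le_def]
    rw [Fin.sum_univ_eq_sum_range (fun a => if a ≤ (i : ℕ) then c (i - a) • v a else 0) l,
      ← Finset.sum_filter]
    congr 1
    ext a
    simp only [Finset.mem_range, Finset.mem_filter]
    omega
  refine Fintype.linearIndependent_iff.2 fun b hb => congrFun <|
    Matrix.eq_zero_of_vecMul_eq_zero hdet <| funext <| Fintype.linearIndependent_iff.1 hv _ ?_
  simp only [hrow, Finset.smul_sum, smul_smul] at hb
  rw [Finset.sum_comm] at hb
  simpa only [Matrix.vecMul, dotProduct, Finset.sum_smul] using hb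

/-- The polynomial that coincides with `N^{l-1}(· + i)` on `[0, 1)`. -/
noncomputable def cellPoly (l i : ℕ) : ℝ[X] :=
  ∑ a ∈ Finset.range (i + 1),
    (((l - 1).factorial : ℝ)⁻¹ * ((-1) ^ (i - a) * l.choose (i - a))) • (X + C (a : ℝ)) ^ (l - 1)

theorem linearIndependent_cellPoly (l : ℕ) :
    LinearIndependent ℝ fun i : Fin l => cellPoly l i := by
  refine linearIndependent_sum_toeplitz (v := fun a : ℕ => (X + C (a : ℝ)) ^ (l - 1))
    (c := fun s => ((l - 1).factorial : ℝ)⁻¹ * ((-1) ^ s * l.choose s)) ?_ ?_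
  · exact linearIndependent_X_add_C_pow (Nat.cast_injective.comp Fin.val_injective)
  · simp [Nat.factorial_ne_zero]

theorem bSpline_add_eq_eval_cellPoly {l i : ℕ} (hi : i < l) {t : ℝ} (ht : t ∈ Set.Ico 0 1) :
    bSpline l (t + i) = (cellPoly l i).eval t := by
  have htail : ∀ s ∈ Finset.range (l + 1), s ∉ Finset.range (i + 1) →
      ((l - 1).factorial : ℝ)⁻¹ * ((-1) ^ s * l.choose s) * truncPow (l - 1) (t + i - s) = 0 := by
    intro s _ hs
    have his : (i : ℝ) + 1 ≤ s := by exact_mod_cast not_lt.1 (Finset.mem_range.not.1 hs)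
    rw [truncPow_of_neg (by linarith [ht.2]), mul_zero]
  rw [bSpline_eq_truncPow, cellPoly,
    ← Finset.sum_subset (Finset.range_mono (Nat.succ_le_succ hi.le)) htail, ← Finset.sum_flip,
    eval_finsetSum]
  refine Finset.sum_congr rfl fun a ha => ?_
  have hai : a ≤ i := Nat.lt_succ_iff.1 (Finset.mem_range.1 ha)
  have hta : 0 ≤ t + a := add_nonneg ht.1 a.cast_nonneg
  rw [Nat.cast_sub hai, sub_sub_eq_add_sub, add_right_comm, add_sub_cancel_right,
    truncPow_of_nonneg hta]
  simp only [eval_smul, eval_pow, eval_add, eval_X, eval_C, smul_eq_mul]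

theorem eq_zero_of_sum_mul_prod_eval_eq_zero {ι R : Type*} [Fintype ι] [CommRing R] [IsDomain R]
    {P : ι → R[X]} (hP : LinearIndependent R P) {s : Set R} (hs : s.Infinite) {n : ℕ}
    {b : (Fin n → ι) → R}
    (hb : ∀ y : Fin n → R, (∀ q, y q ∈ s) → ∑ i, b i * ∏ q, (P (i q)).eval (y q) = 0) :
    b = 0 := by
  induction n with
  | zero =>
    funext i
    have hb := hb 0 fun q => q.elim0
    rwa [Fintype.sum_subsingleton _ i, Fin.prod_univ_zero, mul_one] at hb
  | succ n ih =>
    have hslice : ∀ i₀ : ι, (fun i : Fin n → ι => b (Fin.cons i₀ i)) = 0 := by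
      refine fun i₀ => ih fun y hy => ?_
      refine Fintype.linearIndependent_iff.1 hP
        (fun i₀ => ∑ i, b (Fin.cons i₀ i) * ∏ q, (P (i q)).eval (y q)) ?_ i₀
      refine eq_zero_of_infinite_isRoot _ (hs.mono fun t ht => ?_)
      rw [Set.mem_ofPred_eq, IsRoot.def, ← hb (Fin.cons t y) (Fin.cases ht hy),
        ← (Fin.consEquiv fun _ => ι).sum_comp, Fintype.sum_prod_type, eval_finsetSum]
      refine Finset.sum_congr rfl fun i _ => ?_
      rw [eval_smul, smul_eq_mul, Finset.sum_mul]
      refine Finset.sum_congr rfl fun i' _ => ?_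
      rw [Fin.prod_univ_succ]
      change _ = b (Fin.cons i i') * _
      simp only [Fin.consEquiv_apply, Fin.cons_zero, Fin.cons_succ]
      ring
    funext i
    simpa only [Fin.cons_self_tail, Pi.zero_apply] using congrFun (hslice (i 0)) (Fin.tail i)

theorem exists_enorm_rpow_le_lintegral_cellPoly (n l : ℕ) {r : ℝ} (hr : 0 < r) :
    ∃ C : ℝ≥0, ∀ (b : (Fin n → Fin l) → ℝ) (i : Fin n → Fin l),
      ‖b i‖ₑ ^ r ≤ C * ∫⁻ y in openCube (0 : Fin n → ℝ) 1,
        ‖∑ i, b i * ∏ q, (cellPoly l (i q)).eval (y q)‖ₑ ^ r := by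
  have hcont : ∀ i : Fin n → Fin l,
      Continuous fun y : Fin n → ℝ => ∏ q, (cellPoly l (i q)).eval (y q) := fun i => by fun_prop
  refine exists_enorm_rpow_le_lintegral (fun i => (hcont i).aemeasurable) (fun b hb => ?_) hr
  refine eq_zero_of_sum_mul_prod_eval_eq_zero (linearIndependent_cellPoly l)
    (Set.Ioo_infinite zero_lt_one) fun y hy => ?_
  have heq := Measure.eqOn_open_of_ae_eq hb (isOpen_openCube _ _)
    (by fun_prop) continuousOn_const
  exact heq (show y ∈ openCube 0 1 from fun q => by simpa using hy q)

theorem splineMap_apply_eq_sum_cellPoly {n l : ℕ} (hl : 0 < l) (j : ℕ) (β : (Fin n → ℤ) → ℝ)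
    {m : Fin n → ℤ} {x y : Fin n → ℝ} (hx : ∀ q, 2 ^ j * x q = m q + y q)
    (hy : y ∈ openCube 0 1) :
    splineMap hl j β x = ∑ i : Fin n → Fin l, β (fun q => m q - (i q : ℕ)) *
      ∏ q, (cellPoly l (i q)).eval (y q) := by
  have hy01 : ∀ q, y q ∈ Set.Ico 0 1 := fun q => by
    simpa using And.intro (hy q).1.le (hy q).2
  have hcell : cellIndex j x = m := funext fun q => by
    rw [cellIndex, hx, Int.floor_intCast_add, Int.floor_eq_zero_iff.2 (hy01 q), add_zero]
  let e : (Fin n → Fin l) ↪ (Fin n → ℤ) := ⟨fun i q => m q - (i q : ℕ), fun i i' h =>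
    funext fun q => Fin.ext <| Nat.cast_injective (R := ℤ) <| sub_right_injective (congrFun h q)⟩
  rw [splineMap_apply_eq_sum hl β (Finset.univ.map e) fun m' hm' => ?_, Finset.sum_map]
  · refine Finset.sum_congr rfl fun i _ => ?_
    rw [bSplineN_eq]
    refine congrArg _ (Finset.prod_congr rfl fun q _ => ?_)
    rw [hx, ← bSpline_add_eq_eval_cellPoly (i q).2 (hy01 q)]
    rw [show e i q = m q - (i q : ℕ) from rfl]
    push_cast
    ring_nf
  · have hmem := mem_Ioc_of_bSplineN_ne_zero hl hm'
    rw [hcell] at hmem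
    have htoNat : ∀ q, ((m q - m' q).toNat : ℤ) = m q - m' q := fun q =>
      Int.toNat_of_nonneg (sub_nonneg.2 (hmem q).2)
    refine Finset.mem_map.2 ⟨fun q => ⟨(m q - m' q).toNat, ?_⟩, Finset.mem_univ _, ?_⟩
    · linarith [(hmem q).1, htoNat q]
    · exact funext fun q => (congrArg _ (htoNat q)).trans (sub_sub_cancel _ _)

theorem lpNormOn_eq {ι : Type*} [Fintype ι] (f : (ι → ℝ) → ℝ) {p : ℝ} (hp : 0 < p)
    (E : Set (ι → ℝ)) : lpNormOn f p E = (∫⁻ x in E, ‖f x‖ₑ ^ p) ^ (1 / p) := by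
  rw [lpNormOn, eLpNorm_eq_lintegral_rpow_enorm_toReal (ENNReal.ofReal_pos.2 hp).ne'
    ENNReal.ofReal_ne_top, ENNReal.toReal_ofReal hp.le]

theorem lpNormOn_rpow {ι : Type*} [Fintype ι] (f : (ι → ℝ) → ℝ) {p : ℝ} (hp : 0 < p)
    (E : Set (ι → ℝ)) : lpNormOn f p E ^ p = ∫⁻ x in E, ‖f x‖ₑ ^ p := by
  rw [lpNormOn_eq f hp, one_div, ENNReal.rpow_inv_rpow hp.ne']

theorem exists_enorm_coeff_le (n : ℕ) {l : ℕ} (hl : 0 < l) {r : ℝ} (hr : 0 < r) :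
    ∃ C : ℝ≥0, ∀ (j : ℕ) (β : (Fin n → ℤ) → ℝ) (m : Fin n → ℤ),
      ‖β m‖ₑ ≤
        C * ((2 : ℝ≥0∞) ^ ((j : ℝ) * n / r) * lpNormOn (splineMap hl j β) r (dyadicCube j m)) := by
  obtain ⟨C, hC⟩ := exists_enorm_rpow_le_lintegral_cellPoly n l hr
  refine ⟨C ^ (1 / r), fun j β m => (ENNReal.rpow_le_rpow_iff hr).1 ?_⟩
  have hscale : (2 : ℝ≥0∞) ^ (j * n) * ∫⁻ x in dyadicCube j m, ‖splineMap hl j β x‖ₑ ^ r =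
      ∫⁻ y in openCube (0 : Fin n → ℝ) 1, ‖∑ i : Fin n → Fin l,
        β (fun q => m q - (i q : ℕ)) * ∏ q, (cellPoly l (i q)).eval (y q)‖ₑ ^ r := by
    rw [dyadicCube, setLIntegral_openCube _ (by positivity), ← mul_assoc, pow_mul,
      Fintype.card_fin, ← mul_pow, ← ENNReal.ofReal_ofNat, ← ENNReal.ofReal_pow two_pos.le,
      ← ENNReal.ofReal_mul (by positivity), mul_one_div_cancel (by positivity),
      ENNReal.ofReal_one, one_pow, one_mul]
    refine setLIntegral_congr_fun (measurableSet_openCube _ _) fun y hy => ?_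
    rw [splineMap_apply_eq_sum_cellPoly hl j β (m := m) (y := y) (fun q => ?_) hy]
    simp only [Pi.add_apply, Pi.smul_apply, smul_eq_mul]
    field_simp
  have hcoeff := hC (fun i => β (fun q => m q - (i q : ℕ))) (fun _ => ⟨0, hl⟩)
  simp only [Nat.cast_zero, sub_zero, ← hscale] at hcoeff
  rw [ENNReal.mul_rpow_of_nonneg _ _ hr.le, ENNReal.mul_rpow_of_nonneg _ _ hr.le,
    lpNormOn_rpow _ hr, ← ENNReal.coe_rpow_of_nonneg _ (by positivity), one_div,
    NNReal.rpow_inv_rpow hr.ne', ← ENNReal.rpow_mul, div_mul_cancel₀ _ hr.ne']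
  exact_mod_cast hcoeff

end Stability

section Weight

variable {ι : Type*}

theorem openCube_subset_openCube {c c' : ι → ℝ} {s s' : ℝ} (h : ∀ i, c' i ≤ c i)
    (h' : ∀ i, c i + s ≤ c' i + s') : openCube c s ⊆ openCube c' s' :=
  fun _ hx i => ⟨(h i).trans_lt (hx i).1, (hx i).2.trans_le (h' i)⟩

theorem exists_openCube_subset_iUnion [Fintype ι] (c : ι → ℝ) {s : ℝ} (hs : 0 < s) (K : ℕ) :
    ∃ b : (ι → Fin K) → ι → ℝ, (∀ z, dist c (b z) ≤ K * s) ∧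
      openCube c (K * s) ⊆ ⋃ z, openCube (b z) (2 * s) := by
  refine ⟨fun z i => c i + ((z i : ℕ) - 1) * s, fun z => ?_, fun x hx => ?_⟩
  · refine (dist_pi_le_iff (by positivity)).2 fun i => ?_
    have hz : ((z i : ℕ) : ℝ) + 1 ≤ K := mod_cast (z i).2
    rw [dist_self_add_right, norm_mul, Real.norm_of_nonneg hs.le, Real.norm_eq_abs]
    gcongr
    rw [abs_le]
    constructor <;> linarith [((z i : ℕ).cast_nonneg : (0 : ℝ) ≤ (z i : ℕ))]
  · have hnonneg : ∀ i, 0 ≤ (x i - c i) / s := fun i =>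
      div_nonneg (sub_nonneg.2 (hx i).1.le) hs.le
    have hlt : ∀ i, ⌊(x i - c i) / s⌋₊ < K := fun i => by
      rw [Nat.floor_lt (hnonneg i), div_lt_iff₀ hs]
      linarith [(hx i).2]
    refine Set.mem_iUnion.2 ⟨fun i => ⟨⌊(x i - c i) / s⌋₊, hlt i⟩, fun i => ?_⟩
    have hle := (le_div_iff₀ hs).1 (Nat.floor_le (hnonneg i))
    have hge := (div_lt_iff₀ hs).1 (Nat.lt_floor_add_one ((x i - c i) / s))
    dsimp only
    constructor <;> linarith

variable [Fintype ι] {w : (ι → ℝ) → ℝ}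

theorem weightMass_mono (w : (ι → ℝ) → ℝ) {E F : Set (ι → ℝ)} (h : E ⊆ F) :
    weightMass w E ≤ weightMass w F :=
  lintegral_mono_set h

theorem ALocInfty.exists_shift (hw : ALocInfty w) :
    ∃ κ a : ℝ, 0 < κ ∧ 0 < a ∧ ∃ C : ℝ≥0, ∀ (c c' : ι → ℝ) (s : ℝ), 0 < s → s ≤ a →
      dist c c' ≤ κ * s → weightMass w (openCube c' s) ≤ C * weightMass w (openCube c s) := by
  obtain ⟨-, a, ha, α, hα0, hα1, C, hC⟩ := hw
  have hlim : Filter.Tendsto (fun κ : ℝ => α * (1 + κ) ^ Fintype.card ι)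
      (nhdsWithin 0 (Set.Ioi 0)) (nhds α) :=
    (Continuous.tendsto' (by fun_prop) 0 α (by simp)).mono_left nhdsWithin_le_nhds
  obtain ⟨κ, hκα, hκ0, hκ1⟩ := ((hlim.eventually_lt_const hα1).and
    (Ioo_mem_nhdsGT (zero_lt_one' ℝ))).exists
  refine ⟨κ, a / 2, hκ0, half_pos ha, C, fun c c' s hs hsa hcc => ?_⟩
  have hκs : 0 < κ * s := mul_pos hκ0 hs
  have hdist : ∀ i, |c i - c' i| ≤ κ * s := (dist_pi_le_iff hκs.le).1 hcc
  have hsub : openCube c s ⊆ openCube (c ⊓ c') ((1 + κ) * s) :=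
    openCube_subset_openCube (fun _ => inf_le_left) fun i => by
      rcases min_cases (c i) (c' i) with h | h <;> simp only [Pi.inf_apply, h.1] <;>
        linarith [abs_le.1 (hdist i)]
  have hsub' : openCube c' s ⊆ openCube (c ⊓ c') ((1 + κ) * s) :=
    openCube_subset_openCube (fun _ => inf_le_right) fun i => by
      rcases min_cases (c i) (c' i) with h | h <;> simp only [Pi.inf_apply, h.1] <;>
        linarith [abs_le.1 (hdist i)]
  refine (weightMass_mono w hsub').trans
    (hC _ _ (by positivity) (by nlinarith) _ (measurableSet_openCube c s) hsub ?_)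
  rw [volume_openCube, volume_openCube, ← ENNReal.ofReal_pow (by positivity),
    ← ENNReal.ofReal_pow hs.le, ← ENNReal.ofReal_mul hα0.le, mul_pow, ← mul_assoc]
  exact ENNReal.ofReal_le_ofReal (mul_le_of_le_one_left (by positivity) hκα.le)

theorem ALocInfty.exists_chain (hw : ALocInfty w) :
    ∃ κ a : ℝ, 0 < κ ∧ 0 < a ∧ ∃ C : ℝ≥0, ∀ (M : ℕ) (c c' : ι → ℝ) (s : ℝ), 0 < s → s ≤ a →
      dist c c' ≤ M * (κ * s) →
      weightMass w (openCube c' s) ≤ C ^ M * weightMass w (openCube c s) := by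
  obtain ⟨κ, a, hκ, ha, C, hC⟩ := hw.exists_shift
  refine ⟨κ, a, hκ, ha, C, fun M => ?_⟩
  induction M with
  | zero =>
    intro c c' s _ _ h
    rw [Nat.cast_zero, zero_mul, dist_le_zero] at h
    rw [h, pow_zero, one_mul]
  | succ M ih =>
    intro c c' s hs hsa h
    push_cast at h
    let b : ι → ℝ := AffineMap.lineMap c c' (M / (M + 1) : ℝ)
    have hcb : dist c b ≤ M * (κ * s) := by
      rw [dist_left_lineMap, Real.norm_of_nonneg (by positivity), div_mul_eq_mul_div,
        div_le_iff₀ (by positivity)]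
      nlinarith [(Nat.cast_nonneg M : (0 : ℝ) ≤ M)]
    have hbc : dist b c' ≤ κ * s := by
      rw [dist_lineMap_right, one_sub_div (by positivity), add_sub_cancel_left,
        Real.norm_of_nonneg (by positivity), div_mul_eq_mul_div, div_le_iff₀ (by positivity)]
      linarith
    calc weightMass w (openCube c' s) ≤ C * weightMass w (openCube b s) := hC b c' s hs hsa hbc
      _ ≤ C * (C ^ M * weightMass w (openCube c s)) := by gcongr; exact ih c b s hs hsa hcb
      _ = C ^ (M + 1) * weightMass w (openCube c s) := by ring

theorem ALocInfty.exists_large_le_small (hw : ALocInfty w) (L : ℝ) {η₀ : ℝ} (hη₀ : 0 < η₀) :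
    ∃ η : ℝ, 0 < η ∧ η ≤ η₀ ∧ ∃ C : ℝ≥0, ∀ (c c' : ι → ℝ) (t : ℝ), 0 < t → t ≤ 1 →
      dist c c' ≤ L * t →
      weightMass w (openCube c' (L * t)) ≤ C * weightMass w (openCube c (η * t)) := by
  obtain ⟨κ, a, hκ, ha, C, hC⟩ := hw.exists_chain
  have hη : 0 < min a η₀ := lt_min ha hη₀
  set η := min a η₀
  obtain ⟨K, hK⟩ := exists_nat_ge (L / (η / 2))
  obtain ⟨M, hM⟩ := exists_nat_ge ((L + K * (η / 2)) / (κ * η))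
  rw [div_le_iff₀ (by positivity)] at hK hM
  classical
  refine ⟨η, hη, min_le_right _ _, Fintype.card (ι → Fin K) * C ^ M,
    fun c c' t ht ht1 hcc => ?_⟩
  have hηt : η * t ≤ a := (mul_le_of_le_one_right hη.le ht1).trans (min_le_left _ _)
  obtain ⟨b, hb, hcover⟩ := exists_openCube_subset_iUnion c' (by positivity : 0 < η / 2 * t) K
  rw [← mul_assoc 2, mul_div_cancel₀ _ two_ne_zero] at hcover
  have hsub : openCube c' (L * t) ⊆ openCube c' (K * (η / 2 * t)) :=
    openCube_subset_openCube (fun _ => le_rfl) fun i => by nlinarith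
  calc weightMass w (openCube c' (L * t))
      ≤ ∑' z, weightMass w (openCube (b z) (η * t)) :=
        (weightMass_mono w (hsub.trans hcover)).trans (lintegral_iUnion_le _ _)
    _ ≤ ∑' _z : ι → Fin K, C ^ M * weightMass w (openCube c (η * t)) := by
        refine ENNReal.tsum_le_tsum fun z => hC M c _ _ (by positivity) hηt ?_
        nlinarith [dist_triangle c c' (b z), hb z]
    _ = ↑(Fintype.card (ι → Fin K) * C ^ M : ℝ≥0) * weightMass w (openCube c (η * t)) := by
        rw [tsum_fintype, Finset.sum_const, nsmul_eq_mul, Finset.card_univ]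
        push_cast
        ring

end Weight

section Shell

variable {n d : ℕ}

/-- The cube `∏ (mᵢ / 2ᵏ, (mᵢ + 2) / 2ᵏ) × (-2⁻ᵏ, 2⁻ᵏ)ᵈ`, which contains the shells `Ξ_{j,m'}` over
all dyadic subcubes `Q_{j,m'}` of `Q_{k,m}`. -/
noncomputable def shellHull (d k : ℕ) (m : Fin n → ℤ) : Set (Fin n ⊕ Fin d → ℝ) :=
  openCube (Sum.elim (fun i => (m i : ℝ) / 2 ^ k) fun _ => -(1 / 2 ^ k)) (2 * (1 / 2 ^ k))

theorem shellBox_subset_shellHull {j k : ℕ} (hjk : j ≤ k) {m m' : Fin n → ℤ}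
    (h : dyadicCube k m ⊆ dyadicCube j m') : shellBox d k m ⊆ shellHull d j m' := by
  rintro z ⟨hcube, -, hnorm⟩
  have hpos : (0 : ℝ) < 1 / 2 ^ j := by positivity
  have hle : (1 : ℝ) / 2 ^ k ≤ 1 / 2 ^ j := by gcongr; exact one_le_two
  rintro (i | i)
  · have hi := h hcube i
    dsimp only [Sum.elim_inl] at hi ⊢
    constructor <;> linarith [hpos]
  · have hi : |z (Sum.inr i)| < 1 / 2 ^ k := (PiLp.norm_apply_le
      (WithLp.toLp 2 fun i : Fin d => z (Sum.inr i)) i).trans_lt hnorm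
    rw [abs_lt] at hi
    dsimp only [Sum.elim_inr]
    constructor <;> linarith

theorem norm_toLp_le_sum (v : Fin d → ℝ) : ‖WithLp.toLp 2 v‖ ≤ ∑ i, |v i| := by
  conv_lhs => rw [← Finset.univ_sum_single v, WithLp.toLp_sum]
  refine (norm_sum_le _ _).trans_eq (Finset.sum_congr rfl fun i _ => ?_)
  rw [PiLp.toLp_single, PiLp.norm_single, Real.norm_eq_abs]

theorem norm_toLp_of_mem_openCube_single {i₀ : Fin d} {a b : ℝ} {v : Fin d → ℝ} (ha : 0 ≤ a)
    (hv : v ∈ openCube (Pi.single i₀ a) b) :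
    a ≤ ‖WithLp.toLp 2 v‖ ∧ ‖WithLp.toLp 2 v‖ ≤ a + d * b := by
  constructor
  · have hi₀ : a < v i₀ := by simpa only [Pi.single_eq_same] using (hv i₀).1
    exact hi₀.le.trans ((le_abs_self _).trans (PiLp.norm_apply_le (WithLp.toLp 2 v) i₀))
  · have hdiff : ‖WithLp.toLp 2 (v - Pi.single i₀ a)‖ ≤ d * b := by
      refine (norm_toLp_le_sum _).trans ((Finset.sum_le_card_nsmul _ _ b fun i _ => ?_).trans_eq ?_)
      · rw [Pi.sub_apply, abs_le]
        constructor <;> linarith [hv i]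
      · rw [Finset.card_univ, Fintype.card_fin, nsmul_eq_mul]
    calc ‖WithLp.toLp 2 v‖
        = ‖WithLp.toLp 2 (Pi.single i₀ a : Fin d → ℝ) + WithLp.toLp 2 (v - Pi.single i₀ a)‖ := by
          rw [← WithLp.toLp_add, add_sub_cancel]
      _ ≤ a + d * b := by
          refine (norm_add_le _ _).trans (add_le_add ?_ hdiff)
          rw [PiLp.toLp_single, PiLp.norm_single, Real.norm_of_nonneg ha]

theorem openCube_subset_shellBox (i₀ : Fin d) (k : ℕ) (m : Fin n → ℤ) {η : ℝ} (hη0 : 0 < η)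
    (hη : η ≤ 1 / (4 * (d + 1))) :
    openCube (Sum.elim (fun i => (m i : ℝ) / 2 ^ k) (Pi.single i₀ (1 / 2 ^ (k + 1))))
      (η * (1 / 2 ^ k)) ⊆ shellBox d k m := by
  intro z hz
  have ht : (0 : ℝ) < 1 / 2 ^ k := by positivity
  have hhalf : (1 : ℝ) / 2 ^ (k + 1) = 1 / 2 ^ k / 2 := by rw [pow_succ]; field_simp
  rw [le_div_iff₀ (by positivity)] at hη
  obtain ⟨hlower, hupper⟩ := norm_toLp_of_mem_openCube_single (i₀ := i₀)
    (a := 1 / 2 ^ (k + 1)) (v := fun i => z (Sum.inr i)) (by positivity) fun i => hz (Sum.inr i)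
  refine ⟨fun i => ⟨(hz (Sum.inl i)).1, (hz (Sum.inl i)).2.trans_le ?_⟩, hlower,
    hupper.trans_lt ?_⟩
  · dsimp only [Sum.elim_inl]
    nlinarith
  · rw [hhalf]
    nlinarith [(d.cast_nonneg : (0 : ℝ) ≤ d)]

theorem exists_weightMass_shellHull_le (hd : 0 < d) {w : (Fin n ⊕ Fin d → ℝ) → ℝ}
    (hw : ALocInfty w) (L : ℕ) : ∃ C : ℝ≥0, ∀ (k : ℕ) (m m' : Fin n → ℤ),
      (∀ i, |m i - m' i| ≤ L) →
      weightMass w (shellHull d k m) ≤ C * weightMass w (shellBox d k m') := by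
  obtain ⟨η, hη0, hη, C, hC⟩ := hw.exists_large_le_small (L + 2)
    (by positivity : (0 : ℝ) < 1 / (4 * (d + 1)))
  refine ⟨C, fun k m m' hmm => ?_⟩
  have ht : (0 : ℝ) < 1 / 2 ^ k := by positivity
  have ht1 : (1 : ℝ) / 2 ^ k ≤ 1 := by
    rw [div_le_one (by positivity)]
    exact one_le_pow₀ one_le_two
  have hhalf : (1 : ℝ) / 2 ^ (k + 1) = 1 / 2 ^ k / 2 := by rw [pow_succ]; field_simp
  have hL : (0 : ℝ) ≤ L := L.cast_nonneg
  let c : Fin n ⊕ Fin d → ℝ :=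
    Sum.elim (fun i => (m' i : ℝ) / 2 ^ k) (Pi.single ⟨0, hd⟩ (1 / 2 ^ (k + 1)))
  let c' : Fin n ⊕ Fin d → ℝ := Sum.elim (fun i => (m i : ℝ) / 2 ^ k) fun _ => -(1 / 2 ^ k)
  have hdist : dist c c' ≤ (L + 2) * (1 / 2 ^ k) := by
    refine (dist_pi_le_iff (by positivity)).2 (Sum.rec (fun i => ?_) fun i => ?_)
    · have hi : |(m' i : ℝ) - m i| ≤ L := by rw [abs_sub_comm]; exact_mod_cast hmm i
      simp only [c, c', Sum.elim_inl]
      rw [Real.dist_eq, ← sub_div, abs_div, div_eq_mul_one_div,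
        abs_of_pos (by positivity : (0 : ℝ) < 2 ^ k)]
      gcongr
      linarith
    · simp only [c, c', Sum.elim_inr]
      rw [Real.dist_eq, Pi.single_apply, hhalf]
      split_ifs <;> rw [abs_of_nonneg (by linarith)] <;> nlinarith
  calc weightMass w (shellHull d k m) ≤ weightMass w (openCube c' ((L + 2) * (1 / 2 ^ k))) :=
        weightMass_mono w (openCube_subset_openCube (fun _ => le_rfl) fun i => by
          gcongr; linarith [hL])
    _ ≤ C * weightMass w (openCube c (η * (1 / 2 ^ k))) := hC c c' _ ht ht1 hdist
    _ ≤ C * weightMass w (shellBox d k m') := by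
        gcongr
        exact weightMass_mono w (openCube_subset_shellBox _ k m' hη0 hη)

end Shell

section Subcube

variable {n j k : ℕ} {m m' : Fin n → ℤ}

theorem mem_subcubes_iff (hjk : j ≤ k) : m ∈ subcubes j m' k ↔ ∀ q, m q / 2 ^ (k - j) = m' q := by
  obtain ⟨i, rfl⟩ := Nat.exists_eq_add_of_le hjk
  have hi : (0 : ℝ) < 2 ^ i := by positivity
  simp only [Nat.add_sub_cancel_left, Int.ediv_eq_iff_of_pos (show (0 : ℤ) < 2 ^ i by positivity)]
  constructor
  · intro h q
    have hcenter : (fun q => ((m q : ℝ) + 1 / 2) / 2 ^ (j + i)) ∈ dyadicCube (j + i) m := by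
      refine mem_dyadicCube.2 fun q => ?_
      rw [mul_div_cancel₀ _ (by positivity)]
      constructor <;> linarith
    have hq := mem_dyadicCube.1 (h hcenter) q
    rw [pow_add, mul_div_assoc', mul_div_mul_left _ _ (by positivity), lt_div_iff₀ hi,
      div_lt_iff₀ hi] at hq
    have hlower : ((m' q * 2 ^ i : ℤ) : ℝ) < ((m q + 1 : ℤ) : ℝ) := by push_cast; linarith
    have hupper : (m q : ℝ) < ((m' q * 2 ^ i + 2 ^ i : ℤ) : ℝ) := by push_cast; linarith
    exact ⟨Int.lt_add_one_iff.1 (Int.cast_lt.1 hlower), Int.cast_lt.1 hupper⟩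
  · intro h x hx
    refine mem_dyadicCube.2 fun q => ?_
    have hlower : (m' q : ℝ) * 2 ^ i ≤ m q := mod_cast (h q).1
    have hupper : (m q : ℝ) + 1 ≤ m' q * 2 ^ i + 2 ^ i := mod_cast (h q).2
    have hq := mem_dyadicCube.1 hx q
    rw [pow_add] at hq
    constructor <;> refine lt_of_mul_lt_mul_right ?_ hi.le <;> linarith

theorem tsum_subcubes (hjk : j ≤ k) (f : (Fin n → ℤ) → ℝ≥0∞) :
    ∑' m' : Fin n → ℤ, ∑' m : subcubes j m' k, f m = ∑' m, f m := by
  rw [← ENNReal.tsum_fiberwise f fun m q => m q / 2 ^ (k - j)]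
  refine tsum_congr fun m' => ?_
  have hfiber : subcubes j m' k = (fun (m : Fin n → ℤ) q => m q / 2 ^ (k - j)) ⁻¹' {m'} := by
    ext m
    rw [mem_subcubes_iff hjk, Set.mem_preimage, Set.mem_singleton_iff, funext_iff]
  rw [hfiber]

theorem disjoint_dyadicCube (h : m ≠ m') : Disjoint (dyadicCube k m) (dyadicCube k m') :=
  Set.disjoint_left.2 fun _ hx hx' =>
    h ((cellIndex_of_mem_dyadicCube hx).symm.trans (cellIndex_of_mem_dyadicCube hx'))

/-- The cubes of generation `k` within `l` steps of `Q_{k,m}` in each coordinate direction all lie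
in the same cube of generation `j ≤ k`. -/
def IsInner (l j k : ℕ) (m : Fin n → ℤ) : Prop :=
  ∀ q, (l : ℤ) ≤ m q % 2 ^ (k - j) ∧ m q % 2 ^ (k - j) + l < 2 ^ (k - j)

theorem volume_slab_le {ι : Type*} [Fintype ι] (c : ι → ℝ) {s : ℝ} (hs : 0 < s) (q : ι)
    (T : Set ℝ) : volume {x | x ∈ openCube c s ∧ x q ∈ T} ≤
      volume T / ENNReal.ofReal s * volume (openCube c s) := by
  classical
  rw [ENNReal.mul_comm_div, ← mul_div_assoc, ENNReal.le_div_iff_mul_le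
    (Or.inl (ENNReal.ofReal_pos.2 hs).ne') (Or.inl ENNReal.ofReal_ne_top)]
  have hsub : {x | x ∈ openCube c s ∧ x q ∈ T} ⊆
      Set.univ.pi (Function.update (fun i => Set.Ioo (c i) (c i + s)) q T) := fun x hx i _ => by
    rcases eq_or_ne i q with rfl | hi
    · rw [Function.update_self]
      exact hx.2
    · rw [Function.update_of_ne hi]
      exact hx.1 i
  refine (mul_le_mul_left (measure_mono hsub) _).trans_eq ?_
  rw [volume_pi_pi, openCube_eq_pi, volume_pi_pi, ← Finset.mul_prod_erase _ _ (Finset.mem_univ q),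
    Function.update_self, Finset.prod_congr rfl fun i hi => by
      rw [Function.update_of_ne (Finset.ne_of_mem_erase hi)],
    ← Finset.prod_erase_mul (f := fun i => volume (Set.Ioo (c i) (c i + s))) _
      (Finset.mem_univ q), mul_assoc, Real.volume_Ioo (a := c q), add_sub_cancel_left]

theorem exists_abs_sub_le_of_not_isInner {l : ℕ} (hjk : j ≤ k) (hm : m ∈ subcubes j m' k)
    (hmi : ¬ IsInner l j k m) {x : Fin n → ℝ} (hx : x ∈ dyadicCube k m) :
    ∃ q, |x q - m' q / 2 ^ j| ≤ l / 2 ^ k ∨ |x q - (m' q + 1) / 2 ^ j| ≤ l / 2 ^ k := by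
  obtain ⟨i, rfl⟩ := Nat.exists_eq_add_of_le hjk
  simp only [IsInner, Nat.add_sub_cancel_left, not_forall, not_and_or, not_le, not_lt] at hmi
  obtain ⟨q, hq⟩ := hmi
  have hdiv := Int.mul_ediv_add_emod (m q) (2 ^ i)
  rw [show m q / 2 ^ i = m' q by simpa using (mem_subcubes_iff hjk).1 hm q] at hdiv
  have hxk := mem_dyadicCube.1 hx q
  have hxj := mem_dyadicCube.1 (hm hx) q
  have hscale : ∀ a : ℝ, |x q - a / 2 ^ j| = |2 ^ (j + i) * x q - 2 ^ i * a| / 2 ^ (j + i) := by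
    intro a
    rw [← abs_of_pos (by positivity : (0 : ℝ) < 2 ^ (j + i)), ← abs_div,
      abs_of_pos (by positivity : (0 : ℝ) < 2 ^ (j + i)), pow_add]
    congr 1
    field_simp
  have hi : (0 : ℝ) < 2 ^ i := by positivity
  have hlower := mul_lt_mul_of_pos_left hxj.1 hi
  have hupper := mul_lt_mul_of_pos_left hxj.2 hi
  have hpow : (2 : ℝ) ^ (j + i) * x q = 2 ^ i * (2 ^ j * x q) := by rw [pow_add]; ring
  refine ⟨q, hq.imp (fun h => ?_) fun h => ?_⟩ <;> rw [hscale] <;> gcongr <;>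
    rw [abs_le]
  · have hle : (m q : ℝ) + 1 ≤ 2 ^ i * m' q + l :=
      mod_cast (by omega : m q + 1 ≤ 2 ^ i * m' q + l)
    constructor <;> linarith
  · have hle : 2 ^ i * ((m' q : ℝ) + 1) ≤ m q + l :=
      mod_cast (by linarith : 2 ^ i * (m' q + 1) ≤ m q + l)
    constructor <;> linarith

theorem volume_iUnion_not_isInner_le (l : ℕ) (hjk : j ≤ k) (m' : Fin n → ℤ) :
    volume (⋃ m ∈ {m ∈ subcubes j m' k | ¬ IsInner l j k m}, dyadicCube k m) ≤
      ENNReal.ofReal (4 * l * n * (2 ^ j / 2 ^ k)) * volume (dyadicCube j m') := by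
  let T : Fin n → Set ℝ := fun q => Metric.closedBall (m' q / 2 ^ j) (l / 2 ^ k) ∪
    Metric.closedBall ((m' q + 1) / 2 ^ j) (l / 2 ^ k)
  have hT : ∀ q, volume (T q) ≤ ENNReal.ofReal (4 * l / 2 ^ k) := fun q => by
    refine (measure_union_le _ _).trans_eq ?_
    rw [Real.volume_closedBall, Real.volume_closedBall, ← ENNReal.ofReal_add (by positivity)
      (by positivity)]
    congr 1
    ring
  have hcover : (⋃ m ∈ {m ∈ subcubes j m' k | ¬ IsInner l j k m}, dyadicCube k m) ⊆
      ⋃ q, {x | x ∈ dyadicCube j m' ∧ x q ∈ T q} := by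
    refine Set.iUnion₂_subset fun m hm x hx => ?_
    obtain ⟨q, hq⟩ := exists_abs_sub_le_of_not_isInner hjk hm.1 hm.2 hx
    exact Set.mem_iUnion.2 ⟨q, hm.1 hx, hq⟩
  calc volume (⋃ m ∈ {m ∈ subcubes j m' k | ¬ IsInner l j k m}, dyadicCube k m)
      ≤ ∑ q, volume {x | x ∈ dyadicCube j m' ∧ x q ∈ T q} :=
        (measure_mono hcover).trans (measure_iUnion_fintype_le _ _)
    _ ≤ ∑ _q : Fin n, ENNReal.ofReal (4 * l / 2 ^ k) / ENNReal.ofReal (1 / 2 ^ j) *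
          volume (dyadicCube j m') := by
        refine Finset.sum_le_sum fun q _ => (volume_slab_le _ (by positivity) q (T q)).trans ?_
        gcongr
        exacts [hT q, le_rfl]
    _ = ENNReal.ofReal (4 * l * n * (2 ^ j / 2 ^ k)) * volume (dyadicCube j m') := by
        rw [Finset.sum_const, Finset.card_univ, Fintype.card_fin, nsmul_eq_mul, ← mul_assoc,
          ← ENNReal.ofReal_div_of_pos (by positivity), ← ENNReal.ofReal_natCast,
          ← ENNReal.ofReal_mul (by positivity)]
        congr 2
        field_simp

end Subcube

section Gamma

variable {n d : ℕ} {γ : (Fin n ⊕ Fin d → ℝ) → ℝ} {p : ℝ}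

theorem gammaHat_rpow (hγ : 0 ≤ γ) (hp : 0 < p) (k : ℕ) (m : Fin n → ℤ) :
    gammaHat γ p k m ^ p = weightMass (fun z => γ z ^ p) (shellBox d k m) := by
  rw [gammaHat, lpNormOn_rpow _ hp, weightMass]
  refine lintegral_congr fun z => ?_
  rw [Real.enorm_of_nonneg (hγ z), ENNReal.ofReal_rpow_of_nonneg (hγ z) hp.le]

theorem exists_gammaHat_neighbour_le (hd : 0 < d) (hp : 0 < p) (hγ : 0 ≤ γ)
    (hγp : ALocInfty fun z => γ z ^ p) (L : ℕ) : ∃ C : ℝ≥0, ∀ (k : ℕ) (m m' : Fin n → ℤ),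
      (∀ i, |m i - m' i| ≤ L) → gammaHat γ p k m ^ p ≤ C * gammaHat γ p k m' ^ p := by
  obtain ⟨C, hC⟩ := exists_weightMass_shellHull_le hd hγp L
  refine ⟨C, fun k m m' h => ?_⟩
  rw [gammaHat_rpow hγ hp, gammaHat_rpow hγ hp]
  exact (weightMass_mono _ (shellBox_subset_shellHull le_rfl subset_rfl)).trans (hC k m m' h)

theorem measurableSet_shellBox (d k : ℕ) (m : Fin n → ℤ) : MeasurableSet (shellBox d k m) := by
  have hnorm : Measurable fun z : Fin n ⊕ Fin d → ℝ =>
      ‖WithLp.toLp 2 fun i : Fin d => z (Sum.inr i)‖ := by fun_prop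
  exact (measurableSet_preimage (by fun_prop) (measurableSet_dyadicCube k m)).inter
    ((measurableSet_le measurable_const hnorm).inter (measurableSet_lt hnorm measurable_const))

theorem exists_tsum_gammaHat_subcubes_le (hd : 0 < d) (hp : 0 < p) (hγ : 0 ≤ γ)
    (hγp : ALocInfty fun z => γ z ^ p) : ∃ C : ℝ≥0, ∀ j k : ℕ, j ≤ k → ∀ m' : Fin n → ℤ,
      ∑' m : subcubes j m' k, gammaHat γ p k m ^ p ≤ C * gammaHat γ p j m' ^ p := by
  obtain ⟨C, hC⟩ := exists_weightMass_shellHull_le hd hγp 0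
  refine ⟨C, fun j k hjk m' => ?_⟩
  have hdisj : Pairwise (Function.onFun Disjoint
      fun m : subcubes j m' k => shellBox d k (m : Fin n → ℤ)) := fun m₁ m₂ h =>
    Set.disjoint_left.2 fun z hz₁ hz₂ => Set.disjoint_left.1
      (disjoint_dyadicCube (Subtype.coe_ne_coe.2 h)) hz₁.1 hz₂.1
  simp only [gammaHat_rpow hγ hp]
  refine le_trans ?_ (hC j m' m' (by simp))
  simp only [weightMass]
  rw [← lintegral_iUnion (fun m => measurableSet_shellBox d k _) hdisj]
  exact lintegral_mono_set (Set.iUnion_subset fun m => shellBox_subset_shellHull hjk m.2)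

theorem exists_mem_lt_of_lt_sSup {S : Set ℝ} {x : ℝ} (hx : 0 ≤ x) (h : x < sSup S) :
    ∃ y ∈ S, x < y := by
  refine exists_lt_of_lt_csSup (Set.nonempty_iff_ne_empty.2 ?_) h
  rintro rfl
  exact (hx.trans_lt h).ne' Real.sSup_empty

theorem one_le_two_rpow {x : ℝ} (hx : 0 ≤ x) : 1 ≤ (2 : ℝ≥0∞) ^ x :=
  by simpa using ENNReal.rpow_le_rpow_of_exponent_le one_le_two hx

theorem exists_tsum_gammaHat_le_of_lt_delta1 (hd : 0 < d) (hp : 0 < p) (hγ : 0 ≤ γ)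
    (hγp : ALocInfty fun z => γ z ^ p) {δ : ℝ} (hδ : δ < delta1 γ p) :
    ∃ C : ℝ≥0, ∀ j k : ℕ, j ≤ k → ∀ m' : Fin n → ℤ,
      ∑' m : subcubes j m' k, gammaHat γ p k m ^ p ≤
        C * (2 : ℝ≥0∞) ^ (((j : ℝ) - k) * d * δ) * gammaHat γ p j m' ^ p := by
  have hneg : ∀ j k : ℕ, j ≤ k → ((j : ℝ) - k) * d ≤ 0 := fun j k hjk =>
    mul_nonpos_of_nonpos_of_nonneg (sub_nonpos.2 (Nat.cast_le.2 hjk)) d.cast_nonneg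
  rcases le_or_gt 0 δ with h | h
  · obtain ⟨δ', ⟨-, C, hC⟩, hδδ'⟩ := exists_mem_lt_of_lt_sSup h hδ
    refine ⟨C, fun j k hjk m' => (hC j k hjk m').trans ?_⟩
    exact mul_le_mul' (mul_le_mul' le_rfl (ENNReal.rpow_le_rpow_of_exponent_le one_le_two
      (mul_le_mul_of_nonpos_left hδδ'.le (hneg j k hjk)))) le_rfl
  · obtain ⟨C, hC⟩ := exists_tsum_gammaHat_subcubes_le hd hp hγ hγp
    refine ⟨C, fun j k hjk m' => (hC j k hjk m').trans ?_⟩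
    gcongr
    exact le_mul_of_one_le_right' (one_le_two_rpow
      (mul_nonneg_of_nonpos_of_nonpos (hneg j k hjk) h.le))

theorem ofReal_two_pow_div (j k : ℕ) :
    ENNReal.ofReal (2 ^ j / 2 ^ k) = (2 : ℝ≥0∞) ^ ((j : ℝ) - k) := by
  rw [← Real.rpow_natCast, ← Real.rpow_natCast, ← Real.rpow_sub two_pos,
    ← ENNReal.ofReal_rpow_of_pos two_pos, ENNReal.ofReal_ofNat]

theorem exists_tsum_gammaHat_not_isInner_le_of_lt_delta2 (l : ℕ) {δ : ℝ} (hδ : δ < delta2 γ p) :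
    ∃ C : ℝ≥0, ∀ j k : ℕ, j ≤ k → ∀ m' : Fin n → ℤ,
      ∑' m : {m ∈ subcubes j m' k | ¬ IsInner l j k m}, gammaHat γ p k m ^ p ≤
        C * (2 : ℝ≥0∞) ^ (((j : ℝ) - k) * δ) * ∑' m : subcubes j m' k, gammaHat γ p k m ^ p := by
  have hneg : ∀ j k : ℕ, j ≤ k → (j : ℝ) - k ≤ 0 := fun j k hjk =>
    sub_nonpos.2 (Nat.cast_le.2 hjk)
  rcases le_or_gt 0 δ with h | h
  · obtain ⟨δ', ⟨hδ'0, C, hC⟩, hδδ'⟩ := exists_mem_lt_of_lt_sSup h hδ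
    refine ⟨C * (4 * l * n) ^ δ', fun j k hjk m' =>
      (hC j k hjk m' _ (Set.sep_subset _ _)).trans ?_⟩
    have hratio : volume (⋃ m ∈ {m ∈ subcubes j m' k | ¬ IsInner l j k m}, dyadicCube k m) /
        volume (dyadicCube j m') ≤ (4 * l * n : ℝ≥0) * (2 : ℝ≥0∞) ^ ((j : ℝ) - k) := by
      refine ENNReal.div_le_of_le_mul ((volume_iUnion_not_isInner_le l hjk m').trans_eq ?_)
      rw [ENNReal.ofReal_mul (by positivity), ofReal_two_pow_div]
      congr 2
      rw [ENNReal.ofReal_eq_coe_nnreal (by positivity)]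
      rfl
    refine mul_le_mul' ?_ le_rfl
    rw [ENNReal.coe_mul, mul_assoc]
    refine mul_le_mul' le_rfl ?_
    refine (ENNReal.rpow_le_rpow hratio hδ'0.le).trans ?_
    rw [ENNReal.mul_rpow_of_nonneg _ _ hδ'0.le, ← ENNReal.rpow_mul,
      ENNReal.coe_rpow_of_nonneg _ hδ'0.le]
    exact mul_le_mul' le_rfl (ENNReal.rpow_le_rpow_of_exponent_le one_le_two
      (mul_le_mul_of_nonpos_left hδδ'.le (hneg j k hjk)))
  · refine ⟨1, fun j k hjk m' => ?_⟩
    rw [ENNReal.coe_one, one_mul]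
    exact (ENNReal.tsum_mono_subtype (fun m => gammaHat γ p k m ^ p)
      (Set.sep_subset _ _)).trans (le_mul_of_one_le_left' (one_le_two_rpow
        (mul_nonneg_of_nonpos_of_nonpos (hneg j k hjk) h.le)))

end Gamma

theorem le_pow_mul_of_dist_le {E : Type*} [NormedAddCommGroup E] [NormedSpace ℝ E] {f : E → ℝ}
    {K δ : ℝ} (hK : 0 ≤ K) (hδ : 0 ≤ δ) (h : ∀ x y, dist x y ≤ δ → f x ≤ K * f y) (M : ℕ) :
    ∀ {x y : E}, dist x y ≤ M * δ → f x ≤ K ^ M * f y := by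
  induction M with
  | zero =>
    intro x y hxy
    rw [Nat.cast_zero, zero_mul, dist_le_zero] at hxy
    rw [hxy, pow_zero, one_mul]
  | succ M ih =>
    intro x y hxy
    obtain ⟨z, hxz, hzy⟩ := exists_dist_le_le (by positivity : 0 ≤ M * δ) hδ
      (hxy.trans_eq (by push_cast; ring))
    calc f x ≤ K ^ M * f z := ih hxz
      _ ≤ K ^ M * (K * f y) := by gcongr; exact h z y hzy
      _ = K ^ (M + 1) * f y := by ring

theorem setLAverage_le_mul_setLAverage {X : Type*} [MeasurableSpace X] {μ : Measure X}
    {A B : Set X} (hA : MeasurableSet A) (hB : MeasurableSet B) (hB₀ : μ B ≠ 0)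
    (hB' : μ B ≠ ∞) {f g : X → ℝ≥0∞} {K : ℝ≥0∞} (hK : K ≠ ∞)
    (h : ∀ x ∈ A, ∀ y ∈ B, f x ≤ K * g y) : ⨍⁻ x in A, f x ∂μ ≤ K * ⨍⁻ y in B, g y ∂μ := by
  have hx : ∀ x ∈ A, f x ≤ K * ⨍⁻ y in B, g y ∂μ := fun x hx => by
    rw [setLAverage_eq, ← mul_div_assoc, ENNReal.le_div_iff_mul_le (Or.inl hB₀) (Or.inl hB'),
      ← lintegral_const_mul' _ _ hK, ← setLIntegral_const]
    exact setLIntegral_mono' hB (h x hx)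
  rw [setLAverage_eq]
  refine ENNReal.div_le_of_le_mul ((setLIntegral_mono' hA hx).trans_eq ?_)
  rw [setLIntegral_const]

theorem volume_dyadicCube {n : ℕ} (k : ℕ) (m : Fin n → ℤ) :
    volume (dyadicCube k m) = (2 ^ ((k : ℝ) * n) : ℝ≥0∞)⁻¹ := by
  rw [dyadicCube, volume_openCube, Fintype.card_fin, one_div, ENNReal.ofReal_inv_of_pos
    (by positivity), ENNReal.ofReal_pow zero_le_two, ENNReal.ofReal_ofNat, ENNReal.rpow_mul,
    ENNReal.rpow_natCast, ENNReal.rpow_natCast, ENNReal.inv_pow, ENNReal.inv_pow, ENNReal.inv_pow]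

theorem two_rpow_add (x y : ℝ) : (2 : ℝ≥0∞) ^ (x + y) = 2 ^ x * 2 ^ y :=
  ENNReal.rpow_add _ _ two_ne_zero ENNReal.ofNat_ne_top

theorem two_rpow_ne_top (x : ℝ) : (2 : ℝ≥0∞) ^ x ≠ ∞ :=
  ENNReal.rpow_ne_top_of_ne_zero two_ne_zero ENNReal.ofNat_ne_top

/-- The upper half of `^loc Y^{α₃}_{α₁, α₂}`: the sequence grows at most like `2^{α₂ k}`, and `s_k`
varies slowly at scale `2^{-k}`. -/
structure LocYUpper {n : ℕ} (α₂ α₃ C₁ : ℝ) (s : ℕ → (Fin n → ℝ) → ℝ) : Prop where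
  nonneg : ∀ k, 0 ≤ s k
  upper : ∀ j k : ℕ, j ≤ k → ∀ x, s k x ≤ C₁ * (2 : ℝ) ^ (α₂ * ((k : ℝ) - j)) * s j x
  compare : ∀ (k : ℕ) (x y : Fin n → ℝ),
    dist (WithLp.toLp 2 x) (WithLp.toLp 2 y) ≤ 1 / 2 ^ k → s k x ≤ (2 : ℝ) ^ α₃ * s k y

theorem LocY.locYUpper {n : ℕ} {α₁ α₂ α₃ C₁ : ℝ} {s : ℕ → (Fin n → ℝ) → ℝ}
    (hs : LocY α₁ α₂ α₃ C₁ s) : LocYUpper α₂ α₃ C₁ s where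
  nonneg k x := ((hs.isWeight k).2 x).le
  upper j k hjk x := (div_le_iff₀ ((hs.isWeight j).2 x)).1 (hs.upper j k hjk x)
  compare := hs.compare

namespace LocYUpper

variable {n : ℕ} {α₂ α₃ C₁ p : ℝ} {s : ℕ → (Fin n → ℝ) → ℝ} {j k : ℕ}

theorem le_of_abs_sub_le (hs : LocYUpper α₂ α₃ C₁ s) (hjk : j ≤ k) (M : ℕ) {x y : Fin n → ℝ}
    (h : ∀ i, |x i - y i| ≤ M * (1 / 2 ^ j)) :
    s k x ≤ |C₁| * ((2 : ℝ) ^ α₃) ^ (n * M) * (2 : ℝ) ^ (α₂ * ((k : ℝ) - j)) * s j y := by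
  have hdist : dist (WithLp.toLp 2 x) (WithLp.toLp 2 y) ≤ (n * M : ℕ) * (1 / 2 ^ j) := by
    rw [dist_eq_norm, ← WithLp.toLp_sub]
    refine (norm_toLp_le_sum _).trans ((Finset.sum_le_card_nsmul _ _ _ fun i _ => h i).trans_eq ?_)
    rw [Finset.card_univ, Fintype.card_fin, nsmul_eq_mul, Nat.cast_mul, mul_assoc]
  have hj := hs.nonneg j x
  calc s k x ≤ C₁ * (2 : ℝ) ^ (α₂ * ((k : ℝ) - j)) * s j x := hs.upper j k hjk x
    _ ≤ |C₁| * (2 : ℝ) ^ (α₂ * ((k : ℝ) - j)) * s j x := by gcongr; exact le_abs_self C₁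
    _ ≤ |C₁| * (2 : ℝ) ^ (α₂ * ((k : ℝ) - j)) * (((2 : ℝ) ^ α₃) ^ (n * M) * s j y) := by
        gcongr
        exact le_pow_mul_of_dist_le (f := fun z => s j (WithLp.ofLp z)) (by positivity)
          (by positivity) (fun z w => hs.compare j (WithLp.ofLp z) (WithLp.ofLp w)) _ hdist
    _ = _ := by ring

theorem setLAverage_le (hs : LocYUpper α₂ α₃ C₁ s) (hp : 0 ≤ p) (hjk : j ≤ k) (M : ℕ)
    {m m' : Fin n → ℤ}
    (h : ∀ x ∈ dyadicCube k m, ∀ y ∈ dyadicCube j m', ∀ i, |x i - y i| ≤ M * (1 / 2 ^ j)) :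
    ⨍⁻ x in dyadicCube k m, ‖s k x‖ₑ ^ p ∂volume ≤
      ENNReal.ofReal (|C₁| * ((2 : ℝ) ^ α₃) ^ (n * M)) ^ p *
        (2 : ℝ≥0∞) ^ (((k : ℝ) - j) * α₂ * p) * ⨍⁻ y in dyadicCube j m', ‖s j y‖ₑ ^ p ∂volume := by
  refine setLAverage_le_mul_setLAverage (measurableSet_dyadicCube k m)
    (measurableSet_dyadicCube j m') ?_ ?_ (ENNReal.mul_ne_top (ENNReal.rpow_ne_top_of_nonneg hp
      ENNReal.ofReal_ne_top) (two_rpow_ne_top _)) fun x hx y hy => ?_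
  · rw [volume_dyadicCube]
    exact ENNReal.inv_ne_zero.2 (two_rpow_ne_top _)
  · rw [volume_dyadicCube]
    exact ENNReal.inv_ne_top.2 (ENNReal.rpow_pos two_pos ENNReal.ofNat_ne_top).ne'
  rw [Real.enorm_of_nonneg (hs.nonneg k x), Real.enorm_of_nonneg (hs.nonneg j y)]
  refine (ENNReal.rpow_le_rpow (ENNReal.ofReal_le_ofReal
    (hs.le_of_abs_sub_le hjk M (h x hx y hy))) hp).trans_eq ?_
  rw [ENNReal.ofReal_mul (by positivity), ENNReal.ofReal_mul (by positivity),
    ENNReal.mul_rpow_of_nonneg _ _ hp, ENNReal.mul_rpow_of_nonneg _ _ hp,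
    ← ENNReal.ofReal_rpow_of_pos two_pos, ENNReal.ofReal_ofNat, ← ENNReal.rpow_mul,
    mul_comm α₂]

end LocYUpper

section TSeq

variable {n d : ℕ} {γ : (Fin n ⊕ Fin d → ℝ) → ℝ} {p : ℝ}

theorem tSeq_rpow (s : ℕ → (Fin n → ℝ) → ℝ) (γ : (Fin n ⊕ Fin d → ℝ) → ℝ) (hp : 0 < p) (k : ℕ)
    (m : Fin n → ℤ) : tSeq s γ p k m ^ p =
      (⨍⁻ x in dyadicCube k m, ‖s k x‖ₑ ^ p ∂volume) * gammaHat γ p k m ^ p := by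
  rw [tSeq, ENNReal.mul_rpow_of_nonneg _ _ hp.le, ENNReal.mul_rpow_of_nonneg _ _ hp.le,
    lpNormOn_rpow _ hp, ← ENNReal.rpow_mul, div_mul_cancel₀ _ hp.ne', setLAverage_eq,
    volume_dyadicCube, ENNReal.div_eq_inv_mul, inv_inv]

theorem abs_sub_le_of_mem_dyadicCube {j L : ℕ} {m m' : Fin n → ℤ} (h : ∀ i, |m i - m' i| ≤ L)
    {x y : Fin n → ℝ} (hx : x ∈ dyadicCube j m) (hy : y ∈ dyadicCube j m') (i : Fin n) :
    |x i - y i| ≤ (L + 1 : ℕ) * (1 / 2 ^ j) := by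
  have hxi := mem_dyadicCube.1 hx i
  have hyi := mem_dyadicCube.1 hy i
  have hm : |(m i : ℝ) - m' i| ≤ L := mod_cast h i
  rw [abs_le] at hm
  have hj : (0 : ℝ) < 2 ^ j := by positivity
  rw [mul_one_div, abs_le, ← neg_div, div_le_iff₀ hj, le_div_iff₀ hj]
  push_cast
  constructor <;> linarith

theorem exists_tSeq_neighbour_le (hd : 0 < d) (hp : 0 < p) (hγ : 0 ≤ γ)
    (hγp : ALocInfty fun z => γ z ^ p) (α₂ α₃ C₁ : ℝ) (L : ℕ) :
    ∃ C : ℝ≥0, ∀ s : ℕ → (Fin n → ℝ) → ℝ, LocYUpper α₂ α₃ C₁ s → ∀ (k : ℕ) (m m' : Fin n → ℤ),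
      (∀ i, |m i - m' i| ≤ L) → tSeq s γ p k m ^ p ≤ C * tSeq s γ p k m' ^ p := by
  obtain ⟨C, hC⟩ := exists_gammaHat_neighbour_le hd hp hγ hγp L
  refine ⟨(|C₁| * ((2 : ℝ) ^ α₃) ^ (n * (L + 1))).toNNReal ^ p * C, fun s hs k m m' h => ?_⟩
  rw [tSeq_rpow s γ hp, tSeq_rpow s γ hp]
  have hav := hs.setLAverage_le hp.le (le_refl k) (L + 1) fun x hx y hy =>
    abs_sub_le_of_mem_dyadicCube h hx hy
  rw [sub_self, zero_mul, zero_mul, ENNReal.rpow_zero, mul_one] at hav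
  refine (mul_le_mul' hav (hC k m m' h)).trans_eq ?_
  rw [ENNReal.coe_mul, ENNReal.coe_rpow_of_nonneg _ hp.le, ENNReal.ofReal]
  ring

theorem exists_setLAverage_subcube_le (n : ℕ) (hp : 0 ≤ p) (α₂ α₃ C₁ : ℝ) :
    ∃ K : ℝ≥0, ∀ s : ℕ → (Fin n → ℝ) → ℝ, LocYUpper α₂ α₃ C₁ s → ∀ j k : ℕ, j ≤ k →
      ∀ m' : Fin n → ℤ, ∀ m ∈ subcubes j m' k, ⨍⁻ x in dyadicCube k m, ‖s k x‖ₑ ^ p ∂volume ≤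
        K * (2 : ℝ≥0∞) ^ (((k : ℝ) - j) * α₂ * p) *
          ⨍⁻ y in dyadicCube j m', ‖s j y‖ₑ ^ p ∂volume := by
  refine ⟨(|C₁| * ((2 : ℝ) ^ α₃) ^ (n * 1)).toNNReal ^ p, fun s hs j k hjk m' m hm => ?_⟩
  rw [ENNReal.coe_rpow_of_nonneg _ hp]
  exact hs.setLAverage_le hp hjk 1 fun x hx y hy =>
    abs_sub_le_of_mem_dyadicCube (L := 0) (by simp) (hm hx) hy

open Classical in
/-- The decay rate of the `l`-th differences of step `2^{-k}` of a spline of generation `j` on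
`Q_{k,m}`: `2^{(j-k)l}` if all the differences stay in one cube of generation `j`, where the spline
is a polynomial, and `2^{(j-k)(l-1)}` otherwise. -/
noncomputable def layerRate {n : ℕ} (l j k : ℕ) (m : Fin n → ℤ) : ℝ≥0∞ :=
  if IsInner l j k m then (2 : ℝ≥0∞) ^ (((j : ℝ) - k) * l) else 2 ^ (((j : ℝ) - k) * (l - 1))

theorem tsum_layerRate_rpow_mul_le (l j k : ℕ) (m' : Fin n → ℤ) (g : (Fin n → ℤ) → ℝ≥0∞) :
    ∑' m : subcubes j m' k, layerRate l j k m.1 ^ p * g m ≤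
      2 ^ (((j : ℝ) - k) * (l * p)) * ∑' m : subcubes j m' k, g m +
        2 ^ (((j : ℝ) - k) * ((l - 1) * p)) *
          ∑' m : {m ∈ subcubes j m' k | ¬ IsInner l j k m}, g m := by
  rw [tsum_subtype (subcubes j m' k) g, tsum_subtype {m ∈ subcubes j m' k | ¬ IsInner l j k m} g,
    tsum_subtype (subcubes j m' k) fun m => layerRate l j k m ^ p * g m, ← ENNReal.tsum_mul_left,
    ← ENNReal.tsum_mul_left, ← ENNReal.tsum_add]
  refine ENNReal.tsum_le_tsum fun m => ?_
  by_cases hm : m ∈ subcubes j m' k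
  · rw [Set.indicator_of_mem hm, Set.indicator_of_mem hm]
    by_cases hi : IsInner l j k m
    · rw [layerRate, if_pos hi, ← ENNReal.rpow_mul, mul_assoc ((j : ℝ) - k)]
      exact le_self_add
    · rw [layerRate, if_neg hi, ← ENNReal.rpow_mul, mul_assoc ((j : ℝ) - k),
        Set.indicator_of_mem (show m ∈ {m ∈ subcubes j m' k | ¬ IsInner l j k m} from ⟨hm, hi⟩)]
      exact le_add_self
  · rw [Set.indicator_of_notMem hm]
    exact zero_le

theorem exists_tsum_layerRate_gammaHat_le (hd : 0 < d) (hp : 0 < p) (hγ : 0 ≤ γ)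
    (hγp : ALocInfty fun z => γ z ^ p) (l : ℕ) {δ₁ δ₂ : ℝ} (hδ₁ : δ₁ < delta1 γ p)
    (hδ₂ : δ₂ < delta2 γ p) : ∃ C : ℝ≥0, ∀ j k : ℕ, j ≤ k → ∀ m' : Fin n → ℤ,
      ∑' m : subcubes j m' k, layerRate l j k m.1 ^ p * gammaHat γ p k m ^ p ≤
        C * (2 : ℝ≥0∞) ^ (((j : ℝ) - k) * (min (l : ℝ) (l - 1 + δ₂ / p) * p + d * δ₁)) *
          gammaHat γ p j m' ^ p := by
  obtain ⟨D₁, hD₁⟩ := exists_tsum_gammaHat_le_of_lt_delta1 hd hp hγ hγp hδ₁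
  obtain ⟨D₂, hD₂⟩ := exists_tsum_gammaHat_not_isInner_le_of_lt_delta2 l hδ₂
  refine ⟨(1 + D₂) * D₁, fun j k hjk m' => ?_⟩
  have hjk' : (j : ℝ) - k ≤ 0 := sub_nonpos.2 (Nat.cast_le.2 hjk)
  set lam : ℝ := min (l : ℝ) (l - 1 + δ₂ / p)
  have hmono : ∀ a : ℝ, lam ≤ a →
      (2 : ℝ≥0∞) ^ (((j : ℝ) - k) * (a * p)) ≤ 2 ^ (((j : ℝ) - k) * (lam * p)) := fun a ha =>
    ENNReal.rpow_le_rpow_of_exponent_le one_le_two (mul_le_mul_of_nonpos_left (by gcongr) hjk')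
  have hlayer : (2 : ℝ≥0∞) ^ (((j : ℝ) - k) * ((l - 1) * p)) * 2 ^ (((j : ℝ) - k) * δ₂) ≤
      2 ^ (((j : ℝ) - k) * (lam * p)) := by
    rw [← two_rpow_add, show ((j : ℝ) - k) * ((l - 1) * p) + ((j : ℝ) - k) * δ₂ =
      ((j : ℝ) - k) * ((l - 1 + δ₂ / p) * p) by field_simp]
    exact hmono _ (min_le_right _ _)
  calc ∑' m : subcubes j m' k, layerRate l j k m.1 ^ p * gammaHat γ p k m ^ p
      ≤ 2 ^ (((j : ℝ) - k) * (l * p)) * ∑' m : subcubes j m' k, gammaHat γ p k m ^ p +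
          2 ^ (((j : ℝ) - k) * ((l - 1) * p)) * (D₂ * 2 ^ (((j : ℝ) - k) * δ₂) *
            ∑' m : subcubes j m' k, gammaHat γ p k m ^ p) :=
        (tsum_layerRate_rpow_mul_le l j k m' fun m => gammaHat γ p k m ^ p).trans
          (add_le_add le_rfl (mul_le_mul' le_rfl (hD₂ j k hjk m')))
    _ = (2 ^ (((j : ℝ) - k) * (l * p)) + D₂ * (2 ^ (((j : ℝ) - k) * ((l - 1) * p)) *
          2 ^ (((j : ℝ) - k) * δ₂))) * ∑' m : subcubes j m' k, gammaHat γ p k m ^ p := by ring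
    _ ≤ (2 ^ (((j : ℝ) - k) * (lam * p)) + D₂ * 2 ^ (((j : ℝ) - k) * (lam * p))) *
          (D₁ * 2 ^ (((j : ℝ) - k) * d * δ₁) * gammaHat γ p j m' ^ p) :=
        mul_le_mul' (add_le_add (hmono _ (min_le_left _ _)) (mul_le_mul' le_rfl hlayer))
          (hD₁ j k hjk m')
    _ = _ := by
        rw [mul_add, two_rpow_add, mul_assoc ((j : ℝ) - k) (d : ℝ)]
        push_cast
        ring

theorem exists_tsum_layerRate_tSeq_le (hd : 0 < d) (hp : 0 < p) (hγ : 0 ≤ γ)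
    (hγp : ALocInfty fun z => γ z ^ p) (α₂ α₃ C₁ : ℝ) (l : ℕ) {ε : ℝ} (hε : 0 < ε) :
    ∃ C : ℝ≥0, ∀ s : ℕ → (Fin n → ℝ) → ℝ, LocYUpper α₂ α₃ C₁ s → ∀ j k : ℕ, j ≤ k →
      ∀ m' : Fin n → ℤ, ∑' m : subcubes j m' k, layerRate l j k m.1 ^ p * tSeq s γ p k m ^ p ≤
        C * (2 : ℝ≥0∞) ^ (((j : ℝ) - k) * rate l p α₂ ε γ * p) * tSeq s γ p j m' ^ p := by
  obtain ⟨D, hD⟩ := exists_tsum_layerRate_gammaHat_le hd hp hγ hγp l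
    (sub_lt_self (delta1 γ p) hε) (sub_lt_self (delta2 γ p) hε)
  obtain ⟨K, hK⟩ := exists_setLAverage_subcube_le n hp.le α₂ α₃ C₁
  refine ⟨K * D, fun s hs j k hjk m' => ?_⟩
  set lam : ℝ := min (l : ℝ) (l - 1 + (delta2 γ p - ε) / p) with hlam
  set A : ℝ≥0∞ := K * (2 : ℝ≥0∞) ^ (((k : ℝ) - j) * α₂ * p) *
    ⨍⁻ y in dyadicCube j m', ‖s j y‖ₑ ^ p ∂volume
  calc ∑' m : subcubes j m' k, layerRate l j k m.1 ^ p * tSeq s γ p k m ^ p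
      ≤ ∑' m : subcubes j m' k, A * (layerRate l j k m.1 ^ p * gammaHat γ p k m ^ p) := by
        refine ENNReal.tsum_le_tsum fun m => ?_
        rw [tSeq_rpow s γ hp, mul_left_comm]
        exact mul_le_mul' (hK s hs j k hjk m' m m.2) le_rfl
    _ ≤ A * (D * 2 ^ (((j : ℝ) - k) * (lam * p + d * (delta1 γ p - ε))) *
          gammaHat γ p j m' ^ p) := by
        rw [ENNReal.tsum_mul_left]
        exact mul_le_mul' le_rfl (hD j k hjk m')
    _ = K * D * (2 ^ (((k : ℝ) - j) * α₂ * p) *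
          2 ^ (((j : ℝ) - k) * (lam * p + d * (delta1 γ p - ε)))) *
            ((⨍⁻ y in dyadicCube j m', ‖s j y‖ₑ ^ p ∂volume) * gammaHat γ p j m' ^ p) := by ring
    _ = _ := by
        rw [tSeq_rpow s γ hp, ← two_rpow_add, ENNReal.coe_mul]
        congr 3
        rw [rate, ← hlam]
        field_simp
        ring

theorem exists_tSeq_child_le (hd : 0 < d) (hp : 0 < p) (hγ : 0 ≤ γ)
    (hγp : ALocInfty fun z => γ z ^ p) (α₂ α₃ C₁ : ℝ) :
    ∃ C : ℝ≥0, ∀ s : ℕ → (Fin n → ℝ) → ℝ, LocYUpper α₂ α₃ C₁ s → ∀ (j : ℕ) (m m' : Fin n → ℤ),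
      m ∈ subcubes j m' (j + 1) → tSeq s γ p (j + 1) m ^ p ≤ C * tSeq s γ p j m' ^ p := by
  obtain ⟨D, hD⟩ := exists_tsum_gammaHat_subcubes_le hd hp hγ hγp
  obtain ⟨K, hK⟩ := exists_setLAverage_subcube_le n hp.le α₂ α₃ C₁
  refine ⟨K * 2 ^ (α₂ * p) * D, fun s hs j m m' h => ?_⟩
  have hγm : gammaHat γ p (j + 1) m ^ p ≤ D * gammaHat γ p j m' ^ p :=
    (ENNReal.le_tsum (f := fun m : subcubes j m' (j + 1) => gammaHat γ p (j + 1) m ^ p)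
      ⟨m, h⟩).trans (hD j (j + 1) j.le_succ m')
  rw [tSeq_rpow s γ hp, tSeq_rpow s γ hp]
  refine (mul_le_mul' (hK s hs j (j + 1) j.le_succ m' m h) hγm).trans_eq ?_
  rw [Nat.cast_succ, add_sub_cancel_left, one_mul, ENNReal.coe_mul, ENNReal.coe_mul,
    ENNReal.coe_rpow_of_ne_zero two_ne_zero, ENNReal.coe_ofNat]
  ring

end TSeq

section QuasiNorms

theorem sum_rpow_le_card_rpow_mul_sum {ι : Type*} (s : Finset ι) (a : ι → ℝ≥0∞) {p : ℝ}
    (hp : 0 < p) : (∑ i ∈ s, a i) ^ p ≤ (s.card : ℝ≥0∞) ^ p * ∑ i ∈ s, a i ^ p := by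
  have hle : ∀ i ∈ s, a i ≤ (∑ i ∈ s, a i ^ p) ^ (1 / p) := fun i hi => by
    rw [one_div, ENNReal.le_rpow_inv_iff hp]
    exact Finset.single_le_sum (f := fun i => a i ^ p) (fun _ _ => zero_le) hi
  refine (ENNReal.rpow_le_rpow (Finset.sum_le_card_nsmul s _ _ hle) hp.le).trans_eq ?_
  rw [nsmul_eq_mul, ENNReal.mul_rpow_of_nonneg _ _ hp.le, ← ENNReal.rpow_mul,
    one_div_mul_cancel hp.ne', ENNReal.rpow_one]

-- Minkowski's inequality with exponent `r / μ` for the functions `f ^ μ` and `g ^ μ`.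
theorem lintegral_rpow_root_rpow_le_add {X : Type*} [MeasurableSpace X] {ν : Measure X}
    {f g h : X → ℝ≥0∞} (hf : AEMeasurable f ν) (hg : AEMeasurable g ν) {μ r : ℝ} (hμ : 0 < μ)
    (hμr : μ ≤ r) (hfg : ∀ x, h x ^ μ ≤ f x ^ μ + g x ^ μ) :
    ((∫⁻ x, h x ^ r ∂ν) ^ (1 / r)) ^ μ ≤
      ((∫⁻ x, f x ^ r ∂ν) ^ (1 / r)) ^ μ + ((∫⁻ x, g x ^ r ∂ν) ^ (1 / r)) ^ μ := by
  have hr : 0 < r := hμ.trans_le hμr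
  have hroot : ∀ u : X → ℝ≥0∞, ((∫⁻ x, u x ^ r ∂ν) ^ (1 / r)) ^ μ =
      (∫⁻ x, (u x ^ μ) ^ (r / μ) ∂ν) ^ (1 / (r / μ)) := fun u => by
    simp only [← ENNReal.rpow_mul, mul_div_cancel₀ r hμ.ne', one_div_div, one_div_mul_eq_div]
  simp only [hroot]
  refine le_trans ?_ (ENNReal.lintegral_Lp_add_le (hf.pow_const μ) (hg.pow_const μ)
    ((one_le_div hμ).2 hμr))
  exact ENNReal.rpow_le_rpow (lintegral_mono fun x =>
    ENNReal.rpow_le_rpow (hfg x) (by positivity)) (by positivity)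

theorem enorm_add_rpow_le {μ : ℝ} (hμ : 0 ≤ μ) (hμ1 : μ ≤ 1) (x y : ℝ) :
    ‖x + y‖ₑ ^ μ ≤ ‖x‖ₑ ^ μ + ‖y‖ₑ ^ μ :=
  (ENNReal.rpow_le_rpow (enorm_add_le x y) hμ).trans (ENNReal.rpow_add_le_add_rpow _ _ hμ hμ1)

theorem lpNormOn_add_rpow_le {ι : Type*} [Fintype ι] {f g : (ι → ℝ) → ℝ} (hf : Measurable f)
    (hg : Measurable g) {μ r : ℝ} (hμ : 0 < μ) (hμ1 : μ ≤ 1) (hμr : μ ≤ r) (E : Set (ι → ℝ)) :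
    lpNormOn (f + g) r E ^ μ ≤ lpNormOn f r E ^ μ + lpNormOn g r E ^ μ := by
  simp only [lpNormOn_eq _ (hμ.trans_le hμr)]
  exact lintegral_rpow_root_rpow_le_add hf.enorm.aemeasurable hg.enorm.aemeasurable hμ hμr
    fun x => enorm_add_rpow_le hμ.le hμ1 (f x) (g x)

end QuasiNorms

section Diff

variable {n : ℕ}

theorem measurable_fwdDiff_prod {f : (Fin n → ℝ) → ℝ} (hf : Measurable f) (l : ℕ) :
    Measurable fun z : (Fin n → ℝ) × (Fin n → ℝ) => (fwdDiff z.1)^[l] f z.2 := by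
  simp only [fwdDiff_iter_eq_sum_shift, zsmul_eq_mul]
  refine Finset.measurable_sum _ fun i _ => Measurable.const_mul (hf.comp ?_) _
  fun_prop

theorem dyadicDiff_eq (l : ℕ) (r : ℝ) (k : ℕ) (m : Fin n → ℤ) (f : (Fin n → ℝ) → ℝ) :
    dyadicDiff l r k m f = ((2 : ℝ≥0∞) ^ ((k : ℝ) * n + k * n) *
      ∫⁻ v in openCube (fun _ : Fin n => -(1 / 2 ^ k : ℝ)) (2 * (1 / 2 ^ k)),
        ∫⁻ x in dyadicCube k m, ‖(fwdDiff v)^[l] f x‖ₑ ^ r) ^ (1 / r) := by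
  have hscale : (ENNReal.ofReal ((1 / 2 ^ k : ℝ) ^ (2 * n)))⁻¹ =
      (2 : ℝ≥0∞) ^ ((k : ℝ) * n + k * n) := by
    rw [← ENNReal.ofReal_inv_of_pos (by positivity), one_div, inv_pow, inv_inv, ← pow_mul,
      ENNReal.ofReal_pow (by norm_num), ENNReal.ofReal_ofNat, ← ENNReal.rpow_natCast]
    congr 1
    push_cast
    ring
  rw [dyadicDiff, localDiff, hscale, dyadicCube]

theorem dyadicDiff_congr {f g : (Fin n → ℝ) → ℝ} (h : f =ᵐ[volume] g) (l : ℕ) (r : ℝ) (k : ℕ)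
    (m : Fin n → ℤ) : dyadicDiff l r k m f = dyadicDiff l r k m g := by
  simp only [dyadicDiff_eq]
  congr 2
  refine lintegral_congr fun v => lintegral_congr_ae (ae_restrict_of_ae ?_)
  have hshift : ∀ i : ℕ, ∀ᵐ x : Fin n → ℝ, f (x + i • v) = g (x + i • v) := fun i =>
    (measurePreserving_add_right volume (i • v)).quasiMeasurePreserving.ae h
  filter_upwards [ae_all_iff.2 hshift] with x hx
  simp only [fwdDiff_iter_eq_sum_shift, hx]

theorem dyadicDiff_add_rpow_le {f g : (Fin n → ℝ) → ℝ} (hf : Measurable f) (hg : Measurable g)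
    (l : ℕ) {r μ : ℝ} (hμ : 0 < μ) (hμ1 : μ ≤ 1) (hμr : μ ≤ r) (k : ℕ) (m : Fin n → ℤ) :
    dyadicDiff l r k m (f + g) ^ μ ≤ dyadicDiff l r k m f ^ μ + dyadicDiff l r k m g ^ μ := by
  have hr : 0 < r := hμ.trans_le hμr
  set ν : Measure ((Fin n → ℝ) × (Fin n → ℝ)) :=
    (volume.restrict (openCube (fun _ : Fin n => -(1 / 2 ^ k : ℝ)) (2 * (1 / 2 ^ k)))).prod
      (volume.restrict (dyadicCube k m))
  have hmeas : ∀ {u : (Fin n → ℝ) → ℝ}, Measurable u →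
      Measurable fun z : (Fin n → ℝ) × (Fin n → ℝ) => ‖(fwdDiff z.1)^[l] u z.2‖ₑ :=
    fun hu => (measurable_fwdDiff_prod hu l).enorm
  have hprod : ∀ u : (Fin n → ℝ) → ℝ, Measurable u → dyadicDiff l r k m u ^ μ =
      ((2 : ℝ≥0∞) ^ ((k : ℝ) * n + k * n)) ^ (1 / r * μ) *
        ((∫⁻ z, ‖(fwdDiff z.1)^[l] u z.2‖ₑ ^ r ∂ν) ^ (1 / r)) ^ μ := fun u hu => by
    rw [lintegral_prod _ ((hmeas hu).pow_const r).aemeasurable, dyadicDiff_eq,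
      ENNReal.mul_rpow_of_nonneg _ _ (by positivity), ENNReal.mul_rpow_of_nonneg _ _ hμ.le,
      ENNReal.rpow_mul _ (1 / r) μ]
  rw [hprod _ (hf.add hg), hprod f hf, hprod g hg]
  refine le_trans ?_ (mul_add _ _ _).le
  refine mul_le_mul' le_rfl (lintegral_rpow_root_rpow_le_add (hmeas hf).aemeasurable
    (hmeas hg).aemeasurable hμ hμr fun z => ?_)
  rw [fwdDiff_iter_add]
  exact enorm_add_rpow_le hμ.le hμ1 _ _

theorem dyadicDiff_le_of_setLIntegral_le {l k : ℕ} {r : ℝ} (hr : 0 ≤ r) {m : Fin n → ℤ}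
    {f : (Fin n → ℝ) → ℝ} {I : ℝ≥0∞}
    (h : ∀ v : Fin n → ℝ, (∀ q, |2 ^ k * v q| ≤ 1) →
      ∫⁻ x in dyadicCube k m, ‖(fwdDiff v)^[l] f x‖ₑ ^ r ≤ I) :
    dyadicDiff l r k m f ≤ (2 ^ (n : ℝ) * (2 ^ ((k : ℝ) * n) * I)) ^ (1 / r) := by
  have h2k : (0 : ℝ) < 2 ^ k := by positivity
  have hstep : ∀ v ∈ openCube (fun _ : Fin n => -(1 / 2 ^ k : ℝ)) (2 * (1 / 2 ^ k)),
      ∀ q, |2 ^ k * v q| ≤ 1 := fun v hv q => by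
    rw [abs_mul, abs_of_pos h2k, mul_comm, ← le_div_iff₀ h2k, abs_le]
    exact ⟨(hv q).1.le, by linarith [(hv q).2]⟩
  have hvol : volume (openCube (fun _ : Fin n => -(1 / 2 ^ k : ℝ)) (2 * (1 / 2 ^ k))) =
      2 ^ (n : ℝ) * 2 ^ (-((k : ℝ) * n)) := by
    rw [volume_openCube, Fintype.card_fin, ENNReal.ofReal_mul (by norm_num), ENNReal.ofReal_ofNat,
      ← ENNReal.rpow_natCast, ENNReal.mul_rpow_of_nonneg _ _ n.cast_nonneg,
      ← pow_zero (2 : ℝ), ofReal_two_pow_div, ← ENNReal.rpow_mul]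
    simp
  rw [dyadicDiff_eq]
  refine ENNReal.rpow_le_rpow ?_ (by positivity)
  calc _ ≤ (2 : ℝ≥0∞) ^ ((k : ℝ) * n + k * n) * (I * (2 ^ (n : ℝ) * 2 ^ (-((k : ℝ) * n)))) := by
        rw [← hvol, ← setLIntegral_const]
        exact mul_le_mul' le_rfl (setLIntegral_mono' (measurableSet_openCube _ _)
          fun v hv => h v (hstep v hv))
    _ = 2 ^ (n : ℝ) * (2 ^ ((k : ℝ) * n + k * n + -((k : ℝ) * n)) * I) := by
        rw [two_rpow_add _ (-((k : ℝ) * n))]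
        ring
    _ = _ := by rw [add_neg_cancel_right]

theorem dyadicDiff_le_of_enorm_le {l k : ℕ} {r : ℝ} (hr : 0 < r) {m : Fin n → ℤ}
    {f : (Fin n → ℝ) → ℝ} {b : ℝ≥0∞}
    (h : ∀ v : Fin n → ℝ, (∀ q, |2 ^ k * v q| ≤ 1) → ∀ x ∈ dyadicCube k m,
      ‖(fwdDiff v)^[l] f x‖ₑ ≤ b) :
    dyadicDiff l r k m f ≤ 2 ^ ((n : ℝ) / r) * b := by
  refine (dyadicDiff_le_of_setLIntegral_le hr.le fun v hv =>
    setLIntegral_mono' (measurableSet_dyadicCube k m) fun x hx =>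
      ENNReal.rpow_le_rpow (h v hv x hx) hr.le).trans_eq ?_
  rw [setLIntegral_const, volume_dyadicCube, mul_left_comm (2 ^ ((k : ℝ) * n)),
    ENNReal.mul_inv_cancel (by simp) (two_rpow_ne_top _), mul_one,
    ENNReal.mul_rpow_of_nonneg _ _ (by positivity), ← ENNReal.rpow_mul, ← ENNReal.rpow_mul,
    mul_one_div_cancel hr.ne', ENNReal.rpow_one, mul_one_div]

end Diff

section Translation

variable {n : ℕ}

theorem cellIndex_preimage_ae_eq (k : ℕ) (m : Fin n → ℤ) :
    cellIndex k ⁻¹' {m} =ᵐ[volume] dyadicCube k m := by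
  have h2k : (0 : ℝ) < 2 ^ k := by positivity
  have hbox : cellIndex k ⁻¹' {m} =
      Set.univ.pi fun i => Set.Ico ((m i : ℝ) / 2 ^ k) ((m i : ℝ) / 2 ^ k + 1 / 2 ^ k) := by
    ext x
    simp only [Set.mem_preimage, Set.mem_singleton_iff, funext_iff, cellIndex, Int.floor_eq_iff,
      Set.mem_univ_pi, Set.mem_Ico, ← add_div, div_le_iff₀ h2k, lt_div_iff₀ h2k, mul_comm]
  rw [hbox, dyadicCube, openCube_eq_pi, volume_pi]
  exact Measure.univ_pi_Ico_ae_eq_Icc.trans Measure.univ_pi_Ioo_ae_eq_Icc.symm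

theorem measurable_cellIndex (k : ℕ) : Measurable (cellIndex (n := n) k) :=
  measurable_pi_lambda _ fun _ => Int.measurable_floor.comp (by fun_prop)

theorem setLIntegral_translate_le (g : (Fin n → ℝ) → ℝ≥0∞) (k L : ℕ) (m : Fin n → ℤ)
    {v : Fin n → ℝ} (hv : ∀ q, |2 ^ k * v q| ≤ L) :
    ∫⁻ x in dyadicCube k m, g (x + v) ≤
      ∑ e ∈ offsets n L, ∫⁻ x in dyadicCube k (m + e), g x := by
  set T : Set (Fin n → ℝ) := ⋃ e ∈ offsets n L, cellIndex k ⁻¹' {m + e}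
  have hsub : dyadicCube k m ⊆ (· + v) ⁻¹' T := fun x hx => by
    refine Set.mem_iUnion₂.2 ⟨cellIndex k (x + v) - m, mem_offsets.2 fun q => ?_, ?_⟩
    · rw [← cellIndex_of_mem_dyadicCube hx]
      exact abs_cellIndex_add_sub_le (hv q)
    · rw [add_sub_cancel]
      rfl
  calc ∫⁻ x in dyadicCube k m, g (x + v)
      ≤ ∫⁻ x in (· + v) ⁻¹' T, g (x + v) := lintegral_mono_set hsub
    _ = ∫⁻ x in T, g x := (measurePreserving_add_right volume v).setLIntegral_comp_preimage_emb
        (measurableEmbedding_addRight v) g T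
    _ = ∑ e ∈ offsets n L, ∫⁻ x in cellIndex k ⁻¹' {m + e}, g x :=
        lintegral_biUnion_finset
          (fun e _ e' _ hne => Disjoint.preimage _ (by simpa using hne))
          (fun e _ => measurable_cellIndex k (measurableSet_singleton _)) g
    _ = _ := Finset.sum_congr rfl fun e _ => setLIntegral_congr (cellIndex_preimage_ae_eq k (m + e))

theorem enorm_fwdDiff_iter_le (l : ℕ) (f : (Fin n → ℝ) → ℝ) (v x : Fin n → ℝ) :
    ‖(fwdDiff v)^[l] f x‖ₑ ≤ 2 ^ l * ∑ i ∈ Finset.range (l + 1), ‖f (x + i • v)‖ₑ := by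
  rw [fwdDiff_iter_eq_sum_shift, Finset.mul_sum]
  refine (enorm_sum_le _ _).trans (Finset.sum_le_sum fun i _ => ?_)
  rw [zsmul_eq_mul, enorm_mul]
  refine mul_le_mul' ?_ le_rfl
  have hchoose : ‖(((-1 : ℤ) ^ (l - i) * (l.choose i : ℤ) : ℤ) : ℝ)‖ = l.choose i := by
    push_cast
    rw [norm_mul, norm_pow, norm_neg, norm_one, one_pow, one_mul, Real.norm_natCast]
  rw [← ofReal_norm, hchoose, ENNReal.ofReal_natCast]
  exact_mod_cast Nat.choose_le_two_pow l i

theorem setLIntegral_enorm_fwdDiff_iter_rpow_le {f : (Fin n → ℝ) → ℝ} (hf : Measurable f) (l : ℕ)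
    {r : ℝ} (hr : 0 < r) (k : ℕ) (m : Fin n → ℤ) {v : Fin n → ℝ} (hv : ∀ q, |2 ^ k * v q| ≤ 1) :
    ∫⁻ x in dyadicCube k m, ‖(fwdDiff v)^[l] f x‖ₑ ^ r ≤
      (2 ^ l) ^ r * (l + 1) ^ r * (l + 1) *
        ∑ e ∈ offsets n l, ∫⁻ x in dyadicCube k (m + e), ‖f x‖ₑ ^ r := by
  have hstep : ∀ i ∈ Finset.range (l + 1), ∀ q, |2 ^ k * (i • v) q| ≤ l := fun i hi q => by
    have hil : (i : ℝ) ≤ l := by exact_mod_cast Finset.mem_range_succ_iff.1 hi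
    rw [Pi.smul_apply, nsmul_eq_mul, mul_left_comm, abs_mul, Nat.abs_cast]
    exact (mul_le_of_le_one_right i.cast_nonneg (hv q)).trans hil
  calc ∫⁻ x in dyadicCube k m, ‖(fwdDiff v)^[l] f x‖ₑ ^ r
      ≤ ∫⁻ x in dyadicCube k m, (2 ^ l) ^ r * (l + 1) ^ r *
          ∑ i ∈ Finset.range (l + 1), ‖f (x + i • v)‖ₑ ^ r := lintegral_mono fun x => by
        refine (ENNReal.rpow_le_rpow (enorm_fwdDiff_iter_le l f v x) hr.le).trans ?_
        rw [ENNReal.mul_rpow_of_nonneg _ _ hr.le, mul_assoc]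
        refine mul_le_mul' le_rfl ?_
        simpa using sum_rpow_le_card_rpow_mul_sum (Finset.range (l + 1))
          (fun i => ‖f (x + i • v)‖ₑ) hr
    _ = (2 ^ l) ^ r * (l + 1) ^ r * ∑ i ∈ Finset.range (l + 1),
          ∫⁻ x in dyadicCube k m, ‖f (x + i • v)‖ₑ ^ r := by
        rw [lintegral_const_mul _ (by fun_prop), lintegral_finsetSum _ fun i _ => by fun_prop]
    _ ≤ (2 ^ l) ^ r * (l + 1) ^ r * ∑ _i ∈ Finset.range (l + 1),
          ∑ e ∈ offsets n l, ∫⁻ x in dyadicCube k (m + e), ‖f x‖ₑ ^ r :=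
        mul_le_mul' le_rfl (Finset.sum_le_sum fun i hi =>
          setLIntegral_translate_le (fun x => ‖f x‖ₑ ^ r) k l m (hstep i hi))
    _ = _ := by
        rw [Finset.sum_const, Finset.card_range, nsmul_eq_mul, ← mul_assoc]
        push_cast
        rfl

/-- The normalized quasi-norm `2^{kn/r} ‖f | L_r(Q_{k,m})‖`. -/
noncomputable def cellMean (r : ℝ) (k : ℕ) (m : Fin n → ℤ) (f : (Fin n → ℝ) → ℝ) : ℝ≥0∞ :=
  2 ^ ((k : ℝ) * n / r) * lpNormOn f r (dyadicCube k m)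

theorem exists_dyadicDiff_le_sum_cellMean (n l : ℕ) {r : ℝ} (hr : 0 < r) : ∃ C : ℝ≥0,
    ∀ f : (Fin n → ℝ) → ℝ, Measurable f → ∀ (k : ℕ) (m : Fin n → ℤ),
      dyadicDiff l r k m f ≤ C * ∑ e ∈ offsets n l, cellMean r k (m + e) f := by
  have hr' : 0 ≤ 1 / r := by positivity
  set c : ℝ≥0∞ := (2 ^ (n : ℝ) * ((2 ^ l) ^ r * (l + 1) ^ r * (l + 1))) ^ (1 / r) *
    ((offsets n l).card : ℝ≥0∞) ^ (1 / r) with hc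
  have hctop : c ≠ ∞ := by
    have : ∀ x : ℝ≥0∞, x ≠ ∞ → ∀ y : ℝ, 0 ≤ y → x ^ y ≠ ∞ := fun x hx y hy =>
      ENNReal.rpow_ne_top_of_nonneg hy hx
    finiteness
  refine ⟨c.toNNReal, fun f hf k m => ?_⟩
  set J : ℝ≥0∞ := ∑ e ∈ offsets n l, ∫⁻ x in dyadicCube k (m + e), ‖f x‖ₑ ^ r
  have hroot : J ^ (1 / r) ≤ ((offsets n l).card : ℝ≥0∞) ^ (1 / r) *
      ∑ e ∈ offsets n l, lpNormOn f r (dyadicCube k (m + e)) := by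
    simpa only [lpNormOn_eq _ hr] using sum_rpow_le_card_rpow_mul_sum (offsets n l)
      (fun e => ∫⁻ x in dyadicCube k (m + e), ‖f x‖ₑ ^ r) (one_div_pos.2 hr)
  calc dyadicDiff l r k m f
      ≤ (2 ^ (n : ℝ) * (2 ^ ((k : ℝ) * n) *
          ((2 ^ l) ^ r * (l + 1) ^ r * (l + 1) * J))) ^ (1 / r) :=
        dyadicDiff_le_of_setLIntegral_le hr.le fun v hv =>
          setLIntegral_enorm_fwdDiff_iter_rpow_le hf l hr k m hv
    _ = (2 ^ (n : ℝ) * ((2 ^ l) ^ r * (l + 1) ^ r * (l + 1))) ^ (1 / r) *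
          (2 ^ ((k : ℝ) * n / r) * J ^ (1 / r)) := by
        rw [← mul_one_div ((k : ℝ) * n), ENNReal.rpow_mul 2 ((k : ℝ) * n),
          ← ENNReal.mul_rpow_of_nonneg _ J hr', ← ENNReal.mul_rpow_of_nonneg _ _ hr']
        congr 1
        ring
    _ ≤ _ := by
        rw [ENNReal.coe_toNNReal hctop, hc,
          mul_assoc _ (((offsets n l).card : ℝ≥0∞) ^ (1 / r))]
        simp only [cellMean, ← Finset.mul_sum]
        rw [mul_left_comm (((offsets n l).card : ℝ≥0∞) ^ (1 / r))]
        exact mul_le_mul' le_rfl (mul_le_mul' le_rfl hroot)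

end Translation

section WeightedLp

variable {ι κ : Type*}

/-- The weighted `ℓ_p` quasi-norm `(∑_i (t_i a_i)^p)^{1/p}`. -/
noncomputable def weightedLp (p : ℝ) (t a : ι → ℝ≥0∞) : ℝ≥0∞ :=
  (∑' i, t i ^ p * a i ^ p) ^ (1 / p)

theorem weightedLp_le_of_tsum_le {p : ℝ} (hp : 0 < p) {t a : ι → ℝ≥0∞} {u b : κ → ℝ≥0∞}
    {C : ℝ≥0∞} (h : ∑' i, t i ^ p * a i ^ p ≤ C ^ p * ∑' i, u i ^ p * b i ^ p) :
    weightedLp p t a ≤ C * weightedLp p u b := by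
  refine (ENNReal.rpow_le_rpow h (by positivity)).trans_eq ?_
  rw [ENNReal.mul_rpow_of_nonneg _ _ (by positivity), ← ENNReal.rpow_mul,
    mul_one_div_cancel hp.ne', ENNReal.rpow_one, weightedLp]

theorem weightedLp_le_mul {p : ℝ} (hp : 0 < p) {t a b : ι → ℝ≥0∞} {C : ℝ≥0∞}
    (h : ∀ i, a i ≤ C * b i) : weightedLp p t a ≤ C * weightedLp p t b := by
  refine weightedLp_le_of_tsum_le hp ?_
  rw [← ENNReal.tsum_mul_left]
  refine ENNReal.tsum_le_tsum fun i => ?_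
  rw [mul_left_comm, ← ENNReal.mul_rpow_of_nonneg C _ hp.le]
  exact mul_le_mul' le_rfl (ENNReal.rpow_le_rpow (h i) hp.le)

theorem weightedLp_rpow_le_add {p μ : ℝ} (hμ : 0 < μ) (hμp : μ ≤ p) {t a b c : ι → ℝ≥0∞}
    (h : ∀ i, a i ^ μ ≤ b i ^ μ + c i ^ μ) :
    weightedLp p t a ^ μ ≤ weightedLp p t b ^ μ + weightedLp p t c ^ μ := by
  let _ : MeasurableSpace ι := ⊤
  have hcount : ∀ u : ι → ℝ≥0∞,
      weightedLp p t u = (∫⁻ i, (t i * u i) ^ p ∂Measure.count) ^ (1 / p) := fun u => by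
    simp only [weightedLp, lintegral_count, ENNReal.mul_rpow_of_nonneg _ _ (hμ.le.trans hμp)]
  simp only [hcount]
  refine lintegral_rpow_root_rpow_le_add measurable_from_top.aemeasurable
    measurable_from_top.aemeasurable hμ hμp fun i => ?_
  simp only [ENNReal.mul_rpow_of_nonneg _ _ hμ.le, ← mul_add]
  exact mul_le_mul' le_rfl (h i)

theorem exists_weightedLp_sum_offsets_le (n L : ℕ) {p : ℝ} (hp : 0 < p) (K : ℝ≥0) :
    ∃ C : ℝ≥0, ∀ t a : (Fin n → ℤ) → ℝ≥0∞,
      (∀ m m' : Fin n → ℤ, (∀ i, |m i - m' i| ≤ L) → t m ^ p ≤ K * t m' ^ p) →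
      weightedLp p t (fun m => ∑ e ∈ offsets n L, a (m + e)) ≤ C * weightedLp p t a := by
  set N : ℝ≥0 := ((offsets n L).card : ℝ≥0)
  refine ⟨(N ^ p * K * N) ^ p⁻¹, fun t a ht => weightedLp_le_of_tsum_le hp ?_⟩
  rw [← ENNReal.coe_rpow_of_nonneg _ hp.le, NNReal.rpow_inv_rpow hp.ne']
  calc ∑' m, t m ^ p * (∑ e ∈ offsets n L, a (m + e)) ^ p
      ≤ ∑' m, N ^ p * K * ∑ e ∈ offsets n L, t (m + e) ^ p * a (m + e) ^ p := by
        refine ENNReal.tsum_le_tsum fun m => ?_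
        refine (mul_le_mul' le_rfl (sum_rpow_le_card_rpow_mul_sum _ _ hp)).trans ?_
        rw [mul_left_comm, mul_assoc ((N : ℝ≥0∞) ^ p)]
        refine mul_le_mul' le_rfl ?_
        rw [Finset.mul_sum, Finset.mul_sum]
        refine Finset.sum_le_sum fun e he => ?_
        rw [← mul_assoc]
        exact mul_le_mul' (ht m (m + e) fun i => by simpa using mem_offsets.1 he i) le_rfl
    _ = N ^ p * K * ∑ e ∈ offsets n L, ∑' m, t (m + e) ^ p * a (m + e) ^ p := by
        rw [ENNReal.tsum_mul_left, Summable.tsum_finsetSum fun e _ => ENNReal.summable]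
    _ = N ^ p * K * ∑ _e ∈ offsets n L, ∑' m, t m ^ p * a m ^ p := by
        congr 1
        exact Finset.sum_congr rfl fun e _ =>
          (Equiv.addRight e).tsum_eq fun m => t m ^ p * a m ^ p
    _ = _ := by
        rw [Finset.sum_const, nsmul_eq_mul, ← mul_assoc]
        push_cast [ENNReal.coe_rpow_of_nonneg _ hp.le]
        rfl

end WeightedLp

section Norms

variable {n : ℕ} {l : ℕ} {r p μ : ℝ}

/-- The left-hand side `(∑_m t_{k,m}^p [δ^l_r(Q_{k,m}) f]^p)^{1/p}` of the theorem. -/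
noncomputable def diffNorm (l : ℕ) (r p : ℝ) (t : ℕ → (Fin n → ℤ) → ℝ≥0∞) (k : ℕ)
    (f : (Fin n → ℝ) → ℝ) : ℝ≥0∞ :=
  weightedLp p (t k) fun m => dyadicDiff l r k m f

/-- The quasi-norm `(∑_m t_{k,m}^p 2^{knp/r} ‖f | L_r(Q_{k,m})‖^p)^{1/p}` in which `s^l_k` measures
the distance to the splines of generation `k`. -/
noncomputable def cellNorm (r p : ℝ) (t : ℕ → (Fin n → ℤ) → ℝ≥0∞) (k : ℕ)
    (f : (Fin n → ℝ) → ℝ) : ℝ≥0∞ :=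
  weightedLp p (t k) fun m => cellMean r k m f

theorem diffNorm_add_rpow_le {f g : (Fin n → ℝ) → ℝ} (hf : Measurable f) (hg : Measurable g)
    (hμ : 0 < μ) (hμ1 : μ ≤ 1) (hμr : μ ≤ r) (hμp : μ ≤ p) (l : ℕ)
    (t : ℕ → (Fin n → ℤ) → ℝ≥0∞) (k : ℕ) :
    diffNorm l r p t k (f + g) ^ μ ≤ diffNorm l r p t k f ^ μ + diffNorm l r p t k g ^ μ :=
  weightedLp_rpow_le_add hμ hμp fun m => dyadicDiff_add_rpow_le hf hg l hμ hμ1 hμr k m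

theorem cellNorm_add_rpow_le {f g : (Fin n → ℝ) → ℝ} (hf : Measurable f) (hg : Measurable g)
    (hμ : 0 < μ) (hμ1 : μ ≤ 1) (hμr : μ ≤ r) (hμp : μ ≤ p)
    (t : ℕ → (Fin n → ℤ) → ℝ≥0∞) (k : ℕ) :
    cellNorm r p t k (f + g) ^ μ ≤ cellNorm r p t k f ^ μ + cellNorm r p t k g ^ μ :=
  weightedLp_rpow_le_add hμ hμp fun m => by
    simp only [cellMean, ENNReal.mul_rpow_of_nonneg _ _ hμ.le, ← mul_add]
    exact mul_le_mul' le_rfl (lpNormOn_add_rpow_le hf hg hμ hμ1 hμr _)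

theorem cellNorm_sub_comm (r p : ℝ) (t : ℕ → (Fin n → ℤ) → ℝ≥0∞) (k : ℕ)
    (f g : (Fin n → ℝ) → ℝ) : cellNorm r p t k (f - g) = cellNorm r p t k (g - f) := by
  simp only [cellNorm, cellMean, lpNormOn, eLpNorm_sub_comm]

end Norms

section SplineDifferences

variable {n l : ℕ}

theorem measurable_bSpline (l : ℕ) : Measurable (bSpline l) :=
  Measurable.const_mul (Finset.measurable_sum _ fun _ _ => Measurable.const_mul
    (Measurable.ite measurableSet_Ici (by fun_prop) measurable_const) _) _

theorem measurable_splineMap (hl : 0 < l) (j : ℕ) (β : (Fin n → ℤ) → ℝ) :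
    Measurable (splineMap hl j β) := by
  have hlocal : splineMap hl j β = fun x => ∑ e ∈ offsets n l,
      β (cellIndex j x + e) * bSplineN l j (cellIndex j x + e) x := funext fun x =>
    splineMap_apply_eq_sum_offsets hl β fun q => by simp
  rw [hlocal]
  refine (measurable_from_prod_countable_right (f := fun z : (Fin n → ℤ) × (Fin n → ℝ) =>
    ∑ e ∈ offsets n l, β (z.1 + e) * bSplineN l j (z.1 + e) z.2) fun m => ?_).comp
      ((measurable_cellIndex j).prodMk measurable_id)
  change Measurable fun x => ∑ e ∈ offsets n l, β (m + e) * bSplineN l j (m + e) x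
  refine Finset.measurable_sum _ fun e _ => Measurable.const_mul ?_ _
  exact Finset.measurable_prod _ fun q _ => (measurable_bSpline l).comp (by fun_prop)

theorem cellIndex_add_nsmul_eq_of_isInner {j k : ℕ} {m m' : Fin n → ℤ} (hjk : j ≤ k)
    (hm : m ∈ subcubes j m' k) (hi : IsInner l j k m) {x v : Fin n → ℝ} (hx : x ∈ dyadicCube k m)
    (hv : ∀ q, |2 ^ k * v q| ≤ 1) {i : ℕ} (hil : i ≤ l) :
    cellIndex j (x + i • v) = m' := by
  obtain ⟨w, rfl⟩ := Nat.exists_eq_add_of_le hjk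
  funext q
  obtain ⟨hlow, hupp⟩ := hi q
  have hdiv := Int.mul_ediv_add_emod (m q) (2 ^ w)
  have hmq := (mem_subcubes_iff hjk).1 hm q
  rw [Nat.add_sub_cancel_left] at hlow hupp hmq
  rw [hmq] at hdiv
  have hlow' : (2 : ℝ) ^ w * m' q + l ≤ m q := by
    exact_mod_cast (by linarith : 2 ^ w * m' q + l ≤ m q)
  have hupp' : (m q : ℝ) + l + 1 ≤ 2 ^ w * m' q + 2 ^ w := by
    exact_mod_cast (by linarith : m q + l + 1 ≤ 2 ^ w * m' q + 2 ^ w)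
  have hxq := mem_dyadicCube.1 hx q
  have hiv : |(i : ℝ) * (2 ^ (j + w) * v q)| ≤ l := by
    rw [abs_mul, Nat.abs_cast]
    exact (mul_le_of_le_one_right i.cast_nonneg (hv q)).trans (Nat.cast_le.2 hil)
  have hscale : (2 : ℝ) ^ w * (2 ^ j * (x + i • v) q) =
      2 ^ (j + w) * x q + i * (2 ^ (j + w) * v q) := by
    rw [Pi.add_apply, Pi.smul_apply, nsmul_eq_mul, pow_add]
    ring
  have h2w : (0 : ℝ) < 2 ^ w := by positivity
  refine Int.floor_eq_iff.2 ⟨le_of_mul_le_mul_left ?_ h2w, lt_of_mul_lt_mul_left ?_ h2w.le⟩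
  · linarith [hscale, hlow', hxq.1, (abs_le.1 hiv).1]
  · linarith [hscale, hupp', hxq.2, (abs_le.1 hiv).2]

theorem exists_dyadicDiff_splineMap_le_pow (n : ℕ) (hl : 0 < l) {r : ℝ} (hr : 0 < r) :
    ∃ C : ℝ≥0, ∀ κ ≤ l, ∀ j k : ℕ, j ≤ k → ∀ (β : (Fin n → ℤ) → ℝ) (m' m : Fin n → ℤ),
      m ∈ subcubes j m' k → (κ < l ∨ IsInner l j k m) →
        dyadicDiff l r k m (splineMap hl j β) ≤
          2 ^ (((j : ℝ) - k) * κ) * (C * ∑ e ∈ offsets n (2 * l), ‖β (m' + e)‖ₑ) := by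
  obtain ⟨B, hB, hbound⟩ := exists_abs_fwdDiff_splineMap_le n hl
  refine ⟨(2 : ℝ≥0) ^ ((n : ℝ) / r) * B.toNNReal, fun κ hκ j k hjk β m' m hm hcell => ?_⟩
  set θ : ℝ := 2 ^ j / 2 ^ k with hθ
  have hθ0 : 0 ≤ θ := by positivity
  have hθ1 : θ ≤ 1 := div_le_one_of_le₀ (pow_le_pow_right₀ one_le_two hjk) (by positivity)
  set A : ℝ≥0∞ := ENNReal.ofReal B * ∑ e ∈ offsets n (2 * l), ‖β (m' + e)‖ₑ with hA
  have hdiff : dyadicDiff l r k m (splineMap hl j β) ≤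
      2 ^ ((n : ℝ) / r) * (2 ^ (((j : ℝ) - k) * κ) * A) := by
    refine dyadicDiff_le_of_enorm_le hr fun v hv x hx => ?_
    have hvθ : ∀ q, |2 ^ j * v q| ≤ θ := fun q => by
      rw [show 2 ^ j * v q = θ * (2 ^ k * v q) by rw [hθ]; field_simp, abs_mul, abs_of_nonneg hθ0]
      exact mul_le_of_le_one_right hθ0 (hv q)
    have hxm' : cellIndex j x = m' := cellIndex_of_mem_dyadicCube (hm hx)
    have hle := hbound κ hκ j β x v θ hθ0 hθ1 hvθ <| hcell.imp_right fun hi i hil =>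
      (cellIndex_add_nsmul_eq_of_isInner hjk hm hi hx hv hil).trans hxm'.symm
    rw [hxm'] at hle
    rw [Real.enorm_eq_ofReal_abs, hA]
    simp only [Real.enorm_eq_ofReal_abs]
    refine (ENNReal.ofReal_le_ofReal hle).trans_eq ?_
    rw [ENNReal.ofReal_mul (by positivity), ENNReal.ofReal_mul hB, ENNReal.ofReal_pow hθ0,
      hθ, ofReal_two_pow_div, ← ENNReal.rpow_natCast, ← ENNReal.rpow_mul,
      ENNReal.ofReal_sum_of_nonneg fun _ _ => abs_nonneg _]
    ring
  refine hdiff.trans_eq ?_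
  rw [ENNReal.coe_mul, ENNReal.coe_rpow_of_nonneg _ (by positivity), hA, ENNReal.ofReal,
    ENNReal.coe_ofNat]
  ring

theorem exists_dyadicDiff_splineMap_le (n : ℕ) (hl : 0 < l) {r : ℝ} (hr : 0 < r) : ∃ C : ℝ≥0,
    ∀ j k : ℕ, j ≤ k → ∀ (β : (Fin n → ℤ) → ℝ) (m' m : Fin n → ℤ), m ∈ subcubes j m' k →
      dyadicDiff l r k m (splineMap hl j β) ≤
        layerRate l j k m * (C * ∑ e ∈ offsets n (2 * l), ‖β (m' + e)‖ₑ) := by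
  obtain ⟨C, hC⟩ := exists_dyadicDiff_splineMap_le_pow n hl hr
  refine ⟨C, fun j k hjk β m' m hm => ?_⟩
  by_cases hi : IsInner l j k m
  · rw [layerRate, if_pos hi]
    exact hC l le_rfl j k hjk β m' m hm (Or.inr hi)
  · rw [layerRate, if_neg hi, ← Nat.cast_one (R := ℝ), ← Nat.cast_sub hl]
    exact hC (l - 1) (Nat.sub_le _ _) j k hjk β m' m hm (Or.inl (Nat.sub_lt hl one_pos))

end SplineDifferences

section Weighted

variable {n d : ℕ} {γ : (Fin n ⊕ Fin d → ℝ) → ℝ} {p : ℝ}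

theorem exists_diffNorm_le_cellNorm (hd : 0 < d) (hp : 0 < p) (hγ : 0 ≤ γ)
    (hγp : ALocInfty fun z => γ z ^ p) (α₂ α₃ C₁ : ℝ) (l : ℕ) {r : ℝ} (hr : 0 < r) :
    ∃ C : ℝ≥0, ∀ s : ℕ → (Fin n → ℝ) → ℝ, LocYUpper α₂ α₃ C₁ s →
      ∀ (k : ℕ) (f : (Fin n → ℝ) → ℝ), Measurable f →
        diffNorm l r p (tSeq s γ p) k f ≤ C * cellNorm r p (tSeq s γ p) k f := by
  obtain ⟨K, hK⟩ := exists_tSeq_neighbour_le (n := n) hd hp hγ hγp α₂ α₃ C₁ l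
  obtain ⟨D, hD⟩ := exists_dyadicDiff_le_sum_cellMean n l hr
  obtain ⟨E, hE⟩ := exists_weightedLp_sum_offsets_le n l hp K
  refine ⟨D * E, fun s hs k f hf => ?_⟩
  set t := tSeq s γ p k
  calc weightedLp p t (fun m => dyadicDiff l r k m f)
      ≤ D * weightedLp p t fun m => ∑ e ∈ offsets n l, cellMean r k (m + e) f :=
        weightedLp_le_mul hp (hD f hf k)
    _ ≤ D * (E * weightedLp p t fun m => cellMean r k m f) :=
        mul_le_mul' le_rfl (hE t (fun m => cellMean r k m f) (hK s hs k))
    _ = _ := by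
        rw [ENNReal.coe_mul, mul_assoc]
        rfl

theorem exists_weightedLp_le_of_le_layerRate (hd : 0 < d) (hp : 0 < p) (hγ : 0 ≤ γ)
    (hγp : ALocInfty fun z => γ z ^ p) (α₂ α₃ C₁ : ℝ) (l : ℕ) {ε : ℝ} (hε : 0 < ε) :
    ∃ C : ℝ≥0, ∀ s : ℕ → (Fin n → ℝ) → ℝ, LocYUpper α₂ α₃ C₁ s → ∀ j k : ℕ, j ≤ k →
      ∀ a b : (Fin n → ℤ) → ℝ≥0∞,
        (∀ m' m, m ∈ subcubes j m' k → a m ≤ layerRate l j k m * b m') →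
        weightedLp p (tSeq s γ p k) a ≤
          C * 2 ^ (((j : ℝ) - k) * rate l p α₂ ε γ) * weightedLp p (tSeq s γ p j) b := by
  obtain ⟨F, hF⟩ := exists_tsum_layerRate_tSeq_le (n := n) hd hp hγ hγp α₂ α₃ C₁ l hε
  refine ⟨F ^ p⁻¹, fun s hs j k hjk a b hab => weightedLp_le_of_tsum_le hp ?_⟩
  rw [← tsum_subcubes hjk, ← ENNReal.tsum_mul_left, ENNReal.mul_rpow_of_nonneg _ _ hp.le,
    ← ENNReal.coe_rpow_of_nonneg _ hp.le, NNReal.rpow_inv_rpow hp.ne', ← ENNReal.rpow_mul]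
  refine ENNReal.tsum_le_tsum fun m' => ?_
  calc ∑' m : subcubes j m' k, tSeq s γ p k m ^ p * a m ^ p
      ≤ ∑' m : subcubes j m' k, (layerRate l j k m.1 ^ p * tSeq s γ p k m ^ p) * b m' ^ p := by
        refine ENNReal.tsum_le_tsum fun m => ?_
        rw [mul_comm (layerRate l j k m.1 ^ p), mul_assoc,
          ← ENNReal.mul_rpow_of_nonneg (layerRate l j k m.1) _ hp.le]
        exact mul_le_mul' le_rfl (ENNReal.rpow_le_rpow (hab m' m m.2) hp.le)
    _ ≤ _ := by
        rw [ENNReal.tsum_mul_right, ← mul_assoc]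
        exact mul_le_mul' (hF s hs j k hjk m') le_rfl

theorem exists_diffNorm_spline_le (hd : 0 < d) (hp : 0 < p) (hγ : 0 ≤ γ)
    (hγp : ALocInfty fun z => γ z ^ p) (α₂ α₃ C₁ : ℝ) {l : ℕ} (hl : 0 < l) {r : ℝ} (hr : 0 < r)
    {ε : ℝ} (hε : 0 < ε) :
    ∃ C : ℝ≥0, ∀ s : ℕ → (Fin n → ℝ) → ℝ, LocYUpper α₂ α₃ C₁ s → ∀ j k : ℕ, j ≤ k →
      ∀ U ∈ LinearMap.range (splineMap hl j), diffNorm l r p (tSeq s γ p) k U ≤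
        C * 2 ^ (((j : ℝ) - k) * rate l p α₂ ε γ) * cellNorm r p (tSeq s γ p) j U := by
  obtain ⟨K, hK⟩ := exists_tSeq_neighbour_le (n := n) hd hp hγ hγp α₂ α₃ C₁ (2 * l)
  obtain ⟨D, hD⟩ := exists_dyadicDiff_splineMap_le n hl hr
  obtain ⟨E, hE⟩ := exists_weightedLp_sum_offsets_le n (2 * l) hp K
  obtain ⟨F, hF⟩ := exists_weightedLp_le_of_le_layerRate (n := n) hd hp hγ hγp α₂ α₃ C₁ l hε
  obtain ⟨G, hG⟩ := exists_enorm_coeff_le n hl hr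
  refine ⟨F * (D * (E * G)), ?_⟩
  rintro s hs j k hjk _ ⟨β, rfl⟩
  set ρ : ℝ≥0∞ := 2 ^ (((j : ℝ) - k) * rate l p α₂ ε γ)
  calc diffNorm l r p (tSeq s γ p) k (splineMap hl j β)
      ≤ F * ρ * weightedLp p (tSeq s γ p j)
          fun m' => D * ∑ e ∈ offsets n (2 * l), ‖β (m' + e)‖ₑ :=
        hF s hs j k hjk _ _ fun m' m hm => hD j k hjk β m' m hm
    _ ≤ F * ρ * (D * weightedLp p (tSeq s γ p j)
          fun m' => ∑ e ∈ offsets n (2 * l), ‖β (m' + e)‖ₑ) :=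
        mul_le_mul' le_rfl (weightedLp_le_mul hp fun _ => le_rfl)
    _ ≤ F * ρ * (D * (E * weightedLp p (tSeq s γ p j) fun m => ‖β m‖ₑ)) :=
        mul_le_mul' le_rfl (mul_le_mul' le_rfl (hE _ (fun m => ‖β m‖ₑ) (hK s hs j)))
    _ ≤ F * ρ * (D * (E * (G * cellNorm r p (tSeq s γ p) j (splineMap hl j β)))) :=
        mul_le_mul' le_rfl (mul_le_mul' le_rfl (mul_le_mul' le_rfl
          (weightedLp_le_mul hp (hG j β))))
    _ = _ := by
        push_cast
        ring

theorem encard_subcubes_succ_le (j : ℕ) (m' : Fin n → ℤ) :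
    (subcubes j m' (j + 1)).encard ≤ (offsets n 1).card := by
  have hsub : subcubes j m' (j + 1) ⊆
      (fun e q => 2 * m' q + e q) '' (offsets n 1 : Set (Fin n → ℤ)) := by
    intro m hm
    refine ⟨fun q => m q - 2 * m' q, mem_offsets.2 fun q => ?_, by simp⟩
    have hq : m q / 2 ^ (j + 1 - j) = m' q := (mem_subcubes_iff j.le_succ).1 hm q
    rw [Nat.add_sub_cancel_left, pow_one] at hq
    rw [abs_le]
    omega
  refine (Set.encard_le_encard hsub).trans ((Set.encard_image_le _ _).trans_eq ?_)
  exact Set.encard_coe_eq_coe_finsetCard _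

theorem cellMean_child_le (r : ℝ) {j : ℕ} {m m' : Fin n → ℤ} (hm : m ∈ subcubes j m' (j + 1))
    (f : (Fin n → ℝ) → ℝ) : cellMean r (j + 1) m f ≤ 2 ^ ((n : ℝ) / r) * cellMean r j m' f := by
  rw [cellMean, cellMean, ← mul_assoc, ← two_rpow_add]
  refine mul_le_mul' (le_of_eq ?_) (eLpNorm_mono_measure _ (Measure.restrict_mono_set _ hm))
  congr 1
  push_cast
  ring

theorem exists_cellNorm_succ_le (hd : 0 < d) (hp : 0 < p) (hγ : 0 ≤ γ)
    (hγp : ALocInfty fun z => γ z ^ p) (α₂ α₃ C₁ r : ℝ) :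
    ∃ C : ℝ≥0, ∀ s : ℕ → (Fin n → ℝ) → ℝ, LocYUpper α₂ α₃ C₁ s →
      ∀ (j : ℕ) (f : (Fin n → ℝ) → ℝ),
        cellNorm r p (tSeq s γ p) (j + 1) f ≤ C * cellNorm r p (tSeq s γ p) j f := by
  obtain ⟨K, hK⟩ := exists_tSeq_child_le (n := n) hd hp hγ hγp α₂ α₃ C₁
  set N : ℝ≥0 := ((offsets n 1).card : ℝ≥0) with hN
  refine ⟨(N * (K * ((2 : ℝ≥0) ^ ((n : ℝ) / r)) ^ p)) ^ p⁻¹,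
    fun s hs j f => weightedLp_le_of_tsum_le hp ?_⟩
  rw [← tsum_subcubes j.le_succ, ← ENNReal.tsum_mul_left, ← ENNReal.coe_rpow_of_nonneg _ hp.le,
    NNReal.rpow_inv_rpow hp.ne']
  refine ENNReal.tsum_le_tsum fun m' => ?_
  set X : ℝ≥0∞ := tSeq s γ p j m' ^ p * cellMean r j m' f ^ p
  calc ∑' m : subcubes j m' (j + 1), tSeq s γ p (j + 1) m ^ p * cellMean r (j + 1) m f ^ p
      ≤ ∑' _m : subcubes j m' (j + 1), K * (2 ^ ((n : ℝ) / r)) ^ p * X := by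
        refine ENNReal.tsum_le_tsum fun m => ?_
        refine (mul_le_mul' (hK s hs j m m' m.2)
          (ENNReal.rpow_le_rpow (cellMean_child_le r m.2 f) hp.le)).trans_eq ?_
        rw [ENNReal.mul_rpow_of_nonneg _ _ hp.le]
        ring
    _ ≤ N * (K * (2 ^ ((n : ℝ) / r)) ^ p * X) := by
        rw [ENNReal.tsum_const]
        refine mul_le_mul' ?_ le_rfl
        simpa [hN] using ENat.toENNReal_le.2 (encard_subcubes_succ_le j m')
    _ = _ := by
        push_cast [ENNReal.coe_rpow_of_nonneg _ hp.le, ENNReal.coe_rpow_of_ne_zero two_ne_zero]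
        ring

end Weighted

section Telescoping

variable {n l : ℕ} {r p μ : ℝ} {t : ℕ → (Fin n → ℤ) → ℝ≥0∞}

theorem diffNorm_rpow_le_telescope {S : ℕ → (Fin n → ℝ) → ℝ} (hS : ∀ j, Measurable (S j))
    (hμ : 0 < μ) (hμ1 : μ ≤ 1) (hμr : μ ≤ r) (hμp : μ ≤ p) (k i : ℕ) :
    diffNorm l r p t k (S i) ^ μ ≤ diffNorm l r p t k (S 0) ^ μ +
      ∑ j ∈ Finset.range i, diffNorm l r p t k (S (j + 1) - S j) ^ μ := by
  induction i with
  | zero => simp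
  | succ i ih =>
    have hadd := diffNorm_add_rpow_le (hS i) ((hS (i + 1)).sub (hS i)) hμ hμ1 hμr hμp l t k
    rw [add_sub_cancel] at hadd
    rw [Finset.sum_range_succ, ← add_assoc]
    exact hadd.trans (add_le_add ih le_rfl)

theorem cellNorm_rpow_le_sub_add {f g : (Fin n → ℝ) → ℝ} (hf : Measurable f) (hg : Measurable g)
    (hμ : 0 < μ) (hμ1 : μ ≤ 1) (hμr : μ ≤ r) (hμp : μ ≤ p) (k : ℕ) :
    cellNorm r p t k g ^ μ ≤ cellNorm r p t k (f - g) ^ μ + cellNorm r p t k f ^ μ := by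
  have hadd := cellNorm_add_rpow_le (hg.sub hf) hf hμ hμ1 hμr hμp t k
  rwa [sub_add_cancel, cellNorm_sub_comm] at hadd

theorem add_sum_le_of_step {x w : ℕ → ℝ≥0∞} {x₀ v M : ℝ≥0∞} (h₀ : x₀ ≤ w 0 + M * v)
    (hsucc : ∀ j, x j ≤ w (j + 1) + M * w j) (k : ℕ) :
    x₀ + ∑ j ∈ Finset.range k, x j ≤ (1 + M) * (v + ∑ j ∈ Finset.range (k + 1), w j) := by
  calc x₀ + ∑ j ∈ Finset.range k, x j
      ≤ w 0 + M * v + ∑ j ∈ Finset.range k, (w (j + 1) + M * w j) :=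
        add_le_add h₀ (Finset.sum_le_sum fun j _ => hsucc j)
    _ = ∑ j ∈ Finset.range (k + 1), w j + M * (v + ∑ j ∈ Finset.range k, w j) := by
        rw [Finset.sum_add_distrib, Finset.sum_range_succ', ← Finset.mul_sum]
        ring
    _ ≤ _ := by
        rw [add_mul, one_mul]
        refine add_le_add le_add_self (mul_le_mul' le_rfl (add_le_add le_rfl ?_))
        rw [Finset.sum_range_succ]
        exact le_self_add

theorem cellNorm_zero_add_sum_rpow_le {E : ℝ≥0}
    (hE : ∀ j f, cellNorm r p t (j + 1) f ≤ E * cellNorm r p t j f)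
    {f : (Fin n → ℝ) → ℝ} (hf : Measurable f) {S : ℕ → (Fin n → ℝ) → ℝ}
    (hS : ∀ j, Measurable (S j)) (hμ : 0 < μ) (hμ1 : μ ≤ 1) (hμr : μ ≤ r) (hμp : μ ≤ p)
    (ρ : ℝ) (k : ℕ) :
    cellNorm r p t 0 (S 0) ^ μ + ∑ j ∈ Finset.range k,
        2 ^ (((j + 1 : ℕ) : ℝ) * μ * ρ) * cellNorm r p t (j + 1) (S (j + 1) - S j) ^ μ ≤
      (1 + (1 + E ^ μ) * 2 ^ (μ * ρ)) * (2 ^ (-1 * μ * ρ) * cellNorm r p t 0 f ^ μ +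
        ∑ j ∈ Finset.range (k + 1), 2 ^ ((j : ℝ) * μ * ρ) * cellNorm r p t j (f - S j) ^ μ) := by
  refine add_sum_le_of_step (w := fun j => 2 ^ ((j : ℝ) * μ * ρ) * cellNorm r p t j (f - S j) ^ μ)
    ?_ (fun j => ?_) k
  · refine (cellNorm_rpow_le_sub_add hf (hS 0) hμ hμ1 hμr hμp 0).trans ?_
    have hcancel : (2 : ℝ≥0∞) ^ (μ * ρ) * 2 ^ (-1 * μ * ρ) = 1 := by
      rw [← two_rpow_add, show μ * ρ + -1 * μ * ρ = 0 by ring, ENNReal.rpow_zero]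
    rw [Nat.cast_zero, zero_mul, zero_mul, ENNReal.rpow_zero, one_mul, ← mul_assoc,
      mul_assoc (1 + _), hcancel, mul_one]
    exact add_le_add le_rfl (le_mul_of_one_le_left zero_le le_self_add)
  · have hstep : cellNorm r p t (j + 1) (S (j + 1) - S j) ^ μ ≤
        cellNorm r p t (j + 1) (f - S (j + 1)) ^ μ + E ^ μ * cellNorm r p t j (f - S j) ^ μ := by
      have hsub := cellNorm_rpow_le_sub_add (t := t) (hf.sub (hS j)) ((hS (j + 1)).sub (hS j))
        hμ hμ1 hμr hμp (j + 1)
      rw [sub_sub_sub_cancel_right] at hsub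
      refine hsub.trans (add_le_add le_rfl ?_)
      rw [← ENNReal.mul_rpow_of_nonneg _ _ hμ.le]
      exact ENNReal.rpow_le_rpow (hE j _) hμ.le
    refine (mul_le_mul' le_rfl hstep).trans ((mul_add _ _ _).le.trans (add_le_add le_rfl ?_))
    rw [show ((j + 1 : ℕ) : ℝ) * μ * ρ = μ * ρ + j * μ * ρ by push_cast; ring, two_rpow_add]
    calc 2 ^ (μ * ρ) * 2 ^ (j * μ * ρ) * (E ^ μ * cellNorm r p t j (f - S j) ^ μ)
        = E ^ μ * 2 ^ (μ * ρ) * (2 ^ (j * μ * ρ) * cellNorm r p t j (f - S j) ^ μ) := by ring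
      _ ≤ _ := mul_le_mul' (mul_le_mul' le_add_self le_rfl) le_rfl

/-- The constants of the three estimates behind the telescoping argument, for the weight sequence
`t`: the differences of order `l` of any function, and those of a spline of a coarser generation,
are controlled by its cell norms, and these grow by at most a factor from one generation to the
next. -/
structure TelescopeBounds (hl : 0 < l) (r p : ℝ) (t : ℕ → (Fin n → ℤ) → ℝ≥0∞) (ρ : ℝ)
    (A B E : ℝ≥0) : Prop where
  diffNorm_le : ∀ k f, Measurable f → diffNorm l r p t k f ≤ A * cellNorm r p t k f
  diffNorm_spline_le : ∀ j k, j ≤ k → ∀ U ∈ LinearMap.range (splineMap hl j),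
    diffNorm l r p t k U ≤ B * 2 ^ (((j : ℝ) - k) * ρ) * cellNorm r p t j U
  cellNorm_succ_le : ∀ j f, cellNorm r p t (j + 1) f ≤ E * cellNorm r p t j f

namespace TelescopeBounds

variable {hl : 0 < l} {ρ : ℝ} {A B E : ℝ≥0}

theorem diffNorm_spline_rpow_le (h : TelescopeBounds hl r p t ρ A B E) (hμ : 0 < μ) {j k : ℕ}
    (hjk : j ≤ k) {U : (Fin n → ℝ) → ℝ} (hU : U ∈ LinearMap.range (splineMap hl j)) :
    diffNorm l r p t k U ^ μ ≤ B ^ μ * 2 ^ (-(k : ℝ) * μ * ρ) *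
      (2 ^ ((j : ℝ) * μ * ρ) * cellNorm r p t j U ^ μ) := by
  refine (ENNReal.rpow_le_rpow (h.diffNorm_spline_le j k hjk U hU) hμ.le).trans_eq ?_
  rw [ENNReal.mul_rpow_of_nonneg _ _ hμ.le, ENNReal.mul_rpow_of_nonneg _ _ hμ.le,
    ← ENNReal.rpow_mul,
    show ((j : ℝ) - k) * ρ * μ = -(k : ℝ) * μ * ρ + (j : ℝ) * μ * ρ by ring, two_rpow_add]
  ring

theorem diffNorm_last_rpow_le (h : TelescopeBounds hl r p t ρ A B E) {f : (Fin n → ℝ) → ℝ}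
    (hf : Measurable f) {S : ℕ → (Fin n → ℝ) → ℝ}
    (hS : ∀ j, S j ∈ LinearMap.range (splineMap hl j)) (hSm : ∀ j, Measurable (S j))
    (hμ : 0 < μ) (hμ1 : μ ≤ 1) (hμr : μ ≤ r) (hμp : μ ≤ p) (k : ℕ) :
    diffNorm l r p t k (S k) ^ μ ≤ B ^ μ * 2 ^ (-(k : ℝ) * μ * ρ) *
      ((1 + (1 + E ^ μ) * 2 ^ (μ * ρ)) * (2 ^ (-1 * μ * ρ) * cellNorm r p t 0 f ^ μ +
        ∑ j ∈ Finset.range (k + 1), 2 ^ ((j : ℝ) * μ * ρ) * cellNorm r p t j (f - S j) ^ μ)) := by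
  have hfirst := h.diffNorm_spline_rpow_le hμ k.zero_le (hS 0)
  rw [Nat.cast_zero, zero_mul, zero_mul, ENNReal.rpow_zero, one_mul] at hfirst
  have hincr : ∀ j < k, diffNorm l r p t k (S (j + 1) - S j) ^ μ ≤
      B ^ μ * 2 ^ (-(k : ℝ) * μ * ρ) * (2 ^ (((j + 1 : ℕ) : ℝ) * μ * ρ) *
        cellNorm r p t (j + 1) (S (j + 1) - S j) ^ μ) := fun j hjk =>
    h.diffNorm_spline_rpow_le hμ hjk
      (sub_mem (hS (j + 1)) (range_splineMap_mono hl j.le_succ (hS j)))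
  refine (diffNorm_rpow_le_telescope hSm hμ hμ1 hμr hμp k k).trans
    ((add_le_add hfirst (Finset.sum_le_sum fun j hj => hincr j (Finset.mem_range.1 hj))).trans ?_)
  rw [← Finset.mul_sum, ← mul_add]
  exact mul_le_mul' le_rfl
    (cellNorm_zero_add_sum_rpow_le h.cellNorm_succ_le hf hSm hμ hμ1 hμr hμp ρ k)

theorem diffNorm_rpow_le_sum_cellNorm (h : TelescopeBounds hl r p t ρ A B E)
    {f : (Fin n → ℝ) → ℝ} (hf : Measurable f) {S : ℕ → (Fin n → ℝ) → ℝ}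
    (hS : ∀ j, S j ∈ LinearMap.range (splineMap hl j))
    (hμ : 0 < μ) (hμ1 : μ ≤ 1) (hμr : μ ≤ r) (hμp : μ ≤ p) (k : ℕ) :
    diffNorm l r p t k f ^ μ ≤
      (A ^ μ + B ^ μ * (1 + (1 + E ^ μ) * 2 ^ (μ * ρ))) * 2 ^ (-(k : ℝ) * μ * ρ) *
        (2 ^ (-1 * μ * ρ) * cellNorm r p t 0 f ^ μ +
          ∑ j ∈ Finset.range (k + 1), 2 ^ ((j : ℝ) * μ * ρ) * cellNorm r p t j (f - S j) ^ μ) := by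
  set W := 2 ^ (-1 * μ * ρ) * cellNorm r p t 0 f ^ μ +
    ∑ j ∈ Finset.range (k + 1), 2 ^ ((j : ℝ) * μ * ρ) * cellNorm r p t j (f - S j) ^ μ
  have hSm : ∀ j, Measurable (S j) := fun j => by
    obtain ⟨β, hβ⟩ := hS j
    exact hβ ▸ measurable_splineMap hl j β
  have hlast : cellNorm r p t k (f - S k) ^ μ ≤ 2 ^ (-(k : ℝ) * μ * ρ) * W := by
    have hterm : 2 ^ ((k : ℝ) * μ * ρ) * cellNorm r p t k (f - S k) ^ μ ≤ W :=
      (Finset.single_le_sum_of_canonicallyOrdered (Finset.self_mem_range_succ k)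
        (f := fun j : ℕ => 2 ^ ((j : ℝ) * μ * ρ) * cellNorm r p t j (f - S j) ^ μ)).trans
          le_add_self
    refine le_trans (le_of_eq ?_) (mul_le_mul' le_rfl hterm)
    rw [← mul_assoc, ← two_rpow_add, show -(k : ℝ) * μ * ρ + k * μ * ρ = 0 by ring,
      ENNReal.rpow_zero, one_mul]
  calc diffNorm l r p t k f ^ μ
      ≤ diffNorm l r p t k (f - S k) ^ μ + diffNorm l r p t k (S k) ^ μ := by
        simpa only [sub_add_cancel] using
          diffNorm_add_rpow_le (hf.sub (hSm k)) (hSm k) hμ hμ1 hμr hμp l t k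
    _ ≤ A ^ μ * (2 ^ (-(k : ℝ) * μ * ρ) * W) + B ^ μ * 2 ^ (-(k : ℝ) * μ * ρ) *
          ((1 + (1 + E ^ μ) * 2 ^ (μ * ρ)) * W) := by
        refine add_le_add ?_ (h.diffNorm_last_rpow_le hf hS hSm hμ hμ1 hμr hμp k)
        refine (ENNReal.rpow_le_rpow (h.diffNorm_le k _ (hf.sub (hSm k))) hμ.le).trans ?_
        rw [ENNReal.mul_rpow_of_nonneg _ _ hμ.le]
        exact mul_le_mul' le_rfl hlast
    _ = _ := by ring

end TelescopeBounds

end Telescoping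

section BestApproximation

theorem le_apply_iInf {ι α β : Type*} {κ : ι → Type*} [∀ i, Nonempty (κ i)]
    [CompleteLinearOrder α] [TopologicalSpace α] [OrderTopology α]
    [Preorder β] [TopologicalSpace β] [OrderClosedTopology β]
    {F : (ι → α) → β} (hF : Continuous F) {f : ∀ i, κ i → α} {b : β}
    (h : ∀ a : ∀ i, κ i, b ≤ F fun i => f i (a i)) : b ≤ F fun i => ⨅ a, f i a := by
  have hmem : (fun i => ⨅ a, f i a) ∈ closure (Set.univ.pi fun i => Set.range (f i)) := by
    rw [closure_pi_set]
    exact fun i _ => csInf_mem_closure (Set.range_nonempty _) (OrderBot.bddBelow _)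
  refine closure_minimal (fun x hx => ?_) (isClosed_le continuous_const hF) hmem
  choose a ha using fun i => hx i (Set.mem_univ i)
  exact (h a).trans_eq (congrArg F (funext ha))

variable {n l : ℕ} {r p : ℝ} {t : ℕ → (Fin n → ℤ) → ℝ≥0∞}

theorem splineError_eq_iInf (hl : 0 < l) (f : (Fin n → ℝ) → ℝ) (k : ℕ) :
    splineError l r p t f k =
      ⨅ S : LinearMap.range (splineMap (n := n) hl k), cellNorm r p t k (f - S) := by
  rw [splineError, splineSpace_eq_range hl]
  exact iInf_subtype'

theorem splineErrorInit_eq_cellNorm (f : (Fin n → ℝ) → ℝ) :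
    splineErrorInit r p t f = cellNorm r p t 0 f := by
  simp [splineErrorInit, cellNorm, weightedLp, cellMean]

theorem splineErrorInit_congr {f g : (Fin n → ℝ) → ℝ} (h : f =ᵐ[volume] g) :
    splineErrorInit r p t f = splineErrorInit r p t g := by
  simp only [splineErrorInit, lpNormOn, eLpNorm_congr_ae (ae_restrict_of_ae h)]

theorem splineError_congr {f g : (Fin n → ℝ) → ℝ} (h : f =ᵐ[volume] g) (k : ℕ) :
    splineError l r p t f k = splineError l r p t g k := by
  have hnorm : ∀ (S : (Fin n → ℝ) → ℝ) (E : Set (Fin n → ℝ)),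
      lpNormOn (f - S) r E = lpNormOn (g - S) r E := fun S _ =>
    eLpNorm_congr_ae (ae_restrict_of_ae (h.sub (ae_eq_refl S)))
  simp only [splineError, hnorm]

theorem diffNorm_congr {f g : (Fin n → ℝ) → ℝ} (h : f =ᵐ[volume] g) (k : ℕ) :
    diffNorm l r p t k f = diffNorm l r p t k g := by
  simp only [diffNorm, dyadicDiff_congr h]

/-- The right-hand side `(∑_{j=-1}^k 2^{jμρ} (s^l_j(f))^μ)^{1/μ}` of the theorem. -/
noncomputable def approxSum (l : ℕ) (r p : ℝ) (t : ℕ → (Fin n → ℤ) → ℝ≥0∞) (ρ μ : ℝ)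
    (f : (Fin n → ℝ) → ℝ) (k : ℕ) : ℝ≥0∞ :=
  (2 ^ (-1 * μ * ρ) * splineErrorInit r p t f ^ μ +
    ∑ j ∈ Finset.range (k + 1), 2 ^ ((j : ℝ) * μ * ρ) * splineError l r p t f j ^ μ) ^ (1 / μ)

theorem approxSum_congr {f g : (Fin n → ℝ) → ℝ} (h : f =ᵐ[volume] g) (ρ μ : ℝ) (k : ℕ) :
    approxSum l r p t ρ μ f k = approxSum l r p t ρ μ g k := by
  simp only [approxSum, splineErrorInit_congr h, splineError_congr h]

theorem sum_rpow_root_anti {ι : Type*} (s : Finset ι) (a : ι → ℝ≥0∞) {μ ν : ℝ} (hμ : 0 < μ)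
    (hμν : μ ≤ ν) : (∑ i ∈ s, a i ^ ν) ^ (1 / ν) ≤ (∑ i ∈ s, a i ^ μ) ^ (1 / μ) := by
  have hν : 0 < ν := hμ.trans_le hμν
  have hsub : (∑ i ∈ s, a i ^ ν) ^ (μ / ν) ≤ ∑ i ∈ s, (a i ^ ν) ^ (μ / ν) :=
    Finset.le_sum_of_subadditive (· ^ (μ / ν)) (ENNReal.zero_rpow_of_pos (by positivity)).le
      (fun x y => ENNReal.rpow_add_le_add_rpow x y (by positivity) ((div_le_one hν).2 hμν)) s _
  simp only [← ENNReal.rpow_mul, mul_div_cancel₀ μ hν.ne'] at hsub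
  refine le_trans (le_of_eq ?_) (ENNReal.rpow_le_rpow hsub (by positivity : 0 ≤ 1 / μ))
  rw [← ENNReal.rpow_mul]
  congr 1
  field_simp

theorem approxSum_anti (ρ : ℝ) {μ ν : ℝ} (hμ : 0 < μ) (hμν : μ ≤ ν) (f : (Fin n → ℝ) → ℝ)
    (k : ℕ) : approxSum l r p t ρ ν f k ≤ approxSum l r p t ρ μ f k := by
  let a : Option ℕ → ℝ≥0∞ := fun j => j.elim (2 ^ (-1 * ρ) * splineErrorInit r p t f)
    fun j => 2 ^ ((j : ℝ) * ρ) * splineError l r p t f j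
  have hsum : ∀ η : ℝ, 0 < η → approxSum l r p t ρ η f k =
      (∑ j ∈ (Finset.range (k + 1)).insertNone, a j ^ η) ^ (1 / η) := fun η hη => by
    simp only [approxSum, a, Finset.sum_insertNone, Option.elim_none, Option.elim_some,
      ENNReal.mul_rpow_of_nonneg _ _ hη.le, ← ENNReal.rpow_mul, mul_right_comm _ ρ η]
  rw [hsum μ hμ, hsum ν (hμ.trans_le hμν)]
  exact sum_rpow_root_anti _ _ hμ hμν

theorem TelescopeBounds.exists_diffNorm_le_approxSum (hl : 0 < l) {μ : ℝ} (hμ : 0 < μ)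
    (hμ1 : μ ≤ 1) (hμr : μ ≤ r) (hμp : μ ≤ p) (ρ : ℝ) (A B E : ℝ≥0) :
    ∃ C : ℝ≥0, ∀ t : ℕ → (Fin n → ℤ) → ℝ≥0∞, TelescopeBounds hl r p t ρ A B E →
      ∀ f : (Fin n → ℝ) → ℝ, Measurable f → ∀ k : ℕ,
        diffNorm l r p t k f ≤ C * 2 ^ (-(k : ℝ) * ρ) * approxSum l r p t ρ μ f k := by
  set K : ℝ≥0∞ := A ^ μ + B ^ μ * (1 + (1 + E ^ μ) * 2 ^ (μ * ρ))
  have hK : K ≠ ∞ := by finiteness [two_rpow_ne_top (μ * ρ)]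
  refine ⟨(K ^ (1 / μ)).toNNReal, fun t h f hf k => ?_⟩
  rw [ENNReal.coe_toNNReal (ENNReal.rpow_ne_top_of_nonneg (by positivity) hK)]
  have hpow : diffNorm l r p t k f ^ μ ≤ K * 2 ^ (-(k : ℝ) * μ * ρ) *
      (2 ^ (-1 * μ * ρ) * splineErrorInit r p t f ^ μ +
        ∑ j ∈ Finset.range (k + 1), 2 ^ ((j : ℝ) * μ * ρ) * splineError l r p t f j ^ μ) := by
    simp only [splineError_eq_iInf hl, splineErrorInit_eq_cellNorm]
    refine le_apply_iInf (F := fun x : ℕ → ℝ≥0∞ => K * 2 ^ (-(k : ℝ) * μ * ρ) *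
      (2 ^ (-1 * μ * ρ) * cellNorm r p t 0 f ^ μ +
        ∑ j ∈ Finset.range (k + 1), 2 ^ ((j : ℝ) * μ * ρ) * x j ^ μ)) ?_ fun S => ?_
    · refine (ENNReal.continuous_const_mul (ENNReal.mul_ne_top hK (two_rpow_ne_top _))).comp
        (continuous_const.add (continuous_finsetSum _ fun j _ =>
          (ENNReal.continuous_const_mul (two_rpow_ne_top _)).comp
            (ENNReal.continuous_rpow_const.comp (continuous_apply j))))
    · exact h.diffNorm_rpow_le_sum_cellNorm hf (fun j => (S j).2) hμ hμ1 hμr hμp k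
  have hroot := ENNReal.rpow_le_rpow hpow (by positivity : 0 ≤ 1 / μ)
  rwa [ENNReal.mul_rpow_of_nonneg _ _ (by positivity), ENNReal.mul_rpow_of_nonneg _ _
    (by positivity), ← ENNReal.rpow_mul, ← ENNReal.rpow_mul, mul_one_div_cancel hμ.ne',
    ENNReal.rpow_one, show -(k : ℝ) * μ * ρ * (1 / μ) = -(k : ℝ) * ρ by field_simp] at hroot

theorem MemLpLoc.aemeasurable {f : (Fin n → ℝ) → ℝ} (h : MemLpLoc f r) :
    AEMeasurable f volume := by
  rw [← Measure.restrict_univ (μ := volume), ← Metric.iUnion_closedBall_nat (0 : Fin n → ℝ)]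
  exact aemeasurable_iUnion_iff.2 fun N => (h _ (isCompact_closedBall _ _)).1.aemeasurable

theorem exists_telescopeBounds_tSeq {d : ℕ} {γ : (Fin n ⊕ Fin d → ℝ) → ℝ} (hd : 0 < d) (hl : 0 < l)
    (hp : 0 < p) (hr : 0 < r) (hγ : 0 ≤ γ) (hγp : ALocInfty fun z => γ z ^ p) (α₂ α₃ C₁ : ℝ)
    {ε : ℝ} (hε : 0 < ε) :
    ∃ A B E : ℝ≥0, ∀ s : ℕ → (Fin n → ℝ) → ℝ, LocYUpper α₂ α₃ C₁ s →
      TelescopeBounds hl r p (tSeq s γ p) (rate l p α₂ ε γ) A B E := by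
  obtain ⟨A, hA⟩ := exists_diffNorm_le_cellNorm (n := n) hd hp hγ hγp α₂ α₃ C₁ l hr
  obtain ⟨B, hB⟩ := exists_diffNorm_spline_le (n := n) hd hp hγ hγp α₂ α₃ C₁ hl hr hε
  obtain ⟨E, hE⟩ := exists_cellNorm_succ_le (n := n) hd hp hγ hγp α₂ α₃ C₁ r
  exact ⟨A, B, E, fun s hs => ⟨hA s hs, hB s hs, hE s hs⟩⟩

end BestApproximation

end VarSmooth

theorem theorem4p1_general (n d l : ℕ) (hd : 0 < d) (hl : 0 < l)
    (p r : ℝ) (hp : 0 < p) (hr : 0 < r) (α₂ α₃ : ℝ)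
    (γ : (Fin n ⊕ Fin d → ℝ) → ℝ) (hγ : 0 ≤ γ) (hγp : VarSmooth.ALocInfty fun z => γ z ^ p)
    (ε : ℝ) (hε : 0 < ε) (C₁ : ℝ) :
    ∃ C : ℝ≥0, 0 < C ∧
      ∀ s : ℕ → (Fin n → ℝ) → ℝ, VarSmooth.LocYUpper α₂ α₃ C₁ s →
      ∀ μ : ℝ, 0 < μ → μ ≤ min 1 (min r p) →
      ∀ φ : (Fin n → ℝ) → ℝ, AEMeasurable φ volume →
      ∀ k : ℕ,
        (∑' m : Fin n → ℤ,
            VarSmooth.tSeq s γ p k m ^ p * VarSmooth.dyadicDiff l r k m φ ^ p) ^ (1 / p) ≤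
          (C : ℝ≥0∞) * (2 : ℝ≥0∞) ^ (-(k : ℝ) * VarSmooth.rate l p α₂ ε γ) *
            ((2 : ℝ≥0∞) ^ (-1 * μ * VarSmooth.rate l p α₂ ε γ) *
                VarSmooth.splineErrorInit r p (VarSmooth.tSeq s γ p) φ ^ μ +
              ∑ j ∈ Finset.range (k + 1),
                (2 : ℝ≥0∞) ^ ((j : ℝ) * μ * VarSmooth.rate l p α₂ ε γ) *
                  VarSmooth.splineError l r p (VarSmooth.tSeq s γ p) φ j ^ μ) ^ (1 / μ) := by
  have hμ₀ : 0 < min 1 (min r p) := lt_min one_pos (lt_min hr hp)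
  obtain ⟨A, B, E, hABE⟩ :=
    VarSmooth.exists_telescopeBounds_tSeq hd hl hp hr hγ hγp α₂ α₃ C₁ hε
  obtain ⟨C, hC⟩ := VarSmooth.TelescopeBounds.exists_diffNorm_le_approxSum (n := n) hl hμ₀
    (min_le_left _ _) ((min_le_right _ _).trans (min_le_left _ _))
    ((min_le_right _ _).trans (min_le_right _ _)) (VarSmooth.rate l p α₂ ε γ) A B E
  refine ⟨C + 1, by positivity, fun s hs μ hμ hμle φ ⟨ψ, hψ, hφψ⟩ k => ?_⟩
  set t := VarSmooth.tSeq s γ p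
  set ρ := VarSmooth.rate l p α₂ ε γ
  change VarSmooth.diffNorm l r p t k φ ≤ _ * VarSmooth.approxSum l r p t ρ μ φ k
  rw [VarSmooth.diffNorm_congr hφψ, VarSmooth.approxSum_congr hφψ]
  refine (hC t (hABE s hs) ψ hψ k).trans (mul_le_mul' (mul_le_mul' ?_ le_rfl) ?_)
  · exact ENNReal.coe_le_coe.2 (le_add_of_nonneg_right zero_le_one)
  · exact VarSmooth.approxSum_anti ρ hμ hμle ψ k

theorem theorem4p1 (n d l : ℕ) (hn : 0 < n) (hd : 0 < d) (hl : 0 < l)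
    (p r : ℝ) (hp : 0 < p) (hr : 0 < r)
    (α₁ α₂ α₃ : ℝ) (hα₁ : 0 < α₁) (hα₁₂ : α₁ ≤ α₂) (hα₃ : 0 ≤ α₃)
    (γ : (Fin n ⊕ Fin d → ℝ) → ℝ) (hγ : VarSmooth.IsWeight γ)
    (hγp : VarSmooth.ALocInfty (fun z => γ z ^ p))
    (ε : ℝ) (hε : 0 < ε) (C₁ : ℝ) (hC₁ : 0 < C₁) :
    ∃ C : NNReal, 0 < C ∧
      ∀ s : ℕ → (Fin n → ℝ) → ℝ, VarSmooth.LocY α₁ α₂ α₃ C₁ s →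
      ∀ μ : ℝ, 0 < μ → μ ≤ min 1 (min r p) →
      ∀ φ : (Fin n → ℝ) → ℝ, VarSmooth.MemLpLoc φ r →
      ∀ k : ℕ,
        (∑' m : Fin n → ℤ,
            VarSmooth.tSeq s γ p k m ^ p * VarSmooth.dyadicDiff l r k m φ ^ p) ^ (1 / p) ≤
          (C : ENNReal) * (2 : ENNReal) ^ (-(k : ℝ) * VarSmooth.rate l p α₂ ε γ) *
            ((2 : ENNReal) ^ (-1 * μ * VarSmooth.rate l p α₂ ε γ) *
                VarSmooth.splineErrorInit r p (VarSmooth.tSeq s γ p) φ ^ μ +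
              ∑ j ∈ Finset.range (k + 1),
                (2 : ENNReal) ^ ((j : ℝ) * μ * VarSmooth.rate l p α₂ ε γ) *
                  VarSmooth.splineError l r p (VarSmooth.tSeq s γ p) φ j ^ μ) ^ (1 / μ) := by
  obtain ⟨C, hC, h⟩ := theorem4p1_general n d l hd hl p r hp hr α₂ α₃ γ (fun z => (hγ.2 z).le)
    hγp ε hε C₁
  exact ⟨C, hC, fun s hs μ hμ hμle φ hφ => h s hs.locYUpper μ hμ hμle φ hφ.aemeasurable⟩
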